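/- Consider the stationary incompressible Navier–Stokes equations in $\mathbb R^3$, $$-\Delta u+u\cdot\nabla u+\nabla p=0,\qquad \operatorname{div}u=0. \tag{1}$$ Use polar coordinates $(r,\theta,\phi)$, with $\theta$ the angle to the positive $x_3$-axis, $\phi$ the meridian angle and orthonormal frame $e_r,e_\theta,e_\phi$, and write $u=u_re_r+u_\theta e_\theta+u_\phi e_\phi$. Let $S=(0,0,-1)$ be the south pole of $\mathbb S^2$. By an axisymmetric solution of (1) in $C^\infty(\mathbb S^2\setminus\{S\})$ we mean a pair $(u,p)$ of $C^\infty$ functions on $\mathbb R^3\setminus\{(0,0,x_3): x_3\le 0\}$ satisfying (1) there, where $u$ is $(-1)$-homogeneous, $p$ is $(-2)$-homogeneous, and $u_r,u_\theta,u_\phi$ do not depend on $\phi$. For such a solution put, on the unit sphere and with $x=\cos\theta$, $U_\theta(x)=u_\theta\sin\theta$ and $U_\phi(x)=u_\phi\sin\theta$ for $-1<x\le 1$, and $U_\theta(-1):=\lim_{x\to-1^+}U_\theta(x)$; the solution has zero swirl if $U_\phi\equiv0$, and nonzero swirl otherwise. (a) For every real $\tau<3$ there exists an axisymmetric solution of (1)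 in $C^\infty(\mathbb S^2\setminus\{S\})$ with nonzero swirl and $U_\theta(-1)=\tau$. (b) For every axisymmetric solution of (1) in $C^\infty(\mathbb S^2\setminus\{S\})$ the limit $U_\theta(-1)$ exists and is finite, and if $U_\theta(-1)\ge3$, then the solution has zero swirl, i.e. $U_\phi\equiv0$. -/

import Mathlib

open Set Filter Topology
open scoped ContDiff

noncomputable section

namespace AxisymNS

/-- Euclidean three-space. -/
abbrev R3 : Type := EuclideanSpace ℝ (Fin 3)

/-- The cone over the unit sphere minus its south pole: `ℝ³ ∖ {(0, 0, x₃) | x₃ ≤ 0}`. -/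
def slitSpace : Set R3 := {y | ¬ (y 0 = 0 ∧ y 1 = 0 ∧ y 2 ≤ 0)}

/-- The radial unit vector of the polar frame. -/
def eR (θ φ : ℝ) : R3 :=
  !₂[Real.sin θ * Real.cos φ, Real.sin θ * Real.sin φ, Real.cos θ]

/-- The polar unit vector of the polar frame. -/
def eTheta (θ φ : ℝ) : R3 :=
  !₂[Real.cos θ * Real.cos φ, Real.cos θ * Real.sin φ, -Real.sin θ]

/-- The azimuthal unit vector of the polar frame. -/
def ePhi (φ : ℝ) : R3 := !₂[-Real.sin φ, Real.cos φ, 0]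

/-- The component `u_r` at the point with polar coordinates `(r, θ, φ)`. -/
def compR (u : R3 → R3) (r θ φ : ℝ) : ℝ := inner ℝ (u (r • eR θ φ)) (eR θ φ)

/-- The component `u_θ` at the point with polar coordinates `(r, θ, φ)`. -/
def compTheta (u : R3 → R3) (r θ φ : ℝ) : ℝ := inner ℝ (u (r • eR θ φ)) (eTheta θ φ)

/-- The component `u_φ` at the point with polar coordinates `(r, θ, φ)`. -/
def compPhi (u : R3 → R3) (r θ φ : ℝ) : ℝ := inner ℝ (u (r • eR θ φ)) (ePhi φ)

/-- The polar components of `u` depend only on `r` and `θ`. -/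
def IsAxisymmetric (u : R3 → R3) : Prop :=
  ∀ r : ℝ, 0 < r → ∀ θ ∈ Ioo 0 Real.pi, ∀ φ φ' : ℝ,
    compR u r θ φ = compR u r θ φ' ∧
    compTheta u r θ φ = compTheta u r θ φ' ∧
    compPhi u r θ φ = compPhi u r θ φ'

/-- The divergence `∑ᵢ ∂ᵢ uᵢ`. -/
def divergence (u : R3 → R3) (y : R3) : ℝ :=
  ∑ i : Fin 3, fderiv ℝ u y (EuclideanSpace.single i 1) i

/-- The stationary incompressible Navier–Stokes equations at every point of `D`:
`-Δu + (u · ∇)u + ∇p = 0` and `div u = 0`. -/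
def SolvesNavierStokes (u : R3 → R3) (p : R3 → ℝ) (D : Set R3) : Prop :=
  ∀ y ∈ D, -Laplacian.laplacian u y + fderiv ℝ u y (u y) + gradient p y = 0 ∧
    divergence u y = 0

/-- `(u, p)` is an axisymmetric solution in `C^∞(𝕊² ∖ {S})`: the velocity is `(-1)`-homogeneous and
axisymmetric, the pressure is `(-2)`-homogeneous, both are smooth away from the closed negative
`x₃`-axis, and they satisfy the stationary Navier–Stokes equations there. -/
structure IsAxisymmetricSolution (u : R3 → R3) (p : R3 → ℝ) : Prop where
  smooth_velocity : ContDiffOn ℝ ∞ u slitSpace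
  smooth_pressure : ContDiffOn ℝ ∞ p slitSpace
  homogeneous_velocity : ∀ y ∈ slitSpace, ∀ c : ℝ, 0 < c → u (c • y) = c⁻¹ • u y
  homogeneous_pressure : ∀ y ∈ slitSpace, ∀ c : ℝ, 0 < c → p (c • y) = (c ^ 2)⁻¹ * p y
  axisymmetric : IsAxisymmetric u
  equations : SolvesNavierStokes u p slitSpace

/-- `U_θ = u_θ sin θ` on the unit sphere, as a function of `x = cos θ`. For axisymmetric `u` the
value does not depend on the meridian, which is taken to be `φ = 0`. -/
def UTheta (u : R3 → R3) (x : ℝ) : ℝ :=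
  compTheta u 1 (Real.arccos x) 0 * Real.sin (Real.arccos x)

/-- `U_φ = u_φ sin θ` on the unit sphere, as a function of `x = cos θ`. -/
def UPhi (u : R3 → R3) (x : ℝ) : ℝ :=
  compPhi u 1 (Real.arccos x) 0 * Real.sin (Real.arccos x)

/-- `U_θ(-1) = a`, that is, `U_θ(x) → a` as `x → -1⁺`. -/
def UThetaAtSouth (u : R3 → R3) (a : ℝ) : Prop :=
  Tendsto (UTheta u) (𝓝[>] (-1)) (𝓝 a)

end AxisymNS

end

/-! In the variable `x = cos θ`, an axisymmetric solution is described by `f = U_θ` and `g = U_φ`.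
The swirl equation is of first order and linear in `g'`, so that `g'` has a sign; as `g` vanishes at
the north pole, `g g' ≤ 0`. Hence the third derivative `-2 g g' / (1 - x²)` of the Riccati form
`(1 - x²) f' + 2 x f + f² / 2` is nonnegative, which controls the inhomogeneity of the Riccati
equation near the south pole well enough for `f` to have a limit there. If the limit is at least
`3`, the swirl equation makes `g'` grow so fast that the Riccati form diverges, unless `g'` vanishes
identically.

Conversely, for `τ < 3` we integrate the Riccati equation three times from the north pole and solve
the resulting first-order equation for `f = (1 - x) (τ / 2 + w)` by a contraction argument, for a
small multiple of the swirl and in a space of functions that vanish like a power of `1 + x` at the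
south pole. -/

noncomputable section

namespace AxisymNS

/-! ### One-sided calculus at an end point -/

lemma contDiffOn_deriv {φ : ℝ → ℝ} {s : Set ℝ} (h : ContDiffOn ℝ ∞ φ s) (hs : IsOpen s) :
    ContDiffOn ℝ ∞ (deriv φ) s :=
  ((contDiffOn_infty_iff_deriv_of_isOpen hs).1 h).2

lemma differentiableAt_of_contDiffOn {E G : Type*} [NormedAddCommGroup E] [NormedSpace ℝ E]
    [NormedAddCommGroup G] [NormedSpace ℝ G] {φ : E → G} {s : Set E} (h : ContDiffOn ℝ ∞ φ s)
    (hs : IsOpen s) {x : E} (hx : x ∈ s) : DifferentiableAt ℝ φ x :=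
  (h.differentiableOn (by simp)).differentiableAt (hs.mem_nhds hx)

lemma contDiffAt_two_of_contDiffOn {E G : Type*} [NormedAddCommGroup E] [NormedSpace ℝ E]
    [NormedAddCommGroup G] [NormedSpace ℝ G] {φ : E → G} {s : Set E} (h : ContDiffOn ℝ ∞ φ s)
    (hs : IsOpen s) {x : E} (hx : x ∈ s) : ContDiffAt ℝ 2 φ x :=
  (h.contDiffAt (hs.mem_nhds hx)).of_le (WithTop.coe_le_coe.2 le_top)

lemma hasDerivAt_of_contDiffOn {φ : ℝ → ℝ} {s : Set ℝ} (h : ContDiffOn ℝ ∞ φ s) (hs : IsOpen s)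
    {x : ℝ} (hx : x ∈ s) : HasDerivAt φ (deriv φ x) x :=
  (differentiableAt_of_contDiffOn h hs hx).hasDerivAt

lemma monotoneOn_of_hasDerivAt_nonneg {φ φ' : ℝ → ℝ} {s : Set ℝ} (hs : Convex ℝ s)
    (hd : ∀ y ∈ s, HasDerivAt φ (φ' y) y) (hφ' : ∀ y ∈ s, 0 ≤ φ' y) : MonotoneOn φ s :=
  monotoneOn_of_hasDerivWithinAt_nonneg hs
    (fun y hy => (hd y hy).continuousAt.continuousWithinAt)
    (fun y hy => (hd y (interior_subset hy)).hasDerivWithinAt)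
    (fun y hy => hφ' y (interior_subset hy))

lemma antitoneOn_of_hasDerivAt_nonpos {φ φ' : ℝ → ℝ} {s : Set ℝ} (hs : Convex ℝ s)
    (hd : ∀ y ∈ s, HasDerivAt φ (φ' y) y) (hφ' : ∀ y ∈ s, φ' y ≤ 0) : AntitoneOn φ s :=
  antitoneOn_of_hasDerivWithinAt_nonpos hs
    (fun y hy => (hd y hy).continuousAt.continuousWithinAt)
    (fun y hy => (hd y (interior_subset hy)).hasDerivWithinAt)
    (fun y hy => hφ' y (interior_subset hy))

lemma le_of_deriv_pos_of_eq {φ φ' : ℝ → ℝ} {a b c : ℝ}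
    (hd : ∀ y ∈ Ioc a b, HasDerivAt φ (φ' y) y) (hb : φ b ≤ c)
    (hpos : ∀ y ∈ Ioc a b, φ y = c → 0 < φ' y) : ∀ y ∈ Ioc a b, φ y ≤ c := by
  intro y hy
  have hmem : ∀ t ∈ Icc (-b) (-y), -t ∈ Ioc a b := fun t ht =>
    ⟨by linarith [ht.2, hy.1], by linarith [ht.1]⟩
  have hder : ∀ t ∈ Icc (-b) (-y), HasDerivAt (fun t => φ (-t)) (-φ' (-t)) t := fun t ht =>
    ((hd _ (hmem t ht)).scomp t (hasDerivAt_neg t)).congr_deriv (by simp)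
  have hle := image_le_of_deriv_right_lt_deriv_boundary' (f := fun t => φ (-t))
    (f' := fun t => -φ' (-t)) (a := -b) (b := -y) (B := fun _ => c) (B' := fun _ => 0)
    (fun t ht => (hder t ht).continuousAt.continuousWithinAt)
    (fun t ht => (hder t (Ico_subset_Icc_self ht)).hasDerivWithinAt)
    (by simpa using hb) continuousOn_const (fun t _ => hasDerivWithinAt_const _ _ _)
    (fun t ht he => neg_neg_of_pos (hpos _ (hmem t (Ico_subset_Icc_self ht)) he))
    (x := -y) ⟨neg_le_neg hy.2, le_rfl⟩
  simpa using hle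

lemma exists_Ioc_of_eventually_nhdsGT {p : ℝ → Prop} {a d : ℝ} (had : a < d)
    (h : ∀ᶠ y in 𝓝[>] a, p y) : ∃ b ∈ Ioc a d, ∀ y ∈ Ioc a b, p y := by
  obtain ⟨c, hc, hcp⟩ := mem_nhdsGT_iff_exists_Ioc_subset.1 h
  exact ⟨min c d, ⟨lt_min hc had, min_le_right _ _⟩,
    fun y hy => hcp ⟨hy.1, hy.2.trans (min_le_left _ _)⟩⟩

lemma exists_lt_of_mul_deriv_le {φ φ' : ℝ → ℝ} {b η : ℝ} (hb : 0 < b) (hη : 0 < η)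
    (hd : ∀ y ∈ Ioc 0 b, HasDerivAt φ (φ' y) y) (hφ' : ∀ y ∈ Ioc 0 b, y * φ' y ≤ -η) (C : ℝ) :
    ∃ y ∈ Ioc 0 b, C < φ y := by
  have hanti : AntitoneOn (fun y => φ y + η * Real.log y) (Ioc 0 b) := by
    refine antitoneOn_of_hasDerivAt_nonpos (convex_Ioc 0 b)
      (fun y hy => (hd y hy).add ((Real.hasDerivAt_log hy.1.ne').const_mul η)) fun y hy => ?_
    have hscaled : y * (φ' y + η * y⁻¹) ≤ 0 := by
      rw [mul_add, mul_comm η, mul_inv_cancel_left₀ hy.1.ne']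
      linarith [hφ' y hy]
    exact nonpos_of_mul_nonpos_right hscaled hy.1
  have hlog : Tendsto (fun y => η * Real.log y) (𝓝[>] 0) atBot :=
    Real.tendsto_log_nhdsGT_zero.const_mul_atBot hη
  obtain ⟨y, hlt, hy⟩ := ((hlog.eventually_lt_atBot (φ b + η * Real.log b - C)).and
    (Ioc_mem_nhdsGT hb)).exists
  have hle : φ b + η * Real.log b ≤ φ y + η * Real.log y := hanti hy ⟨hb, le_rfl⟩ hy.2
  exact ⟨y, hy, by linarith⟩

lemma nonneg_of_tendsto_mul_deriv {φ φ' : ℝ → ℝ} {b a μ : ℝ} (hb : 0 < b)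
    (hd : ∀ y ∈ Ioc 0 b, HasDerivAt φ (φ' y) y) (ha : Tendsto φ (𝓝[>] 0) (𝓝 a))
    (hμ : Tendsto (fun y => y * φ' y) (𝓝[>] 0) (𝓝 μ)) : 0 ≤ μ := by
  by_contra! hneg
  obtain ⟨d, hd', hev⟩ := exists_Ioc_of_eventually_nhdsGT hb
    ((hμ.eventually_lt_const (show μ < μ / 2 by linarith)).and
      (ha.eventually_lt_const (lt_add_one a)))
  obtain ⟨y, hy, hlt⟩ := exists_lt_of_mul_deriv_le (η := -(μ / 2)) hd'.1 (by linarith)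
    (fun y hy => hd y (Ioc_subset_Ioc_right hd'.2 hy)) (fun y hy => by linarith [(hev y hy).1])
    (a + 1)
  exact hlt.not_gt (hev y hy).2

lemma eq_zero_of_tendsto_mul_deriv {φ φ' : ℝ → ℝ} {b a μ : ℝ} (hb : 0 < b)
    (hd : ∀ y ∈ Ioc 0 b, HasDerivAt φ (φ' y) y) (ha : Tendsto φ (𝓝[>] 0) (𝓝 a))
    (hμ : Tendsto (fun y => y * φ' y) (𝓝[>] 0) (𝓝 μ)) : μ = 0 := by
  refine le_antisymm (neg_nonneg.1 ?_) (nonneg_of_tendsto_mul_deriv hb hd ha hμ)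
  exact nonneg_of_tendsto_mul_deriv hb (fun y hy => (hd y hy).neg) ha.neg
    (hμ.neg.congr fun y => (mul_neg _ _).symm)

lemma exists_hasDerivAt_of_continuousOn_Ioo {φ : ℝ → ℝ} {a b c : ℝ} (hc : c ∈ Ioo a b)
    (hφ : ContinuousOn φ (Ioo a b)) : ∃ Φ : ℝ → ℝ, ∀ x ∈ Ioo a b, HasDerivAt Φ (φ x) x := by
  refine ⟨fun x => ∫ t in c..x, φ t, fun x hx => ?_⟩
  have hsub : uIcc c x ⊆ Ioo a b := ordConnected_Ioo.uIcc_subset hc hx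
  exact intervalIntegral.integral_hasDerivAt_right (hφ.mono hsub).intervalIntegrable
    (hφ.stronglyMeasurableAtFilter isOpen_Ioo x hx) (hφ.continuousAt (isOpen_Ioo.mem_nhds hx))

lemma exists_eq_mul_exp_of_deriv_eq_mul {w φ : ℝ → ℝ} {a b c : ℝ} (hc : c ∈ Ioo a b)
    (hφ : ContinuousOn φ (Ioo a b)) (hw : ∀ x ∈ Ioo a b, HasDerivAt w (φ x * w x) x) :
    ∃ Φ : ℝ → ℝ, ∀ x ∈ Ioo a b, w x = w c * Real.exp (Φ x) := by
  obtain ⟨Φ, hΦ⟩ := exists_hasDerivAt_of_continuousOn_Ioo hc hφ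
  refine ⟨fun x => Φ x - Φ c, fun x hx => ?_⟩
  have hd : ∀ x ∈ Ioo a b, HasDerivAt (fun x => w x * Real.exp (-Φ x)) 0 x := fun x hx =>
    ((hw x hx).fun_mul (hΦ x hx).fun_neg.exp).congr_deriv (by ring)
  have hconst : w x * Real.exp (-Φ x) = w c * Real.exp (-Φ c) :=
    isOpen_Ioo.is_const_of_deriv_eq_zero isPreconnected_Ioo
      (fun x hx => (hd x hx).differentiableAt.differentiableWithinAt)
      (fun x hx => (hd x hx).deriv) hx hc
  change w x = w c * Real.exp (Φ x - Φ c)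
  rw [sub_eq_neg_add, Real.exp_add, ← mul_assoc, ← hconst, mul_assoc, ← Real.exp_add,
    neg_add_cancel, Real.exp_zero, mul_one]

/-- `h₁`, `h₂`, `h₃` are the first three derivatives of `h` on `s`. -/
structure HasThreeDerivsOn (h h₁ h₂ h₃ : ℝ → ℝ) (s : Set ℝ) : Prop where
  first : ∀ y ∈ s, HasDerivAt h (h₁ y) y
  second : ∀ y ∈ s, HasDerivAt h₁ (h₂ y) y
  third : ∀ y ∈ s, HasDerivAt h₂ (h₃ y) y

namespace HasThreeDerivsOn

variable {h h₁ h₂ h₃ k k₁ k₂ k₃ : ℝ → ℝ} {s t : Set ℝ} {b : ℝ}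

lemma mono (H : HasThreeDerivsOn h h₁ h₂ h₃ s) (hts : t ⊆ s) : HasThreeDerivsOn h h₁ h₂ h₃ t :=
  ⟨fun y hy => H.first y (hts hy), fun y hy => H.second y (hts hy),
    fun y hy => H.third y (hts hy)⟩

lemma sub (H : HasThreeDerivsOn h h₁ h₂ h₃ s) (K : HasThreeDerivsOn k k₁ k₂ k₃ s) :
    HasThreeDerivsOn (h - k) (h₁ - k₁) (h₂ - k₂) (h₃ - k₃) s :=
  ⟨fun y hy => (H.first y hy).sub (K.first y hy), fun y hy => (H.second y hy).sub (K.second y hy),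
    fun y hy => (H.third y hy).sub (K.third y hy)⟩

lemma of_contDiffOn (hh : ContDiffOn ℝ ∞ h s) (hs : IsOpen s) :
    HasThreeDerivsOn h (deriv h) (deriv (deriv h)) (deriv (deriv (deriv h))) s :=
  have hh₁ := contDiffOn_deriv hh hs
  ⟨fun _ => hasDerivAt_of_contDiffOn hh hs, fun _ => hasDerivAt_of_contDiffOn hh₁ hs,
    fun _ => hasDerivAt_of_contDiffOn (contDiffOn_deriv hh₁ hs) hs⟩

lemma comp_sub_const (H : HasThreeDerivsOn h h₁ h₂ h₃ s) (c : ℝ) :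
    HasThreeDerivsOn (fun y => h (y - c)) (fun y => h₁ (y - c)) (fun y => h₂ (y - c))
      (fun y => h₃ (y - c)) ((· - c) ⁻¹' s) :=
  ⟨fun y hy => (H.first _ hy).comp_sub_const y c, fun y hy => (H.second _ hy).comp_sub_const y c,
    fun y hy => (H.third _ hy).comp_sub_const y c⟩

lemma const_mul_log (c : ℝ) :
    HasThreeDerivsOn (fun y => c * Real.log y) (fun y => c * y⁻¹) (fun y => c * -(y ^ 2)⁻¹)
      (fun y => 2 * c / y ^ 3) (Ioi 0) where
  first y hy := (Real.hasDerivAt_log hy.ne').const_mul c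
  second y hy := (hasDerivAt_inv hy.ne').const_mul c
  third y hy := by
    have hy0 : y ≠ 0 := hy.ne'
    refine ((((hasDerivAt_pow 2 y).fun_inv (pow_ne_zero 2 hy0)).fun_neg).const_mul c).congr_deriv ?_
    field_simp
    norm_num
    ring

/-- The quadratic polynomial is a Taylor polynomial of `h` at the right end point. -/
lemma exists_monotoneOn_sub_quadratic (H : HasThreeDerivsOn h h₁ h₂ h₃ (Ioc 0 b)) (hb : 0 < b)
    (h₃nn : ∀ y ∈ Ioc 0 b, 0 ≤ h₃ y) :
    ∃ k l : ℝ, MonotoneOn (fun y => h y - (k * y ^ 2 + l * y)) (Ioc 0 b) := by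
  have hbb : b ∈ Ioc 0 b := ⟨hb, le_rfl⟩
  have mono_second : MonotoneOn h₂ (Ioc 0 b) :=
    monotoneOn_of_hasDerivAt_nonneg (convex_Ioc 0 b) H.third h₃nn
  have anti_first : AntitoneOn (fun y => h₁ y - h₂ b * y) (Ioc 0 b) :=
    antitoneOn_of_hasDerivAt_nonpos (φ' := fun y => h₂ y - h₂ b * 1) (convex_Ioc 0 b)
      (fun y hy => (H.second y hy).fun_sub ((hasDerivAt_id' y).const_mul (h₂ b)))
      (fun y hy => by linarith [mono_second hy hbb hy.2])
  refine ⟨h₂ b / 2, h₁ b - h₂ b * b, ?_⟩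
  refine monotoneOn_of_hasDerivAt_nonneg
    (φ' := fun y => h₁ y - (h₂ b / 2 * (2 * y) + (h₁ b - h₂ b * b))) (convex_Ioc 0 b)
    (fun y hy => ?_) (fun y hy => ?_)
  · have hquad := ((hasDerivAt_pow 2 y).const_mul (h₂ b / 2)).fun_add
      ((hasDerivAt_id' y).const_mul (h₁ b - h₂ b * b))
    exact ((H.first y hy).fun_sub hquad).congr_deriv (by simp)
  · have hle : h₁ b - h₂ b * b ≤ h₁ y - h₂ b * y := anti_first hy hbb hy.2
    linarith

lemma exists_le (H : HasThreeDerivsOn h h₁ h₂ h₃ (Ioc 0 b)) (hb : 0 < b)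
    (h₃nn : ∀ y ∈ Ioc 0 b, 0 ≤ h₃ y) : ∃ C, ∀ y ∈ Ioc 0 b, h y ≤ C := by
  obtain ⟨k, l, hmono⟩ := H.exists_monotoneOn_sub_quadratic hb h₃nn
  refine ⟨h b - (k * b ^ 2 + l * b) + (|k| * b ^ 2 + |l| * b), fun y hy => ?_⟩
  have hle : h y - (k * y ^ 2 + l * y) ≤ h b - (k * b ^ 2 + l * b) := hmono hy ⟨hb, le_rfl⟩ hy.2
  have hk : k * y ^ 2 ≤ |k| * b ^ 2 :=
    mul_le_mul (le_abs_self k) (pow_le_pow_left₀ hy.1.le hy.2 2) (by positivity) (abs_nonneg k)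
  have hl : l * y ≤ |l| * b := mul_le_mul (le_abs_self l) hy.2 hy.1.le (abs_nonneg l)
  linarith

/-- Subtracting `ε / 2 * log y` leaves a nonnegative third derivative. -/
lemma exists_lt_of_div_cube_le (H : HasThreeDerivsOn h h₁ h₂ h₃ (Ioc 0 b)) (hb : 0 < b) {ε : ℝ}
    (hε : 0 < ε) (hle : ∀ y ∈ Ioc 0 b, ε / y ^ 3 ≤ h₃ y) (B : ℝ) : ∃ y ∈ Ioc 0 b, h y < B := by
  obtain ⟨C, hC⟩ := (H.sub ((const_mul_log (ε / 2)).mono Ioc_subset_Ioi_self)).exists_le hb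
    fun y hy => by
      rw [Pi.sub_apply, mul_div_cancel₀ ε two_ne_zero]
      exact sub_nonneg.2 (hle y hy)
  have hlog : Tendsto (fun y => ε / 2 * Real.log y) (𝓝[>] 0) atBot :=
    Real.tendsto_log_nhdsGT_zero.const_mul_atBot (half_pos hε)
  obtain ⟨y, hlt, hy⟩ := ((hlog.eventually_lt_atBot (B - C)).and (Ioc_mem_nhdsGT hb)).exists
  have hCy : h y - ε / 2 * Real.log y ≤ C := hC y hy
  exact ⟨y, hy, by linarith⟩

end HasThreeDerivsOn

lemma abs_quadratic_le (k l : ℝ) {y : ℝ} (hy : y ∈ Icc (0 : ℝ) 1) :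
    |k * y ^ 2 + l * y| ≤ (|k| + |l|) * y :=
  calc |k * y ^ 2 + l * y| ≤ |k * y ^ 2| + |l * y| := abs_add_le _ _
    _ = |k| * y ^ 2 + |l| * y := by
      rw [abs_mul, abs_mul, abs_of_nonneg hy.1, abs_of_nonneg (sq_nonneg y)]
    _ ≤ |k| * y + |l| * y := by
      gcongr
      exact pow_le_of_le_one hy.1 hy.2 two_ne_zero
    _ = (|k| + |l|) * y := by ring

lemma exists_tendsto_of_monotoneOn_sub_quadratic {h : ℝ → ℝ} {k l A : ℝ}
    (hmono : MonotoneOn (fun y => h y - (k * y ^ 2 + l * y)) (Ioc 0 1))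
    (hA : ∀ y ∈ Ioc (0 : ℝ) 1, A ≤ h y - (k * y ^ 2 + l * y)) :
    ∃ L C : ℝ, 0 ≤ C ∧ Tendsto h (𝓝[>] 0) (𝓝 L) ∧ ∀ y ∈ Ioc (0 : ℝ) 1, L - C * y ≤ h y := by
  have hbdd : BddBelow ((fun y => h y - (k * y ^ 2 + l * y)) '' Ioo 0 1) :=
    ⟨A, forall_mem_image.2 fun y hy => hA y (Ioo_subset_Ioc_self hy)⟩
  have hlim := (hmono.mono Ioo_subset_Ioc_self).tendsto_nhdsWithin_Ioo_right
    (nonempty_Ioo.2 one_pos) hbdd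
  set L := sInf ((fun y => h y - (k * y ^ 2 + l * y)) '' Ioo 0 1)
  have hquad : Tendsto (fun y : ℝ => k * y ^ 2 + l * y) (𝓝[>] 0) (𝓝 0) := by
    have hcont : Continuous fun y : ℝ => k * y ^ 2 + l * y := by fun_prop
    simpa using (hcont.tendsto 0).mono_left nhdsWithin_le_nhds
  refine ⟨L, |k| + |l|, by positivity, by simpa using hlim.add hquad, fun y hy => ?_⟩
  have hle : L ≤ h y - (k * y ^ 2 + l * y) := by
    have hhalf : y / 2 ∈ Ioo (0 : ℝ) 1 := ⟨by linarith [hy.1], by linarith [hy.2]⟩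
    exact (csInf_le hbdd ⟨y / 2, hhalf, rfl⟩).trans
      (hmono (Ioo_subset_Ioc_self hhalf) hy (by linarith [hy.1]))
  linarith [(abs_le.1 (abs_quadratic_le k l (Ioc_subset_Icc_self hy))).1]

/-! ### The Riccati equation near the south pole -/

/-- Right-hand side of the Riccati equation `y (2 - y) F' = 2 (1 - y) F - F² / 2 + h` satisfied by
`U_θ` in the variable `y = 1 + x`, which is the distance to the south pole. -/
def riccatiRHS (h : ℝ → ℝ) (y v : ℝ) : ℝ := 2 * (1 - y) * v - v ^ 2 / 2 + h y

/-- `F` solves the Riccati equation with inhomogeneity `h` on `(0, 1]`. -/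
def IsRiccatiSolution (h F : ℝ → ℝ) : Prop :=
  ∀ y ∈ Ioc (0 : ℝ) 1, HasDerivAt F (riccatiRHS h y (F y) / (y * (2 - y))) y

lemma mul_two_sub_pos {y : ℝ} (hy : y ∈ Ioc (0 : ℝ) 1) : 0 < y * (2 - y) :=
  mul_pos hy.1 (by linarith [hy.2])

lemma mul_div_mul_two_sub_le {y v ε : ℝ} (hy : y ∈ Ioc (0 : ℝ) 1) (hε : 0 ≤ ε)
    (hv : v ≤ -(2 * ε)) : y * (v / (y * (2 - y))) ≤ -ε := by
  have h2y : 0 < 2 - y := by linarith [hy.2]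
  rw [← mul_div_assoc, mul_div_mul_left _ _ hy.1.ne', div_le_iff₀ h2y]
  nlinarith [hy.1]

lemma tendsto_riccatiRHS {h φ : ℝ → ℝ} {L a : ℝ} (hL : Tendsto h (𝓝[>] 0) (𝓝 L))
    (ha : Tendsto φ (𝓝[>] 0) (𝓝 a)) :
    Tendsto (fun y => riccatiRHS h y (φ y)) (𝓝[>] 0) (𝓝 (2 * a - a ^ 2 / 2 + L)) := by
  have hid : Tendsto (fun y : ℝ => y) (𝓝[>] 0) (𝓝 0) := tendsto_id.mono_left nhdsWithin_le_nhds
  simpa [riccatiRHS] using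
    ((((hid.const_sub 1).const_mul 2).mul ha).sub ((ha.pow 2).div_const 2)).add hL

namespace IsRiccatiSolution

variable {h h₁ h₂ h₃ F : ℝ → ℝ} {a b c A B C L : ℝ}

lemma le_of_riccatiRHS_pos (H : IsRiccatiSolution h F) (hb : b ≤ 1) (hc : F b ≤ c)
    (hpos : ∀ y ∈ Ioc 0 b, 0 < riccatiRHS h y c) : ∀ y ∈ Ioc 0 b, F y ≤ c := by
  have hsub : Ioc 0 b ⊆ Ioc 0 1 := Ioc_subset_Ioc_right hb
  refine le_of_deriv_pos_of_eq (fun y hy => H y (hsub hy)) hc fun y hy hFc => ?_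
  exact div_pos (hFc.symm ▸ hpos y hy) (mul_two_sub_pos (hsub hy))

lemma le_of_riccatiRHS_neg (H : IsRiccatiSolution h F) (hb : b ≤ 1) (hc : c ≤ F b)
    (hneg : ∀ y ∈ Ioc 0 b, riccatiRHS h y c < 0) : ∀ y ∈ Ioc 0 b, c ≤ F y := by
  have hsub : Ioc 0 b ⊆ Ioc 0 1 := Ioc_subset_Ioc_right hb
  intro y hy
  refine neg_le_neg_iff.1 (le_of_deriv_pos_of_eq (φ := fun y => -F y)
    (fun y hy => (H y (hsub hy)).fun_neg) (neg_le_neg hc) (fun y hy hFc => ?_) y hy)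
  rw [neg_inj.1 hFc]
  exact neg_pos.2 (div_neg_of_neg_of_pos (hneg y hy) (mul_two_sub_pos (hsub hy)))

lemma exists_ge (H : IsRiccatiSolution h F) (hC : ∀ y ∈ Ioc (0 : ℝ) 1, h y ≤ C) :
    ∃ A, ∀ y ∈ Ioc (0 : ℝ) 1, A ≤ F y := by
  obtain ⟨B, hB0, hFB, hCB⟩ : ∃ B : ℝ, 0 ≤ B ∧ -F 1 ≤ B ∧ 2 * C < B ^ 2 := by
    refine ⟨|F 1| + |C| + 1, by positivity, ?_, ?_⟩
    · linarith [neg_abs_le (F 1), abs_nonneg C]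
    · nlinarith [abs_nonneg (F 1), abs_nonneg C, le_abs_self C, sq_abs C]
  refine ⟨-B, H.le_of_riccatiRHS_neg le_rfl (by linarith) fun y hy => ?_⟩
  have hprod : 0 ≤ (1 - y) * B := mul_nonneg (by linarith [hy.2]) hB0
  have hCy := hC y hy
  unfold riccatiRHS
  linarith

/-- Above a large level `-1 / F` would decrease at rate at least `1 / (8 y)`, whose integral
diverges at `0`. -/
lemma exists_le (H : IsRiccatiSolution h F) (hC : ∀ y ∈ Ioc (0 : ℝ) 1, h y ≤ C) :
    ∃ B, ∀ y ∈ Ioc (0 : ℝ) 1, F y ≤ B := by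
  set B := 16 + 8 * |C|
  have hB0 : 0 < B := by positivity
  have hrhs : ∀ y ∈ Ioc (0 : ℝ) 1, ∀ v, B ≤ v → riccatiRHS h y v ≤ -(v ^ 2 / 4) := by
    intro y hy v hv
    have hquad : 2 * v + C ≤ v ^ 2 / 4 := by nlinarith [abs_nonneg C, le_abs_self C]
    have hyv : 0 ≤ y * v := mul_nonneg hy.1.le (hB0.le.trans hv)
    have hCy := hC y hy
    unfold riccatiRHS
    linarith
  refine ⟨B, ?_⟩
  by_contra! ⟨b, hb, hBb⟩
  have hsub : Ioc 0 b ⊆ Ioc 0 1 := Ioc_subset_Ioc_right hb.2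
  have hBF : ∀ y ∈ Ioc 0 b, B ≤ F y := H.le_of_riccatiRHS_neg hb.2 hBb.le fun y hy =>
    (hrhs y (hsub hy) B le_rfl).trans_lt (by linarith [pow_pos hB0 2])
  have hF : ∀ y ∈ Ioc 0 b, 0 < F y := fun y hy => hB0.trans_le (hBF y hy)
  obtain ⟨y, hy, hlt⟩ := exists_lt_of_mul_deriv_le (φ := fun y => -(F y)⁻¹)
    (φ' := fun y => riccatiRHS h y (F y) / F y ^ 2 / (y * (2 - y))) (b := b) (η := 1 / 8) hb.1
    (by norm_num)
    (fun y hy => ((H y (hsub hy)).fun_inv (hF y hy).ne').fun_neg.congr_deriv (by ring))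
    (fun y hy => mul_div_mul_two_sub_le (hsub hy) (by norm_num) (by
      rw [div_le_iff₀ (pow_pos (hF y hy) 2)]
      linarith [hrhs y (hsub hy) _ (hBF y hy)])) 0
  linarith [inv_pos.2 (hF y hy)]

/-- The Riccati right-hand side is at most `h y + 2`, so `h ≤ -4` near `0` would make `F` diverge
logarithmically. -/
lemma exists_neg_four_lt (H : IsRiccatiSolution h F) (hB : ∀ y ∈ Ioc (0 : ℝ) 1, F y ≤ B)
    (hb : b ∈ Ioc (0 : ℝ) 1) : ∃ y ∈ Ioc 0 b, -4 < h y := by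
  by_contra! hle
  have hsub : Ioc 0 b ⊆ Ioc 0 1 := Ioc_subset_Ioc_right hb.2
  obtain ⟨y, hy, hlt⟩ := exists_lt_of_mul_deriv_le hb.1 one_pos (fun y hy => H y (hsub hy))
    (fun y hy => mul_div_mul_two_sub_le (hsub hy) one_pos.le (by
      have hsq : 2 * (1 - y) * F y ≤ F y ^ 2 / 2 + 2 := by
        nlinarith [sq_nonneg (F y - 2 * (1 - y)), (hsub hy).1, (hsub hy).2]
      have hhy := hle y hy
      unfold riccatiRHS
      linarith)) B
  exact hlt.not_ge (hB y (hsub hy))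

lemma exists_tendsto_inhomogeneity (H : IsRiccatiSolution h F)
    (hd : HasThreeDerivsOn h h₁ h₂ h₃ (Ioc 0 1)) (h₃nn : ∀ y ∈ Ioc (0 : ℝ) 1, 0 ≤ h₃ y) :
    ∃ L C : ℝ, 0 ≤ C ∧ Tendsto h (𝓝[>] 0) (𝓝 L) ∧ ∀ y ∈ Ioc (0 : ℝ) 1, L - C * y ≤ h y := by
  obtain ⟨C, hC⟩ := hd.exists_le one_pos h₃nn
  obtain ⟨B, hB⟩ := H.exists_le hC
  obtain ⟨k, l, hmono⟩ := hd.exists_monotoneOn_sub_quadratic one_pos h₃nn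
  refine exists_tendsto_of_monotoneOn_sub_quadratic (A := -4 - (|k| + |l|)) hmono fun b hb => ?_
  obtain ⟨y, hy, hlt⟩ := H.exists_neg_four_lt hB hb
  have hy1 : y ∈ Ioc (0 : ℝ) 1 := Ioc_subset_Ioc_right hb.2 hy
  have hquad : k * y ^ 2 + l * y ≤ |k| + |l| :=
    (le_of_abs_le (abs_quadratic_le k l (Ioc_subset_Icc_self hy1))).trans
      (mul_le_of_le_one_right (by positivity) hy1.2)
  calc -4 - (|k| + |l|) ≤ h y - (k * y ^ 2 + l * y) := by linarith
    _ ≤ h b - (k * b ^ 2 + l * b) := hmono hy1 hb hy.2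

/-- A level that is not a root of the limiting right-hand side is crossed in one direction only. -/
lemma exists_tendsto_of_bounded (H : IsRiccatiSolution h F) (hL : Tendsto h (𝓝[>] 0) (𝓝 L))
    (hA : ∀ y ∈ Ioc (0 : ℝ) 1, A ≤ F y) (hB : ∀ y ∈ Ioc (0 : ℝ) 1, F y ≤ B) :
    ∃ a, Tendsto F (𝓝[>] 0) (𝓝 a) := by
  have hmem : ∀ᶠ y in 𝓝[>] (0 : ℝ), y ∈ Ioc (0 : ℝ) 1 := Ioc_mem_nhdsGT one_pos
  refine tendsto_of_no_upcrossings dense_univ ?_ ⟨B, eventually_map.2 (hmem.mono hB)⟩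
    ⟨A, eventually_map.2 (hmem.mono hA)⟩
  rintro a - b - hab ⟨hFa, hFb⟩
  obtain ⟨c, hc, hc0⟩ : ∃ c ∈ Ioo a b, 2 * c - c ^ 2 / 2 + L ≠ 0 := by
    by_contra! hroot
    have hmid := hroot ((a + b) / 2) ⟨by linarith, by linarith⟩
    have hleft := hroot ((3 * a + b) / 4) ⟨by linarith, by linarith⟩
    have hright := hroot ((a + 3 * b) / 4) ⟨by linarith, by linarith⟩
    nlinarith [mul_pos (sub_pos.2 hab) (sub_pos.2 hab)]
  have hrhs := tendsto_riccatiRHS hL (tendsto_const_nhds (x := c))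
  rcases lt_or_gt_of_ne hc0 with hneg | hpos
  · obtain ⟨d, hd, hev⟩ := exists_Ioc_of_eventually_nhdsGT one_pos (hrhs.eventually_lt_const hneg)
    obtain ⟨z, hzb, hz⟩ := (hFb.and_eventually (Ioc_mem_nhdsGT hd.1)).exists
    obtain ⟨y, hya, hy⟩ := (hFa.and_eventually (Ioc_mem_nhdsGT hz.1)).exists
    have hcy := H.le_of_riccatiRHS_neg (hz.2.trans hd.2) (hc.2.trans hzb).le
      (fun y hy => hev y (Ioc_subset_Ioc_right hz.2 hy)) y hy
    exact (hya.trans hc.1).not_ge hcy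
  · obtain ⟨d, hd, hev⟩ := exists_Ioc_of_eventually_nhdsGT one_pos (hrhs.eventually_const_lt hpos)
    obtain ⟨z, hza, hz⟩ := (hFa.and_eventually (Ioc_mem_nhdsGT hd.1)).exists
    obtain ⟨y, hyb, hy⟩ := (hFb.and_eventually (Ioc_mem_nhdsGT hz.1)).exists
    have hyc := H.le_of_riccatiRHS_pos (hz.2.trans hd.2) (hza.trans hc.1).le
      (fun y hy => hev y (Ioc_subset_Ioc_right hz.2 hy)) y hy
    exact (hc.2.trans hyb).not_ge hyc

lemma tendsto_inhomogeneity_eq (H : IsRiccatiSolution h F) (hL : Tendsto h (𝓝[>] 0) (𝓝 L))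
    (ha : Tendsto F (𝓝[>] 0) (𝓝 a)) : L = a ^ 2 / 2 - 2 * a := by
  have hid : Tendsto (fun y : ℝ => y) (𝓝[>] 0) (𝓝 0) := tendsto_id.mono_left nhdsWithin_le_nhds
  have hlim : Tendsto (fun y => y * (riccatiRHS h y (F y) / (y * (2 - y)))) (𝓝[>] 0)
      (𝓝 ((2 * a - a ^ 2 / 2 + L) / (2 - 0))) := by
    refine ((tendsto_riccatiRHS hL ha).div (hid.const_sub 2) (by norm_num)).congr' ?_
    filter_upwards [self_mem_nhdsWithin] with y hy
    rw [← mul_div_assoc, mul_div_mul_left _ _ (ne_of_gt hy), Pi.div_apply]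
  linarith [eq_zero_of_tendsto_mul_deriv one_pos H ha hlim]

/-- At a level `v ∈ (2, 3)` the limiting right-hand side `(v - 1) (3 - v) / 2` dominates the errors
of order `y`, so `F` could not rise back to its limit `3` as `y → 0`. -/
lemma exists_three_sub_mul_le (H : IsRiccatiSolution h F) (hC0 : 0 ≤ C)
    (hC : ∀ y ∈ Ioc (0 : ℝ) 1, L - C * y ≤ h y) (hL : Tendsto h (𝓝[>] 0) (𝓝 L))
    (ha : Tendsto F (𝓝[>] 0) (𝓝 a)) (h3 : 3 ≤ a) :
    ∃ c, 0 ≤ c ∧ ∃ b ∈ Ioc (0 : ℝ) 1, ∀ y ∈ Ioc 0 b, 3 - c * y ≤ F y ∧ 0 ≤ F y := by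
  rcases h3.lt_or_eq with hlt | rfl
  · obtain ⟨b, hb, hev⟩ := exists_Ioc_of_eventually_nhdsGT one_pos (ha.eventually_const_lt hlt)
    exact ⟨0, le_rfl, b, hb, fun y hy => ⟨by linarith [hev y hy], by linarith [hev y hy]⟩⟩
  obtain ⟨b, hb, hev⟩ := exists_Ioc_of_eventually_nhdsGT one_pos
    (ha.eventually_const_lt (show (2 : ℝ) < 3 by norm_num))
  refine ⟨2 * (6 + C), by linarith, b, hb, fun z hz => ⟨?_, by linarith [hev z hz]⟩⟩
  by_contra! hlt
  have hL3 : L = 3 ^ 2 / 2 - 2 * 3 := H.tendsto_inhomogeneity_eq hL ha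
  have hcz : 0 ≤ 2 * (6 + C) * z := by have := hz.1; positivity
  have hFz : F z < 3 := by linarith
  have hrhs : ∀ y ∈ Ioc 0 z, 0 < riccatiRHS h y (F z) := by
    intro y hy
    have hhy := hC y ⟨hy.1, hy.2.trans (hz.2.trans hb.2)⟩
    have hyz : 2 * (6 + C) * y ≤ 2 * (6 + C) * z := by have := hy.2; gcongr
    have hfactor : 3 - F z ≤ (F z - 1) * (3 - F z) := by nlinarith [hev z hz]
    have hyF : y * F z ≤ y * 3 := mul_le_mul_of_nonneg_left hFz.le hy.1.le
    unfold riccatiRHS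
    linarith
  have hle := H.le_of_riccatiRHS_pos (hz.2.trans hb.2) le_rfl hrhs
  exact hFz.not_ge (le_of_tendsto ha (mem_of_superset (Ioc_mem_nhdsGT hz.1) hle))

end IsRiccatiSolution

/-! ### Swirl near the south pole -/

/-- The integrating factor is `y ^ (3 / 2) * exp (-c y / 2)`. -/
lemma exists_div_mul_sqrt_le_deriv_swirl {F q : ℝ → ℝ} {b c : ℝ} (hb : b ∈ Ioc (0 : ℝ) 1)
    (hc : 0 ≤ c) (hF : ∀ y ∈ Ioc 0 b, 3 - c * y ≤ F y ∧ 0 ≤ F y) (hq : ∀ y ∈ Ioc 0 b, 0 < q y)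
    (dq : ∀ y ∈ Ioc 0 b, HasDerivAt q (-(F y * q y / (y * (2 - y)))) y) :
    ∃ κ, 0 < κ ∧ ∀ y ∈ Ioc 0 b, κ / (y * √y) ≤ q y := by
  have hbb : b ∈ Ioc 0 b := ⟨hb.1, le_rfl⟩
  have h2y : ∀ y ∈ Ioc 0 b, 0 < 2 - y := fun y hy => by linarith [hy.2, hb.2]
  have hanti : AntitoneOn (fun y => q y * (y * √y) * Real.exp (-(c / 2) * y)) (Ioc 0 b) := by
    refine antitoneOn_of_hasDerivAt_nonpos (φ' := fun y => q y * √y * Real.exp (-(c / 2) * y) *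
      (3 / 2 - c / 2 * y - F y / (2 - y))) (convex_Ioc 0 b) (fun y hy => ?_) (fun y hy => ?_)
    · have hy0 : y ≠ 0 := hy.1.ne'
      have hs : √y ≠ 0 := (Real.sqrt_pos.2 hy.1).ne'
      have h2y0 : 2 - y ≠ 0 := (h2y y hy).ne'
      have hpow : HasDerivAt (fun y => y * √y) (3 / 2 * √y) y := by
        refine ((hasDerivAt_id' y).fun_mul (Real.hasDerivAt_sqrt hy0)).congr_deriv ?_
        field_simp
        rw [Real.sq_sqrt hy.1.le]
        ring
      have hexp : HasDerivAt (fun y => Real.exp (-(c / 2) * y))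
          (Real.exp (-(c / 2) * y) * (-(c / 2) * 1)) y :=
        ((hasDerivAt_id' y).const_mul (-(c / 2))).exp
      refine (((dq y hy).fun_mul hpow).fun_mul hexp).congr_deriv ?_
      field_simp
      ring
    · have hhalf : F y / 2 ≤ F y / (2 - y) :=
        div_le_div_of_nonneg_left (hF y hy).2 (h2y y hy) (by linarith [hy.1])
      have hqy := (hq y hy).le
      exact mul_nonpos_of_nonneg_of_nonpos (by positivity) (by linarith [(hF y hy).1])
  have hsqrt : ∀ y ∈ Ioc 0 b, 0 < y * √y := fun y hy => mul_pos hy.1 (Real.sqrt_pos.2 hy.1)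
  refine ⟨q b * (b * √b) * Real.exp (-(c / 2) * b),
    mul_pos (mul_pos (hq b hbb) (hsqrt b hbb)) (Real.exp_pos _), fun y hy => ?_⟩
  rw [div_le_iff₀ (hsqrt y hy)]
  have hexp : Real.exp (-(c / 2) * y) ≤ 1 := Real.exp_le_one_iff.2 (by nlinarith [hy.1])
  exact (hanti hy hbb hy.2).trans
    (mul_le_of_le_one_right (mul_pos (hq y hy) (hsqrt y hy)).le hexp)

lemma le_neg_div_sqrt_of_deriv_ge {g q : ℝ → ℝ} {b κ : ℝ} (hb : 0 < b) (hκ : 0 ≤ κ)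
    (dg : ∀ y ∈ Ioc 0 b, HasDerivAt g (q y) y) (hq : ∀ y ∈ Ioc 0 b, κ / (y * √y) ≤ q y)
    (hgb : g b ≤ 0) : ∀ y ∈ Ioc 0 (b / 4), g y ≤ -(κ / √y) := by
  have hmono : MonotoneOn (fun y => g y + 2 * κ * (√y)⁻¹) (Ioc 0 b) := by
    refine monotoneOn_of_hasDerivAt_nonneg (φ' := fun y => q y - κ / (y * √y)) (convex_Ioc 0 b)
      (fun y hy => ?_) (fun y hy => sub_nonneg.2 (hq y hy))
    have hs : √y ≠ 0 := (Real.sqrt_pos.2 hy.1).ne'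
    have hy0 : y ≠ 0 := hy.1.ne'
    refine ((dg y hy).fun_add
      (((Real.hasDerivAt_sqrt hy0).fun_inv hs).const_mul (2 * κ))).congr_deriv ?_
    rw [Real.sq_sqrt hy.1.le]
    field_simp
    ring
  intro y hy
  have hyb : y ∈ Ioc 0 b := ⟨hy.1, by linarith [hy.2]⟩
  have hs : 0 < √y := Real.sqrt_pos.2 hy.1
  have hsb : 2 * √y ≤ √b := by
    refine Real.le_sqrt_of_sq_le ?_
    rw [mul_pow, Real.sq_sqrt hy.1.le]
    linarith [hy.2]
  have hle : g y + 2 * κ * (√y)⁻¹ ≤ g b + 2 * κ * (√b)⁻¹ := hmono hyb ⟨hb, le_rfl⟩ hyb.2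
  have hinv : 2 * κ * (√b)⁻¹ ≤ 2 * κ * (2 * √y)⁻¹ := by gcongr
  have hcancel : 2 * κ * (2 * √y)⁻¹ = κ / √y := by field_simp
  have hdouble : 2 * κ * (√y)⁻¹ = 2 * (κ / √y) := by ring
  linarith

lemma sq_div_cube_le_of_swirl_le {g q κ y : ℝ} (hy : y ∈ Ioc (0 : ℝ) 1) (hκ : 0 ≤ κ)
    (hq : κ / (y * √y) ≤ q) (hg : g ≤ -(κ / √y)) :
    κ ^ 2 / y ^ 3 ≤ -(2 * g * q / (y * (2 - y))) := by
  have hy0 : 0 < y := hy.1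
  have h2y : 0 < 2 - y := by linarith [hy.2]
  have hprod : κ ^ 2 / y ^ 2 ≤ -g * q := by
    have hκy : κ / √y * (κ / (y * √y)) = κ ^ 2 / y ^ 2 := by
      field_simp
      rw [Real.sq_sqrt hy0.le]
    rw [← hκy]
    exact mul_le_mul (le_neg_of_le_neg hg) hq (by positivity)
      ((by positivity : 0 ≤ κ / √y).trans (le_neg_of_le_neg hg))
  have hfactor : 1 ≤ 2 / (2 - y) := by
    rw [le_div_iff₀ h2y]
    linarith
  calc κ ^ 2 / y ^ 3 = κ ^ 2 / y ^ 2 / y := by field_simp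
    _ ≤ -g * q / y := by gcongr
    _ ≤ -g * q / y * (2 / (2 - y)) :=
      le_mul_of_one_le_right (div_nonneg (le_trans (by positivity) hprod) hy0.le) hfactor
    _ = -(2 * g * q / (y * (2 - y))) := by field_simp

/-- Near a pole with limit at least `3` one has `|g| ≥ κ / √y` and `g' ≥ κ / y ^ (3 / 2)`, so the
third derivative of `h` is at least `κ² / y³` and `h` diverges logarithmically. -/
lemma IsRiccatiSolution.lt_three_of_swirl {F h h₁ h₂ h₃ g q : ℝ → ℝ} {L C a : ℝ}
    (H : IsRiccatiSolution h F) (hd : HasThreeDerivsOn h h₁ h₂ h₃ (Ioc 0 1))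
    (dg : ∀ y ∈ Ioc (0 : ℝ) 1, HasDerivAt g (q y) y)
    (dq : ∀ y ∈ Ioc (0 : ℝ) 1, HasDerivAt q (-(F y * q y / (y * (2 - y)))) y)
    (hg : ∀ y ∈ Ioc (0 : ℝ) 1, g y ≤ 0) (hq : ∀ y ∈ Ioc (0 : ℝ) 1, 0 < q y)
    (hh₃ : ∀ y ∈ Ioc (0 : ℝ) 1, h₃ y = -(2 * g y * q y / (y * (2 - y))))
    (hC0 : 0 ≤ C) (hC : ∀ y ∈ Ioc (0 : ℝ) 1, L - C * y ≤ h y)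
    (hL : Tendsto h (𝓝[>] 0) (𝓝 L)) (ha : Tendsto F (𝓝[>] 0) (𝓝 a)) : a < 3 := by
  by_contra! h3
  obtain ⟨c, hc, b, hb, hF⟩ := H.exists_three_sub_mul_le hC0 hC hL ha h3
  have hsub : Ioc 0 b ⊆ Ioc 0 1 := Ioc_subset_Ioc_right hb.2
  obtain ⟨κ, hκ, hκq⟩ := exists_div_mul_sqrt_le_deriv_swirl hb hc hF (fun y hy => hq y (hsub hy))
    (fun y hy => dq y (hsub hy))
  have hκg : ∀ y ∈ Ioc 0 (b / 4), g y ≤ -(κ / √y) :=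
    le_neg_div_sqrt_of_deriv_ge hb.1 hκ.le (fun y hy => dg y (hsub hy)) hκq (hg b hb)
  have hsub4 : Ioc 0 (b / 4) ⊆ Ioc 0 b := Ioc_subset_Ioc_right (by linarith [hb.1])
  obtain ⟨y, hy, hlt⟩ := (hd.mono (hsub4.trans hsub)).exists_lt_of_div_cube_le
    (by linarith [hb.1]) (pow_pos hκ 2) (fun y hy => by
      rw [hh₃ y (hsub (hsub4 hy))]
      exact sq_div_cube_le_of_swirl_le (hsub (hsub4 hy)) hκ.le (hκq y (hsub4 hy)) (hκg y hy))
    (L - C)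
  have hy1 := hsub (hsub4 hy)
  linarith [hC y hy1, mul_le_of_le_one_right hC0 hy1.2]

/-- The quantity `(1 - x²) f' + 2 x f + f² / 2`. For `f = U_θ` without swirl it is a quadratic
polynomial in `x`, so that its third derivative measures the effect of the swirl. -/
def riccatiForm (f : ℝ → ℝ) (x : ℝ) : ℝ :=
  (1 - x ^ 2) * deriv f x + 2 * x * f x + f x ^ 2 / 2

/-- The ordinary differential equations satisfied on `(-1, 1)` by the profiles `f = U_θ` and
`g = U_φ` of an axisymmetric solution. -/
structure ProfileEquations (f g : ℝ → ℝ) : Prop where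
  smooth_f : ContDiffOn ℝ ∞ f (Ioo (-1) 1)
  smooth_g : ContDiffOn ℝ ∞ g (Ioo (-1) 1)
  swirl : ∀ x ∈ Ioo (-1 : ℝ) 1, (1 - x ^ 2) * deriv (deriv g) x + f x * deriv g x = 0
  meridian : ∀ x ∈ Ioo (-1 : ℝ) 1,
    deriv (deriv (deriv (riccatiForm f))) x + 2 * g x * deriv g x / (1 - x ^ 2) = 0

lemma one_sub_sq_pos {x : ℝ} (hx : x ∈ Ioo (-1 : ℝ) 1) : 0 < 1 - x ^ 2 := by
  nlinarith [hx.1, hx.2]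

lemma contDiffOn_riccatiForm {f : ℝ → ℝ} {s : Set ℝ} (hf : ContDiffOn ℝ ∞ f s) (hs : IsOpen s) :
    ContDiffOn ℝ ∞ (riccatiForm f) s := by
  have hf' := contDiffOn_deriv hf hs
  unfold riccatiForm
  fun_prop

lemma sub_one_mem_Ioo {y : ℝ} (hy : y ∈ Ioc (0 : ℝ) 1) : y - 1 ∈ Ioo (-1 : ℝ) 1 :=
  ⟨by linarith [hy.1], by linarith [hy.2]⟩

lemma hasDerivAt_comp_sub_one {φ : ℝ → ℝ} (hφ : ContDiffOn ℝ ∞ φ (Ioo (-1) 1)) {y : ℝ}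
    (hy : y ∈ Ioc (0 : ℝ) 1) : HasDerivAt (fun y => φ (y - 1)) (deriv φ (y - 1)) y :=
  (hasDerivAt_of_contDiffOn hφ isOpen_Ioo (sub_one_mem_Ioo hy)).comp_sub_const y 1

lemma isRiccatiSolution_comp_sub_one {f : ℝ → ℝ} (hf : ContDiffOn ℝ ∞ f (Ioo (-1) 1)) :
    IsRiccatiSolution (fun y => riccatiForm f (y - 1)) (fun y => f (y - 1)) := by
  intro y hy
  refine (hasDerivAt_comp_sub_one hf hy).congr_deriv ((eq_div_iff (mul_two_sub_pos hy).ne').2 ?_)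
  unfold riccatiRHS riccatiForm
  ring

namespace ProfileEquations

variable {f g : ℝ → ℝ}

lemma neg (h : ProfileEquations f g) : ProfileEquations f (fun x => -g x) where
  smooth_f := h.smooth_f
  smooth_g := h.smooth_g.neg
  swirl x hx := by
    simp only [deriv.fun_neg', deriv.fun_neg]
    linarith [h.swirl x hx]
  meridian x hx := by
    rw [← h.meridian x hx, deriv.fun_neg]
    ring

lemma exists_deriv_swirl_eq (h : ProfileEquations f g) :
    ∃ Φ : ℝ → ℝ, ∀ x ∈ Ioo (-1 : ℝ) 1, deriv g x = deriv g 0 * Real.exp (Φ x) := by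
  refine exists_eq_mul_exp_of_deriv_eq_mul (φ := fun x => -f x / (1 - x ^ 2)) (by simp)
    (h.smooth_f.continuousOn.neg.div (by fun_prop) fun x hx => (one_sub_sq_pos hx).ne')
    fun x hx => ?_
  refine (hasDerivAt_of_contDiffOn (contDiffOn_deriv h.smooth_g isOpen_Ioo)
    isOpen_Ioo hx).congr_deriv ?_
  have hx0 := (one_sub_sq_pos hx).ne'
  field_simp
  linarith [h.swirl x hx]

lemma deriv_swirl_nonneg (h : ProfileEquations f g) (h0 : 0 ≤ deriv g 0) {x : ℝ}
    (hx : x ∈ Ioo (-1 : ℝ) 1) : 0 ≤ deriv g x := by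
  obtain ⟨Φ, hΦ⟩ := h.exists_deriv_swirl_eq
  rw [hΦ x hx]
  positivity

lemma swirl_nonpos (h : ProfileEquations f g) (hg : Tendsto g (𝓝[<] 1) (𝓝 0))
    (h0 : 0 ≤ deriv g 0) {x : ℝ} (hx : x ∈ Ioo (-1 : ℝ) 1) : g x ≤ 0 := by
  have hmono : MonotoneOn g (Ioo (-1) 1) :=
    monotoneOn_of_hasDerivAt_nonneg (convex_Ioo _ _)
      (fun x hx => hasDerivAt_of_contDiffOn h.smooth_g isOpen_Ioo hx)
      (fun x hx => h.deriv_swirl_nonneg h0 hx)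
  refine ge_of_tendsto hg ?_
  filter_upwards [Ioo_mem_nhdsLT hx.2] with z hz
  exact hmono hx ⟨hx.1.trans hz.1, hz.2⟩ hz.1.le

lemma third_deriv_riccatiForm_comp_sub_one (h : ProfileEquations f g) {y : ℝ}
    (hy : y ∈ Ioc (0 : ℝ) 1) : deriv (deriv (deriv (riccatiForm f))) (y - 1) =
      -(2 * g (y - 1) * deriv g (y - 1) / (y * (2 - y))) := by
  rw [eq_neg_iff_add_eq_zero, ← h.meridian _ (sub_one_mem_Ioo hy)]
  ring

lemma hasDerivAt_deriv_swirl_comp_sub_one (h : ProfileEquations f g) {y : ℝ}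
    (hy : y ∈ Ioc (0 : ℝ) 1) : HasDerivAt (fun y => deriv g (y - 1))
      (-(f (y - 1) * deriv g (y - 1) / (y * (2 - y)))) y := by
  refine (hasDerivAt_comp_sub_one (contDiffOn_deriv h.smooth_g isOpen_Ioo) hy).congr_deriv ?_
  rw [← neg_div, eq_div_iff (mul_two_sub_pos hy).ne']
  linear_combination h.swirl _ (sub_one_mem_Ioo hy)

lemma exists_tendsto_south_of_deriv_swirl_nonneg (h : ProfileEquations f g)
    (hg : Tendsto g (𝓝[<] 1) (𝓝 0)) (h0 : 0 ≤ deriv g 0) :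
    ∃ a, Tendsto f (𝓝[>] (-1)) (𝓝 a) ∧ (3 ≤ a → deriv g 0 = 0) := by
  have hR := isRiccatiSolution_comp_sub_one h.smooth_f
  have hd := ((HasThreeDerivsOn.of_contDiffOn (contDiffOn_riccatiForm h.smooth_f isOpen_Ioo)
    isOpen_Ioo).comp_sub_const 1).mono fun _ => sub_one_mem_Ioo
  have hgnp : ∀ y ∈ Ioc (0 : ℝ) 1, g (y - 1) ≤ 0 := fun y hy =>
    h.swirl_nonpos hg h0 (sub_one_mem_Ioo hy)
  have h₃nn : ∀ y ∈ Ioc (0 : ℝ) 1, 0 ≤ deriv (deriv (deriv (riccatiForm f))) (y - 1) := by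
    intro y hy
    rw [h.third_deriv_riccatiForm_comp_sub_one hy, neg_nonneg]
    exact div_nonpos_of_nonpos_of_nonneg
      (mul_nonpos_of_nonpos_of_nonneg (by linarith [hgnp y hy])
        (h.deriv_swirl_nonneg h0 (sub_one_mem_Ioo hy))) (mul_two_sub_pos hy).le
  obtain ⟨L, C, hC0, hL, hC⟩ := hR.exists_tendsto_inhomogeneity hd h₃nn
  obtain ⟨C', hC'⟩ := hd.exists_le one_pos h₃nn
  obtain ⟨A, hA⟩ := hR.exists_ge hC'
  obtain ⟨B, hB⟩ := hR.exists_le hC'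
  obtain ⟨a, ha⟩ := hR.exists_tendsto_of_bounded hL hA hB
  refine ⟨a, ?_, fun h3a => ?_⟩
  · have hshift : Tendsto (fun x : ℝ => x + 1) (𝓝[>] (-1)) (𝓝[>] 0) := by
      simpa using (tendsto_map (f := (· + (1 : ℝ))) (x := 𝓝[>] (-1)))
    simpa [Function.comp_def] using ha.comp hshift
  · by_contra hne
    obtain ⟨Φ, hΦ⟩ := h.exists_deriv_swirl_eq
    have hpos : ∀ y ∈ Ioc (0 : ℝ) 1, 0 < deriv g (y - 1) := fun y hy => by
      rw [hΦ _ (sub_one_mem_Ioo hy)]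
      exact mul_pos (h0.lt_of_ne' hne) (Real.exp_pos _)
    exact h3a.not_gt (hR.lt_three_of_swirl hd (fun y => hasDerivAt_comp_sub_one h.smooth_g)
      (fun y => h.hasDerivAt_deriv_swirl_comp_sub_one) hgnp hpos
      (fun y => h.third_deriv_riccatiForm_comp_sub_one) hC0 hC hL ha)

theorem exists_tendsto_south (h : ProfileEquations f g) (hg : Tendsto g (𝓝[<] 1) (𝓝 0)) :
    ∃ a, Tendsto f (𝓝[>] (-1)) (𝓝 a) ∧ (3 ≤ a → ∀ x ∈ Ioo (-1 : ℝ) 1, g x = 0) := by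
  obtain ⟨a, ha, h3⟩ : ∃ a, Tendsto f (𝓝[>] (-1)) (𝓝 a) ∧ (3 ≤ a → deriv g 0 = 0) := by
    rcases le_total 0 (deriv g 0) with h0 | h0
    · exact h.exists_tendsto_south_of_deriv_swirl_nonneg hg h0
    · simpa using h.neg.exists_tendsto_south_of_deriv_swirl_nonneg (by simpa using hg.neg)
        (by simpa using h0)
  refine ⟨a, ha, fun h3a x hx => ?_⟩
  obtain ⟨Φ, hΦ⟩ := h.exists_deriv_swirl_eq
  have hconst : ∀ z ∈ Ioo (-1 : ℝ) 1, g z = g x := fun z hz =>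
    isOpen_Ioo.is_const_of_deriv_eq_zero isPreconnected_Ioo
      (h.smooth_g.differentiableOn (by simp))
      (fun z hz => by rw [hΦ z hz, h3 h3a, zero_mul, Pi.zero_apply]) hz hx
  refine tendsto_nhds_unique (tendsto_const_nhds.congr' ?_) hg
  filter_upwards [Ioo_mem_nhdsLT (show (-1 : ℝ) < 1 by norm_num)] with z hz
  exact (hconst z hz).symm

end ProfileEquations

/-! ### Partial derivatives and the Laplacian -/

section PartialDerivatives

variable {n : ℕ}

/-- The partial derivative `∂ᵢ h`. -/
def partialDeriv (i : Fin n) (h : EuclideanSpace ℝ (Fin n) → ℝ)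
    (y : EuclideanSpace ℝ (Fin n)) : ℝ :=
  fderiv ℝ h y (EuclideanSpace.single i 1)

variable {i j : Fin n} {h h₁ h₂ : EuclideanSpace ℝ (Fin n) → ℝ} {s : Set (EuclideanSpace ℝ (Fin n))}
  {y : EuclideanSpace ℝ (Fin n)}

lemma partialDeriv_congr (hs : IsOpen s) (h : EqOn h₁ h₂ s) (hy : y ∈ s) :
    partialDeriv i h₁ y = partialDeriv i h₂ y :=
  congrArg (fun L : EuclideanSpace ℝ (Fin n) →L[ℝ] ℝ => L (EuclideanSpace.single i 1))
    (h.eventuallyEq_of_mem (hs.mem_nhds hy)).fderiv_eq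

lemma contDiffOn_partialDeriv (hs : IsOpen s) (hh : ContDiffOn ℝ ∞ h s) :
    ContDiffOn ℝ ∞ (partialDeriv i h) s :=
  (hh.fderiv_of_isOpen hs (m := ∞) (by simp)).clm_apply contDiffOn_const

lemma partialDeriv_add (d₁ : DifferentiableAt ℝ h₁ y) (d₂ : DifferentiableAt ℝ h₂ y) :
    partialDeriv i (fun y => h₁ y + h₂ y) y = partialDeriv i h₁ y + partialDeriv i h₂ y := by
  simp only [partialDeriv, fderiv_fun_add d₁ d₂, add_apply]

lemma partialDeriv_sub (d₁ : DifferentiableAt ℝ h₁ y) (d₂ : DifferentiableAt ℝ h₂ y) :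
    partialDeriv i (fun y => h₁ y - h₂ y) y = partialDeriv i h₁ y - partialDeriv i h₂ y := by
  simp only [partialDeriv, fderiv_fun_sub d₁ d₂, sub_apply]

lemma partialDeriv_const_mul (d : DifferentiableAt ℝ h y) (c : ℝ) :
    partialDeriv i (fun y => c * h y) y = c * partialDeriv i h y := by
  simp only [partialDeriv, fderiv_const_mul d c, smul_apply, smul_eq_mul]

lemma hasFDerivAt_coord (j : Fin n) (y : EuclideanSpace ℝ (Fin n)) :
    HasFDerivAt (fun y : EuclideanSpace ℝ (Fin n) => y j) (EuclideanSpace.proj (𝕜 := ℝ) j) y :=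
  (EuclideanSpace.proj (𝕜 := ℝ) j).hasFDerivAt

lemma contDiff_coord (j : Fin n) : ContDiff ℝ ∞ (fun y : EuclideanSpace ℝ (Fin n) => y j) :=
  (EuclideanSpace.proj (𝕜 := ℝ) j).contDiff

lemma fderiv_coord_mul (d : DifferentiableAt ℝ h y) (v : EuclideanSpace ℝ (Fin n)) :
    fderiv ℝ (fun y => y j * h y) y v = v j * h y + y j * fderiv ℝ h y v := by
  rw [((hasFDerivAt_coord j y).fun_mul d.hasFDerivAt).fderiv]
  simp only [add_apply, smul_apply, smul_eq_mul, PiLp.proj_apply]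
  ring

lemma partialDeriv_coord_mul (d : DifferentiableAt ℝ h y) :
    partialDeriv i (fun y => y j * h y) y =
      (if j = i then 1 else 0) * h y + y j * partialDeriv i h y := by
  simp only [partialDeriv, fderiv_coord_mul d, PiLp.single_apply]

lemma fderiv_eq_sum_partialDeriv (h : EuclideanSpace ℝ (Fin n) → ℝ)
    (y v : EuclideanSpace ℝ (Fin n)) :
    fderiv ℝ h y v = ∑ i, v i * partialDeriv i h y := by
  conv_lhs => rw [← (EuclideanSpace.basisFun (Fin n) ℝ).sum_repr v, map_sum]
  simp [partialDeriv]

lemma laplacian_eq_sum_partialDeriv (hs : IsOpen s) (hh : ContDiffOn ℝ ∞ h s) (hy : y ∈ s) :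
    Laplacian.laplacian h y = ∑ i, partialDeriv i (partialDeriv i h) y := by
  have hd : DifferentiableAt ℝ (fderiv ℝ h) y :=
    differentiableAt_of_contDiffOn (hh.fderiv_of_isOpen hs (m := ∞) (by simp)) hs hy
  rw [InnerProductSpace.laplacian_eq_iteratedFDeriv_orthonormalBasis h
    (EuclideanSpace.basisFun (Fin n) ℝ)]
  refine Finset.sum_congr rfl fun i _ => ?_
  unfold partialDeriv
  rw [iteratedFDeriv_two_apply, fderiv_clm_apply hd (differentiableAt_const _)]
  simp

lemma laplacian_coord_mul (hs : IsOpen s) (hh : ContDiffOn ℝ ∞ h s) (hy : y ∈ s) :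
    Laplacian.laplacian (fun y => y j * h y) y =
      y j * Laplacian.laplacian h y + 2 * partialDeriv j h y := by
  have hsecond : ∀ i, partialDeriv i (partialDeriv i fun y => y j * h y) y =
      2 * ((if j = i then 1 else 0) * partialDeriv i h y) +
        y j * partialDeriv i (partialDeriv i h) y := by
    intro i
    have hd := differentiableAt_of_contDiffOn hh hs hy
    have hpd := contDiffOn_partialDeriv (i := i) hs hh
    rw [partialDeriv_congr hs (fun z hz =>
        partialDeriv_coord_mul (differentiableAt_of_contDiffOn hh hs hz)) hy,
      partialDeriv_add (hd.const_mul _)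
        (differentiableAt_of_contDiffOn ((contDiff_coord j).contDiffOn.mul hpd) hs hy),
      partialDeriv_coord_mul (differentiableAt_of_contDiffOn hpd hs hy), partialDeriv_const_mul hd]
    ring
  rw [laplacian_eq_sum_partialDeriv hs ((contDiff_coord j).contDiffOn.mul hh) hy,
    laplacian_eq_sum_partialDeriv hs hh hy]
  simp only [hsecond, Finset.sum_add_distrib, ← Finset.mul_sum, ite_mul, one_mul, zero_mul,
    Finset.sum_ite_eq, Finset.mem_univ, if_true]
  ring

lemma fderiv_apply_coord {u : EuclideanSpace ℝ (Fin n) → EuclideanSpace ℝ (Fin n)}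
    (d : DifferentiableAt ℝ u y) (v : EuclideanSpace ℝ (Fin n)) (j : Fin n) :
    fderiv ℝ u y v j = fderiv ℝ (fun z => u z j) y v :=
  (congrArg (fun L : EuclideanSpace ℝ (Fin n) →L[ℝ] ℝ => L v)
    ((hasFDerivAt_coord j (u y)).comp y d.hasFDerivAt).fderiv).symm

lemma laplacian_apply_coord {u : EuclideanSpace ℝ (Fin n) → EuclideanSpace ℝ (Fin n)}
    (hu : ContDiffAt ℝ 2 u y) (j : Fin n) :
    Laplacian.laplacian u y j = Laplacian.laplacian (fun z => u z j) y :=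
  (hu.laplacian_CLM_comp_left (l := EuclideanSpace.proj j)).symm

lemma gradient_apply_coord (h : EuclideanSpace ℝ (Fin n) → ℝ)
    (y : EuclideanSpace ℝ (Fin n)) (j : Fin n) :
    gradient h y j = partialDeriv j h y := by
  rw [partialDeriv, ← inner_gradient_left, EuclideanSpace.inner_single_right]
  simp

/-- The operator `-Δv + (u · ∇)v`: the contribution of viscosity and of transport by the velocity
`u` to the balance of the scalar quantity `v`. -/
def advectionDiffusion (u : EuclideanSpace ℝ (Fin n) → EuclideanSpace ℝ (Fin n))
    (v : EuclideanSpace ℝ (Fin n) → ℝ) (y : EuclideanSpace ℝ (Fin n)) : ℝ :=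
  -Laplacian.laplacian v y + fderiv ℝ v y (u y)

variable {u : EuclideanSpace ℝ (Fin n) → EuclideanSpace ℝ (Fin n)}

lemma advectionDiffusion_add (hs : IsOpen s) (c₁ : ContDiffOn ℝ ∞ h₁ s)
    (c₂ : ContDiffOn ℝ ∞ h₂ s) (hy : y ∈ s) :
    advectionDiffusion u (fun y => h₁ y + h₂ y) y =
      advectionDiffusion u h₁ y + advectionDiffusion u h₂ y := by
  have hlap : Laplacian.laplacian (fun y => h₁ y + h₂ y) y = _ :=
    (contDiffAt_two_of_contDiffOn c₁ hs hy).laplacian_add (contDiffAt_two_of_contDiffOn c₂ hs hy)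
  rw [advectionDiffusion, hlap, fderiv_fun_add (differentiableAt_of_contDiffOn c₁ hs hy)
    (differentiableAt_of_contDiffOn c₂ hs hy)]
  simp only [advectionDiffusion, add_apply]
  ring

lemma advectionDiffusion_sub (hs : IsOpen s) (c₁ : ContDiffOn ℝ ∞ h₁ s)
    (c₂ : ContDiffOn ℝ ∞ h₂ s) (hy : y ∈ s) :
    advectionDiffusion u (fun y => h₁ y - h₂ y) y =
      advectionDiffusion u h₁ y - advectionDiffusion u h₂ y := by
  have hlap : Laplacian.laplacian (fun y => h₁ y - h₂ y) y = _ :=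
    (contDiffAt_two_of_contDiffOn c₁ hs hy).laplacian_sub (contDiffAt_two_of_contDiffOn c₂ hs hy)
  rw [advectionDiffusion, hlap, fderiv_fun_sub (differentiableAt_of_contDiffOn c₁ hs hy)
    (differentiableAt_of_contDiffOn c₂ hs hy)]
  simp only [advectionDiffusion, sub_apply]
  ring

lemma advectionDiffusion_coord_mul (hs : IsOpen s) (hh : ContDiffOn ℝ ∞ h s) (hy : y ∈ s) :
    advectionDiffusion u (fun y => y j * h y) y =
      y j * advectionDiffusion u h y - 2 * partialDeriv j h y + u y j * h y := by
  rw [advectionDiffusion, laplacian_coord_mul hs hh hy,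
    fderiv_coord_mul (differentiableAt_of_contDiffOn hh hs hy), advectionDiffusion]
  ring

end PartialDerivatives

lemma divergence_eq_sum_partialDeriv {u : R3 → R3} {y : R3} (d : DifferentiableAt ℝ u y) :
    divergence u y = ∑ i, partialDeriv i (fun z => u z i) y := by
  simp only [divergence, fderiv_apply_coord d, partialDeriv]

lemma momentum_equation_iff {u : R3 → R3} {p : R3 → ℝ} {s : Set R3} (hs : IsOpen s)
    (hu : ContDiffOn ℝ ∞ u s) {y : R3} (hy : y ∈ s) :
    -Laplacian.laplacian u y + fderiv ℝ u y (u y) + gradient p y = 0 ↔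
      ∀ j, advectionDiffusion u (fun z => u z j) y + partialDeriv j p y = 0 := by
  rw [PiLp.ext_iff]
  refine forall_congr' fun j => ?_
  rw [advectionDiffusion, ← laplacian_apply_coord (contDiffAt_two_of_contDiffOn hu hs hy),
    ← fderiv_apply_coord (differentiableAt_of_contDiffOn hu hs hy), ← gradient_apply_coord]
  simp

/-! ### Homogeneous functions of the polar angle -/

/-- The complement of the `x₃`-axis. -/
def offAxis : Set R3 := {y | 0 < y 0 ^ 2 + y 1 ^ 2}

lemma isOpen_offAxis : IsOpen offAxis :=
  isOpen_lt continuous_const (by fun_prop)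

lemma norm_sq_eq (y : R3) : ‖y‖ ^ 2 = y 0 ^ 2 + y 1 ^ 2 + y 2 ^ 2 := by
  simp [EuclideanSpace.real_norm_sq_eq, Fin.sum_univ_three]

lemma offAxis_subset_slitSpace : offAxis ⊆ slitSpace := by
  rintro y hy ⟨h0, h1, -⟩
  simp [offAxis, h0, h1] at hy

lemma ne_zero_of_mem_slitSpace {y : R3} (hy : y ∈ slitSpace) : y ≠ 0 := by
  rintro rfl
  simp [slitSpace] at hy

lemma ne_zero_of_mem_offAxis {y : R3} (hy : y ∈ offAxis) : y ≠ 0 :=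
  ne_zero_of_mem_slitSpace (offAxis_subset_slitSpace hy)

/-- The cosine of the polar angle, with the junk value `0` at the origin. -/
def cosPolar (y : R3) : ℝ := y 2 / ‖y‖

lemma norm_mul_cosPolar {y : R3} (hy : y ≠ 0) : ‖y‖ * cosPolar y = y 2 :=
  mul_div_cancel₀ _ (norm_ne_zero_iff.2 hy)

lemma cosPolar_mem_Ioo {y : R3} (hy : y ∈ offAxis) : cosPolar y ∈ Ioo (-1 : ℝ) 1 := by
  have hnorm : 0 < ‖y‖ := norm_pos_iff.2 (ne_zero_of_mem_offAxis hy)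
  have hy2 : |y 2| < ‖y‖ := by
    rw [← abs_of_pos hnorm]
    exact sq_lt_sq.1 (by linarith [norm_sq_eq y, show 0 < y 0 ^ 2 + y 1 ^ 2 from hy])
  rw [mem_Ioo, ← abs_lt, cosPolar, abs_div, abs_norm]
  exact (div_lt_one hnorm).2 hy2

lemma sq_add_sq_mul_inv_pow {y : R3} (hy : y ≠ 0) (k : ℕ) :
    (y 0 ^ 2 + y 1 ^ 2) * (‖y‖ ^ (k + 2))⁻¹ = (1 - cosPolar y ^ 2) * (‖y‖ ^ k)⁻¹ := by
  have hnorm : ‖y‖ ≠ 0 := norm_ne_zero_iff.2 hy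
  have hsq : y 0 ^ 2 + y 1 ^ 2 = ‖y‖ ^ 2 * (1 - cosPolar y ^ 2) := by
    linear_combination (‖y‖ * cosPolar y + y 2) * norm_mul_cosPolar hy - norm_sq_eq y
  rw [hsq, pow_add]
  field_simp

/-- The `(-k)`-homogeneous function `r⁻ᵏ η(cos θ)`. -/
def hom (k : ℕ) (η : ℝ → ℝ) (y : R3) : ℝ := (‖y‖ ^ k)⁻¹ * η (cosPolar y)

lemma contDiffOn_cosPolar {s : Set R3} (hs : ∀ y ∈ s, y ≠ 0) : ContDiffOn ℝ ∞ cosPolar s :=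
  (contDiff_coord 2).contDiffOn.div (fun y hy => (contDiffAt_norm ℝ (hs y hy)).contDiffWithinAt)
    fun y hy => norm_ne_zero_iff.2 (hs y hy)

lemma contDiffOn_hom {k : ℕ} {η : ℝ → ℝ} {s : Set R3} {J : Set ℝ} (hs : ∀ y ∈ s, y ≠ 0)
    (hJ : MapsTo cosPolar s J) (hη : ContDiffOn ℝ ∞ η J) : ContDiffOn ℝ ∞ (hom k η) s := by
  have hnorm : ContDiffOn ℝ ∞ (fun y : R3 => ‖y‖) s := fun y hy =>
    (contDiffAt_norm ℝ (hs y hy)).contDiffWithinAt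
  exact ((hnorm.pow k).inv fun y hy => pow_ne_zero _ (norm_ne_zero_iff.2 (hs y hy))).mul
    (hη.comp (contDiffOn_cosPolar hs) hJ)

lemma contDiffOn_hom_offAxis {k : ℕ} {η : ℝ → ℝ} (h : ContDiffOn ℝ ∞ η (Ioo (-1) 1)) :
    ContDiffOn ℝ ∞ (hom k η) offAxis :=
  contDiffOn_hom (fun _ => ne_zero_of_mem_offAxis) (fun _ => cosPolar_mem_Ioo) h

lemma hasFDerivAt_norm {E : Type*} [NormedAddCommGroup E] [InnerProductSpace ℝ E] {y : E}
    (hy : y ≠ 0) : HasFDerivAt (fun y : E => ‖y‖) (‖y‖⁻¹ • innerSL ℝ y) y := by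
  have hnorm : ‖y‖ ≠ 0 := norm_ne_zero_iff.2 hy
  have h := (hasStrictFDerivAt_norm_sq y).hasFDerivAt.sqrt (pow_ne_zero 2 hnorm)
  simp only [Real.sqrt_sq (norm_nonneg _)] at h
  refine h.congr_fderiv ?_
  ext v
  simp only [smul_apply, smul_eq_mul, nsmul_eq_mul, Nat.cast_ofNat]
  field_simp

lemma hasFDerivAt_cosPolar {y : R3} (hy : y ≠ 0) :
    HasFDerivAt cosPolar (‖y‖⁻¹ • EuclideanSpace.proj 2 -
      (cosPolar y * (‖y‖ ^ 2)⁻¹) • innerSL ℝ y) y := by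
  have hnorm : ‖y‖ ≠ 0 := norm_ne_zero_iff.2 hy
  have h : HasFDerivAt cosPolar _ y := (hasFDerivAt_coord 2 y).fun_mul
    ((hasDerivAt_inv hnorm).comp_hasFDerivAt y (hasFDerivAt_norm hy))
  refine h.congr_fderiv ?_
  ext v
  simp only [cosPolar, add_apply, sub_apply, smul_apply, smul_eq_mul]
  field_simp
  ring

lemma hasFDerivAt_hom {k : ℕ} {η : ℝ → ℝ} {η' : ℝ} {y : R3} (hy : y ≠ 0)
    (hη : HasDerivAt η η' (cosPolar y)) :
    HasFDerivAt (hom k η)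
      ((-((‖y‖ ^ (k + 2))⁻¹ * (k * η (cosPolar y) + cosPolar y * η'))) • innerSL ℝ y +
        ((‖y‖ ^ (k + 1))⁻¹ * η') • EuclideanSpace.proj 2) y := by
  have hnorm : ‖y‖ ≠ 0 := norm_ne_zero_iff.2 hy
  have hpow := ((hasDerivAt_pow k ‖y‖).fun_inv (pow_ne_zero k hnorm)).comp_hasFDerivAt y
    (hasFDerivAt_norm hy)
  refine (hpow.fun_mul (hη.comp_hasFDerivAt y (hasFDerivAt_cosPolar hy))).congr_fderiv ?_
  ext v
  simp only [add_apply, sub_apply, smul_apply, smul_eq_mul, Function.comp_apply]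
  rcases k with _ | k
  · field_simp
    ring
  · simp only [Nat.add_sub_cancel]
    field_simp
    ring

/-- The action of `∂/∂(ρ²)`, `ρ² = x₁² + x₂²`, on the profiles of homogeneous functions:
`∂/∂(ρ²)` maps `hom k η` to `hom (k + 2) (rhoOp k η)`. -/
def rhoOp (k : ℕ) (η : ℝ → ℝ) (x : ℝ) : ℝ := -(k * η x + x * deriv η x) / 2

/-- The action of `∂₃` on the profiles of homogeneous functions: `∂₃` maps `hom k η` to
`hom (k + 1) (zOp k η)`. -/
def zOp (k : ℕ) (η : ℝ → ℝ) (x : ℝ) : ℝ :=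
  -k * x * η x + (1 - x ^ 2) * deriv η x

section Profiles

variable {k : ℕ} {η : ℝ → ℝ} {J : Set ℝ} {x : ℝ} {y : R3}

lemma contDiffOn_rhoOp (hJ : IsOpen J) (h : ContDiffOn ℝ ∞ η J) : ContDiffOn ℝ ∞ (rhoOp k η) J := by
  have := contDiffOn_deriv h hJ
  unfold rhoOp
  fun_prop

lemma contDiffOn_zOp (hJ : IsOpen J) (h : ContDiffOn ℝ ∞ η J) : ContDiffOn ℝ ∞ (zOp k η) J := by
  have := contDiffOn_deriv h hJ
  unfold zOp
  fun_prop

lemma deriv_rhoOp (hJ : IsOpen J) (h : ContDiffOn ℝ ∞ η J) (hx : x ∈ J) :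
    deriv (rhoOp k η) x = -((k + 1) * deriv η x + x * deriv (deriv η) x) / 2 := by
  have hd : HasDerivAt (rhoOp k η) _ x :=
    ((((hasDerivAt_of_contDiffOn h hJ hx).const_mul (k : ℝ)).fun_add ((hasDerivAt_id' x).fun_mul
      (hasDerivAt_of_contDiffOn (contDiffOn_deriv h hJ) hJ hx))).fun_neg).div_const 2
  rw [hd.deriv]
  ring

lemma hasDerivAt_one_sub_sq (x : ℝ) : HasDerivAt (fun x : ℝ => 1 - x ^ 2) (-(2 * x)) x := by
  simpa using (hasDerivAt_pow 2 x).const_sub 1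

lemma deriv_zOp (hJ : IsOpen J) (h : ContDiffOn ℝ ∞ η J) (hx : x ∈ J) :
    deriv (zOp k η) x =
      -k * η x - (k + 2) * x * deriv η x + (1 - x ^ 2) * deriv (deriv η) x := by
  have hd : HasDerivAt (zOp k η) _ x :=
    (((hasDerivAt_id' x).const_mul (-(k : ℝ))).fun_mul (hasDerivAt_of_contDiffOn h hJ hx)).fun_add
      ((hasDerivAt_one_sub_sq x).fun_mul
        (hasDerivAt_of_contDiffOn (contDiffOn_deriv h hJ) hJ hx))
  rw [hd.deriv]
  ring

lemma partialDeriv_hom_horizontal (h : ContDiffOn ℝ ∞ η (Ioo (-1) 1)) (hy : y ∈ offAxis)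
    {i : Fin 3} (hi : i ≠ 2) :
    partialDeriv i (hom k η) y = y i * (2 * hom (k + 2) (rhoOp k η) y) := by
  rw [partialDeriv, (hasFDerivAt_hom (ne_zero_of_mem_offAxis hy)
    (hasDerivAt_of_contDiffOn h isOpen_Ioo (cosPolar_mem_Ioo hy))).fderiv]
  simp only [add_apply, smul_apply, smul_eq_mul, innerSL_apply_apply,
    EuclideanSpace.inner_single_right, PiLp.proj_apply, PiLp.single_apply, hi.symm,
    if_false, hom, rhoOp, conj_trivial]
  ring

lemma partialDeriv_hom_two (h : ContDiffOn ℝ ∞ η (Ioo (-1) 1)) (hy : y ∈ offAxis) :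
    partialDeriv 2 (hom k η) y = hom (k + 1) (zOp k η) y := by
  have hnorm : ‖y‖ ≠ 0 := norm_ne_zero_iff.2 (ne_zero_of_mem_offAxis hy)
  rw [partialDeriv, (hasFDerivAt_hom (ne_zero_of_mem_offAxis hy)
    (hasDerivAt_of_contDiffOn h isOpen_Ioo (cosPolar_mem_Ioo hy))).fderiv]
  simp only [add_apply, smul_apply, smul_eq_mul, innerSL_apply_apply,
    EuclideanSpace.inner_single_right, PiLp.proj_apply, PiLp.single_apply, if_true, hom,
    zOp, conj_trivial, ← norm_mul_cosPolar (ne_zero_of_mem_offAxis hy)]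
  field_simp
  ring

lemma partialDeriv_partialDeriv_hom_horizontal (h : ContDiffOn ℝ ∞ η (Ioo (-1) 1))
    (hy : y ∈ offAxis) {i : Fin 3} (hi : i ≠ 2) :
    partialDeriv i (partialDeriv i (hom k η)) y = 2 * hom (k + 2) (rhoOp k η) y +
      4 * y i ^ 2 * hom (k + 4) (rhoOp (k + 2) (rhoOp k η)) y := by
  have hrho := contDiffOn_rhoOp (k := k) isOpen_Ioo h
  have hd := differentiableAt_of_contDiffOn (contDiffOn_hom_offAxis (k := k + 2) hrho)
    isOpen_offAxis hy
  rw [partialDeriv_congr isOpen_offAxis (fun z hz => partialDeriv_hom_horizontal h hz hi) hy,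
    partialDeriv_coord_mul (hd.const_mul 2), partialDeriv_const_mul hd,
    partialDeriv_hom_horizontal hrho hy hi, if_pos rfl]
  ring

lemma laplacian_hom (h : ContDiffOn ℝ ∞ η (Ioo (-1) 1)) (hy : y ∈ offAxis) :
    Laplacian.laplacian (hom k η) y = 4 * hom (k + 2) (rhoOp k η) y +
      4 * (y 0 ^ 2 + y 1 ^ 2) * hom (k + 4) (rhoOp (k + 2) (rhoOp k η)) y +
      hom (k + 2) (zOp (k + 1) (zOp k η)) y := by
  rw [laplacian_eq_sum_partialDeriv isOpen_offAxis (contDiffOn_hom_offAxis h) hy,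
    Fin.sum_univ_three, partialDeriv_partialDeriv_hom_horizontal h hy (by decide),
    partialDeriv_partialDeriv_hom_horizontal h hy (by decide),
    partialDeriv_congr isOpen_offAxis (fun z hz => partialDeriv_hom_two h hz) hy,
    partialDeriv_hom_two (contDiffOn_zOp isOpen_Ioo h) hy]
  ring

end Profiles

/-! ### Axisymmetric velocity fields -/

/-- The `(-1)`-homogeneous axisymmetric vector field whose horizontal radial, azimuthal and vertical
components are `ρ r⁻² α`, `ρ r⁻² β` and `r⁻¹ ζ`, where `ρ² = x₁² + x₂²` and `α`, `β`, `ζ` are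
functions of `cos θ`. -/
def axiField (α β ζ : ℝ → ℝ) (y : R3) : R3 :=
  !₂[y 0 * hom 2 α y - y 1 * hom 2 β y, y 1 * hom 2 α y + y 0 * hom 2 β y, hom 1 ζ y]

/-- The action of `advectionDiffusion (axiField α β ζ)` on the profiles of homogeneous functions: it
maps `hom k η` to `hom (k + 2) (advectionDiffusionOp α ζ k η)`. -/
def advectionDiffusionOp (α ζ : ℝ → ℝ) (k : ℕ) (η : ℝ → ℝ) (x : ℝ) : ℝ :=
  -(4 * rhoOp k η x + 4 * (1 - x ^ 2) * rhoOp (k + 2) (rhoOp k η) x + zOp (k + 1) (zOp k η) x) +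
    2 * (1 - x ^ 2) * α x * rhoOp k η x + ζ x * zOp k η x

/-- The profile of the horizontal radial component of `-Δu + (u · ∇)u` for `u = axiField α β ζ`. -/
def radialRes (α β ζ : ℝ → ℝ) (x : ℝ) : ℝ :=
  advectionDiffusionOp α ζ 2 α x - 4 * rhoOp 2 α x + α x ^ 2 - β x ^ 2

/-- The profile of the azimuthal component of `-Δu + (u · ∇)u` for `u = axiField α β ζ`. -/
def swirlRes (α β ζ : ℝ → ℝ) (x : ℝ) : ℝ :=
  advectionDiffusionOp α ζ 2 β x - 4 * rhoOp 2 β x + 2 * α x * β x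

/-- The profile of the vertical component of `-Δu + (u · ∇)u` for `u = axiField α β ζ`. -/
def axialRes (α ζ : ℝ → ℝ) (x : ℝ) : ℝ := advectionDiffusionOp α ζ 1 ζ x

/-- The profile of the divergence of `axiField α β ζ`. -/
def divRes (α ζ : ℝ → ℝ) (x : ℝ) : ℝ :=
  2 * α x + 2 * (1 - x ^ 2) * rhoOp 2 α x + zOp 1 ζ x

section AxiField

variable {α β ζ : ℝ → ℝ} {y : R3}

lemma axiField_zero (α β ζ : ℝ → ℝ) (y : R3) :
    axiField α β ζ y 0 = y 0 * hom 2 α y - y 1 * hom 2 β y := rfl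

lemma axiField_one (α β ζ : ℝ → ℝ) (y : R3) :
    axiField α β ζ y 1 = y 1 * hom 2 α y + y 0 * hom 2 β y := rfl

lemma axiField_two (α β ζ : ℝ → ℝ) (y : R3) : axiField α β ζ y 2 = hom 1 ζ y := rfl

lemma contDiffOn_coord_mul_hom {k : ℕ} {η : ℝ → ℝ} (h : ContDiffOn ℝ ∞ η (Ioo (-1) 1))
    (j : Fin 3) : ContDiffOn ℝ ∞ (fun y : R3 => y j * hom k η y) offAxis :=
  (contDiff_coord j).contDiffOn.mul (contDiffOn_hom_offAxis h)

lemma advectionDiffusion_hom {k : ℕ} {η : ℝ → ℝ} (h : ContDiffOn ℝ ∞ η (Ioo (-1) 1))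
    (hy : y ∈ offAxis) : advectionDiffusion (axiField α β ζ) (hom k η) y =
      hom (k + 2) (advectionDiffusionOp α ζ k η) y := by
  rw [advectionDiffusion, laplacian_hom h hy, fderiv_eq_sum_partialDeriv, Fin.sum_univ_three,
    partialDeriv_hom_horizontal h hy (by decide), partialDeriv_hom_horizontal h hy (by decide),
    partialDeriv_hom_two h hy, axiField_zero, axiField_one, axiField_two]
  have hdiffusion := sq_add_sq_mul_inv_pow (ne_zero_of_mem_offAxis hy) (k + 2)
  simp only [hom, advectionDiffusionOp]
  generalize cosPolar y = x at *
  linear_combination (-4 * rhoOp (k + 2) (rhoOp k η) x + 2 * α x * rhoOp k η x) * hdiffusion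

lemma advectionDiffusion_axiField_zero (hα : ContDiffOn ℝ ∞ α (Ioo (-1) 1))
    (hβ : ContDiffOn ℝ ∞ β (Ioo (-1) 1)) (hy : y ∈ offAxis) :
    advectionDiffusion (axiField α β ζ) (fun z => axiField α β ζ z 0) y =
      (‖y‖ ^ 4)⁻¹ * (y 0 * radialRes α β ζ (cosPolar y) - y 1 * swirlRes α β ζ (cosPolar y)) := by
  simp only [axiField_zero]
  rw [advectionDiffusion_sub isOpen_offAxis (contDiffOn_coord_mul_hom hα 0)
      (contDiffOn_coord_mul_hom hβ 1) hy,
    advectionDiffusion_coord_mul isOpen_offAxis (contDiffOn_hom_offAxis hα) hy,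
    advectionDiffusion_coord_mul isOpen_offAxis (contDiffOn_hom_offAxis hβ) hy,
    advectionDiffusion_hom hα hy, advectionDiffusion_hom hβ hy,
    partialDeriv_hom_horizontal hα hy (by decide), partialDeriv_hom_horizontal hβ hy (by decide),
    axiField_zero, axiField_one]
  simp only [hom, radialRes, swirlRes]
  ring

lemma advectionDiffusion_axiField_one (hα : ContDiffOn ℝ ∞ α (Ioo (-1) 1))
    (hβ : ContDiffOn ℝ ∞ β (Ioo (-1) 1)) (hy : y ∈ offAxis) :
    advectionDiffusion (axiField α β ζ) (fun z => axiField α β ζ z 1) y =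
      (‖y‖ ^ 4)⁻¹ * (y 1 * radialRes α β ζ (cosPolar y) + y 0 * swirlRes α β ζ (cosPolar y)) := by
  simp only [axiField_one]
  rw [advectionDiffusion_add isOpen_offAxis (contDiffOn_coord_mul_hom hα 1)
      (contDiffOn_coord_mul_hom hβ 0) hy,
    advectionDiffusion_coord_mul isOpen_offAxis (contDiffOn_hom_offAxis hα) hy,
    advectionDiffusion_coord_mul isOpen_offAxis (contDiffOn_hom_offAxis hβ) hy,
    advectionDiffusion_hom hα hy, advectionDiffusion_hom hβ hy,
    partialDeriv_hom_horizontal hα hy (by decide), partialDeriv_hom_horizontal hβ hy (by decide),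
    axiField_zero, axiField_one]
  simp only [hom, radialRes, swirlRes]
  ring

lemma advectionDiffusion_axiField_two (hζ : ContDiffOn ℝ ∞ ζ (Ioo (-1) 1)) (hy : y ∈ offAxis) :
    advectionDiffusion (axiField α β ζ) (fun z => axiField α β ζ z 2) y =
      (‖y‖ ^ 3)⁻¹ * axialRes α ζ (cosPolar y) :=
  advectionDiffusion_hom hζ hy

lemma sum_partialDeriv_axiField (hα : ContDiffOn ℝ ∞ α (Ioo (-1) 1))
    (hβ : ContDiffOn ℝ ∞ β (Ioo (-1) 1)) (hζ : ContDiffOn ℝ ∞ ζ (Ioo (-1) 1)) (hy : y ∈ offAxis) :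
    ∑ i, partialDeriv i (fun z => axiField α β ζ z i) y =
      (‖y‖ ^ 2)⁻¹ * divRes α ζ (cosPolar y) := by
  have dα := differentiableAt_of_contDiffOn (contDiffOn_hom_offAxis (k := 2) hα) isOpen_offAxis hy
  have dβ := differentiableAt_of_contDiffOn (contDiffOn_hom_offAxis (k := 2) hβ) isOpen_offAxis hy
  have dα' := fun j =>
    differentiableAt_of_contDiffOn (contDiffOn_coord_mul_hom (k := 2) hα j) isOpen_offAxis hy
  have dβ' := fun j =>
    differentiableAt_of_contDiffOn (contDiffOn_coord_mul_hom (k := 2) hβ j) isOpen_offAxis hy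
  simp only [Fin.sum_univ_three, axiField_zero, axiField_one, axiField_two]
  rw [partialDeriv_sub (dα' 0) (dβ' 1), partialDeriv_add (dα' 1) (dβ' 0),
    partialDeriv_coord_mul dα, partialDeriv_coord_mul dα, partialDeriv_coord_mul dβ,
    partialDeriv_coord_mul dβ, partialDeriv_hom_horizontal hα hy (by decide),
    partialDeriv_hom_horizontal hα hy (by decide), partialDeriv_hom_horizontal hβ hy (by decide),
    partialDeriv_hom_horizontal hβ hy (by decide), partialDeriv_hom_two hζ hy]
  have hradial := sq_add_sq_mul_inv_pow (ne_zero_of_mem_offAxis hy) 2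
  simp only [hom, divRes, Fin.reduceEq, if_true, if_false]
  generalize cosPolar y = x at *
  linear_combination (2 * rhoOp 2 α x) * hradial

end AxiField

/-! ### Profiles in terms of `U_θ` and `U_φ` -/

/-- The profiles `α`, `β`, `ζ` of a divergence-free field `axiField α β ζ` expressed by `f = U_θ`
and `g = U_φ`. -/
structure IsProfile (f g α β ζ : ℝ → ℝ) : Prop where
  smooth_f : ContDiffOn ℝ ∞ f (Ioo (-1) 1)
  smooth_g : ContDiffOn ℝ ∞ g (Ioo (-1) 1)
  eqOn_radial : EqOn α (fun x => deriv f x + x * f x / (1 - x ^ 2)) (Ioo (-1) 1)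
  eqOn_swirl : EqOn β (fun x => g x / (1 - x ^ 2)) (Ioo (-1) 1)
  eqOn_axial : EqOn ζ (fun x => x * deriv f x - f x) (Ioo (-1) 1)

/-- Twice the pressure profile: the profile of the radial component of `-Δu + (u · ∇)u`. -/
def pressureForm (f g : ℝ → ℝ) (x : ℝ) : ℝ :=
  -(1 - x ^ 2) * deriv (deriv (deriv f)) x + 2 * x * deriv (deriv f) x -
    f x * deriv (deriv f) x - deriv f x ^ 2 - (f x ^ 2 + g x ^ 2) / (1 - x ^ 2)

/-- The derivative of the pressure profile: the profile of the polar component of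
`-Δu + (u · ∇)u`. -/
def polarForm (f g : ℝ → ℝ) (x : ℝ) : ℝ :=
  deriv (deriv f) x - f x * deriv f x / (1 - x ^ 2) - x * (f x ^ 2 + g x ^ 2) / (1 - x ^ 2) ^ 2

lemma eqOn_deriv_of_hasDerivAt {φ ψ ψ' : ℝ → ℝ} {J : Set ℝ} (hJ : IsOpen J) (h : EqOn φ ψ J)
    (hd : ∀ x ∈ J, HasDerivAt ψ (ψ' x) x) : EqOn (deriv φ) ψ' J := fun x hx =>
  ((h.eventuallyEq_of_mem (hJ.mem_nhds hx)).deriv_eq).trans (hd x hx).deriv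

namespace IsProfile

variable {f g α β ζ : ℝ → ℝ} {x : ℝ}

lemma contDiffOn_radial (h : IsProfile f g α β ζ) : ContDiffOn ℝ ∞ α (Ioo (-1) 1) :=
  ((contDiffOn_deriv h.smooth_f isOpen_Ioo).add ((contDiffOn_id.mul h.smooth_f).div (by fun_prop)
    fun _ hx => (one_sub_sq_pos hx).ne')).congr h.eqOn_radial

lemma contDiffOn_swirl (h : IsProfile f g α β ζ) : ContDiffOn ℝ ∞ β (Ioo (-1) 1) :=
  (h.smooth_g.div (by fun_prop) fun _ hx => (one_sub_sq_pos hx).ne').congr h.eqOn_swirl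

lemma contDiffOn_axial (h : IsProfile f g α β ζ) : ContDiffOn ℝ ∞ ζ (Ioo (-1) 1) :=
  ((contDiffOn_id.mul (contDiffOn_deriv h.smooth_f isOpen_Ioo)).sub h.smooth_f).congr h.eqOn_axial

lemma eqOn_deriv_radial (h : IsProfile f g α β ζ) : EqOn (deriv α) (fun x => deriv (deriv f) x +
    (f x + x * deriv f x) / (1 - x ^ 2) + 2 * x ^ 2 * f x / (1 - x ^ 2) ^ 2) (Ioo (-1) 1) := by
  refine eqOn_deriv_of_hasDerivAt isOpen_Ioo h.eqOn_radial fun x hx => ?_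
  have d₀ := hasDerivAt_of_contDiffOn h.smooth_f isOpen_Ioo hx
  have d₁ := hasDerivAt_of_contDiffOn (contDiffOn_deriv h.smooth_f isOpen_Ioo) isOpen_Ioo hx
  have hw := (one_sub_sq_pos hx).ne'
  refine (d₁.fun_add (((hasDerivAt_id' x).fun_mul d₀).fun_div (hasDerivAt_one_sub_sq x)
    hw)).congr_deriv ?_
  field_simp
  ring

lemma eqOn_deriv_deriv_radial (h : IsProfile f g α β ζ) : EqOn (deriv (deriv α))
    (fun x => deriv (deriv (deriv f)) x + (2 * deriv f x + x * deriv (deriv f) x) / (1 - x ^ 2) +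
      (6 * x * f x + 4 * x ^ 2 * deriv f x) / (1 - x ^ 2) ^ 2 +
      8 * x ^ 3 * f x / (1 - x ^ 2) ^ 3) (Ioo (-1) 1) := by
  refine eqOn_deriv_of_hasDerivAt isOpen_Ioo h.eqOn_deriv_radial fun x hx => ?_
  have hf' := contDiffOn_deriv h.smooth_f isOpen_Ioo
  have d₀ := hasDerivAt_of_contDiffOn h.smooth_f isOpen_Ioo hx
  have d₁ := hasDerivAt_of_contDiffOn hf' isOpen_Ioo hx
  have d₂ := hasDerivAt_of_contDiffOn (contDiffOn_deriv hf' isOpen_Ioo) isOpen_Ioo hx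
  have hw := (one_sub_sq_pos hx).ne'
  have dx := hasDerivAt_id' x
  have dw := hasDerivAt_one_sub_sq x
  refine ((d₂.fun_add ((d₀.fun_add (dx.fun_mul d₁)).fun_div dw hw)).fun_add
    ((((dx.fun_pow 2).const_mul 2).fun_mul d₀).fun_div (dw.fun_pow 2)
      (pow_ne_zero 2 hw))).congr_deriv ?_
  push_cast
  field_simp
  ring

lemma eqOn_deriv_swirl (h : IsProfile f g α β ζ) : EqOn (deriv β)
    (fun x => deriv g x / (1 - x ^ 2) + 2 * x * g x / (1 - x ^ 2) ^ 2) (Ioo (-1) 1) := by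
  refine eqOn_deriv_of_hasDerivAt isOpen_Ioo h.eqOn_swirl fun x hx => ?_
  have hw := (one_sub_sq_pos hx).ne'
  refine ((hasDerivAt_of_contDiffOn h.smooth_g isOpen_Ioo hx).fun_div
    (hasDerivAt_one_sub_sq x) hw).congr_deriv ?_
  field_simp
  ring

lemma eqOn_deriv_deriv_swirl (h : IsProfile f g α β ζ) : EqOn (deriv (deriv β))
    (fun x => deriv (deriv g) x / (1 - x ^ 2) + (2 * g x + 4 * x * deriv g x) / (1 - x ^ 2) ^ 2 +
    8 * x ^ 2 * g x / (1 - x ^ 2) ^ 3) (Ioo (-1) 1) := by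
  refine eqOn_deriv_of_hasDerivAt isOpen_Ioo h.eqOn_deriv_swirl fun x hx => ?_
  have d₀ := hasDerivAt_of_contDiffOn h.smooth_g isOpen_Ioo hx
  have d₁ := hasDerivAt_of_contDiffOn (contDiffOn_deriv h.smooth_g isOpen_Ioo) isOpen_Ioo hx
  have hw := (one_sub_sq_pos hx).ne'
  have dw := hasDerivAt_one_sub_sq x
  refine ((d₁.fun_div dw hw).fun_add ((((hasDerivAt_id' x).const_mul 2).fun_mul d₀).fun_div
    (dw.fun_pow 2) (pow_ne_zero 2 hw))).congr_deriv ?_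
  field_simp
  ring

lemma eqOn_deriv_axial (h : IsProfile f g α β ζ) :
    EqOn (deriv ζ) (fun x => x * deriv (deriv f) x) (Ioo (-1) 1) := by
  refine eqOn_deriv_of_hasDerivAt isOpen_Ioo h.eqOn_axial fun x hx => ?_
  have d₀ := hasDerivAt_of_contDiffOn h.smooth_f isOpen_Ioo hx
  have d₁ := hasDerivAt_of_contDiffOn (contDiffOn_deriv h.smooth_f isOpen_Ioo) isOpen_Ioo hx
  exact (((hasDerivAt_id' x).fun_mul d₁).fun_sub d₀).congr_deriv (by ring)

lemma eqOn_deriv_deriv_axial (h : IsProfile f g α β ζ) : EqOn (deriv (deriv ζ))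
    (fun x => deriv (deriv f) x + x * deriv (deriv (deriv f)) x) (Ioo (-1) 1) := by
  refine eqOn_deriv_of_hasDerivAt isOpen_Ioo h.eqOn_deriv_axial fun x hx => ?_
  have hf'' := contDiffOn_deriv (contDiffOn_deriv h.smooth_f isOpen_Ioo) isOpen_Ioo
  exact ((hasDerivAt_id' x).fun_mul (hasDerivAt_of_contDiffOn hf'' isOpen_Ioo hx)).congr_deriv
    (by ring)

lemma divRes_eq_zero (h : IsProfile f g α β ζ) (hx : x ∈ Ioo (-1 : ℝ) 1) : divRes α ζ x = 0 := by
  have hw := (one_sub_sq_pos hx).ne'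
  simp only [divRes, rhoOp, zOp, h.eqOn_deriv_radial hx, h.eqOn_deriv_axial hx, h.eqOn_radial hx,
    h.eqOn_axial hx]
  push_cast
  field_simp
  ring

lemma swirlRes_eq (h : IsProfile f g α β ζ) (hx : x ∈ Ioo (-1 : ℝ) 1) : swirlRes α β ζ x =
    -((1 - x ^ 2) * deriv (deriv g) x + f x * deriv g x) / (1 - x ^ 2) := by
  have hw := (one_sub_sq_pos hx).ne'
  have hβ := h.contDiffOn_swirl
  simp only [swirlRes, advectionDiffusionOp, Nat.reduceAdd, rhoOp.eq_1 4, zOp.eq_1 3,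
    deriv_rhoOp isOpen_Ioo hβ hx, deriv_zOp isOpen_Ioo hβ hx]
  simp only [rhoOp, zOp, h.eqOn_deriv_deriv_swirl hx, h.eqOn_deriv_swirl hx, h.eqOn_radial hx,
    h.eqOn_swirl hx, h.eqOn_axial hx]
  push_cast
  field_simp
  ring

lemma radialRes_eq (h : IsProfile f g α β ζ) (hx : x ∈ Ioo (-1 : ℝ) 1) :
    radialRes α β ζ x = pressureForm f g x + x * polarForm f g x := by
  have hw := (one_sub_sq_pos hx).ne'
  have hα := h.contDiffOn_radial
  simp only [radialRes, advectionDiffusionOp, Nat.reduceAdd, rhoOp.eq_1 4, zOp.eq_1 3,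
    deriv_rhoOp isOpen_Ioo hα hx, deriv_zOp isOpen_Ioo hα hx]
  simp only [rhoOp, zOp, h.eqOn_deriv_deriv_radial hx, h.eqOn_deriv_radial hx, h.eqOn_radial hx,
    h.eqOn_swirl hx, h.eqOn_axial hx, pressureForm, polarForm]
  push_cast
  field_simp
  ring

lemma axialRes_eq (h : IsProfile f g α β ζ) (hx : x ∈ Ioo (-1 : ℝ) 1) :
    axialRes α ζ x = x * pressureForm f g x - (1 - x ^ 2) * polarForm f g x := by
  have hw := (one_sub_sq_pos hx).ne'
  have hζ := h.contDiffOn_axial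
  simp only [axialRes, advectionDiffusionOp, Nat.reduceAdd, rhoOp.eq_1 3, zOp.eq_1 2,
    deriv_rhoOp isOpen_Ioo hζ hx, deriv_zOp isOpen_Ioo hζ hx]
  simp only [rhoOp, zOp, h.eqOn_deriv_deriv_axial hx, h.eqOn_deriv_axial hx, h.eqOn_radial hx,
    h.eqOn_axial hx, pressureForm, polarForm]
  push_cast
  field_simp
  ring

end IsProfile

section RiccatiForm

variable {f g : ℝ → ℝ} {s : Set ℝ} {x : ℝ}

lemma eqOn_deriv_riccatiForm (hs : IsOpen s) (hf : ContDiffOn ℝ ∞ f s) :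
    EqOn (deriv (riccatiForm f))
      (fun z => (1 - z ^ 2) * deriv (deriv f) z + 2 * f z + f z * deriv f z) s := by
  refine eqOn_deriv_of_hasDerivAt hs (eqOn_refl _ _) fun z hz => ?_
  have d₀ := hasDerivAt_of_contDiffOn hf hs hz
  have d₁ := hasDerivAt_of_contDiffOn (contDiffOn_deriv hf hs) hs hz
  refine ((((hasDerivAt_one_sub_sq z).fun_mul d₁).fun_add
    (((hasDerivAt_id' z).const_mul 2).fun_mul d₀)).fun_add
    ((d₀.fun_pow 2).div_const 2)).congr_deriv ?_
  push_cast
  ring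

lemma eqOn_deriv_deriv_riccatiForm (hs : IsOpen s) (hf : ContDiffOn ℝ ∞ f s) :
    EqOn (deriv (deriv (riccatiForm f))) (fun z => (1 - z ^ 2) * deriv (deriv (deriv f)) z -
      2 * z * deriv (deriv f) z + 2 * deriv f z + deriv f z ^ 2 + f z * deriv (deriv f) z) s := by
  refine eqOn_deriv_of_hasDerivAt hs (eqOn_deriv_riccatiForm hs hf) fun z hz => ?_
  have hf' := contDiffOn_deriv hf hs
  have d₀ := hasDerivAt_of_contDiffOn hf hs hz
  have d₁ := hasDerivAt_of_contDiffOn hf' hs hz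
  have d₂ := hasDerivAt_of_contDiffOn (contDiffOn_deriv hf' hs) hs hz
  exact ((((hasDerivAt_one_sub_sq z).fun_mul d₂).fun_add (d₀.const_mul 2)).fun_add
    (d₀.fun_mul d₁)).congr_deriv (by ring)

lemma pressureForm_eq (hs : IsOpen s) (hf : ContDiffOn ℝ ∞ f s) (hx : x ∈ s) :
    pressureForm f g x = 2 * deriv f x - (f x ^ 2 + g x ^ 2) / (1 - x ^ 2) -
      deriv (deriv (riccatiForm f)) x := by
  rw [eqOn_deriv_deriv_riccatiForm hs hf hx, pressureForm]
  ring

lemma hasDerivAt_pressureForm (hf : ContDiffOn ℝ ∞ f (Ioo (-1) 1))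
    (hg : ContDiffOn ℝ ∞ g (Ioo (-1) 1)) (hx : x ∈ Ioo (-1 : ℝ) 1) :
    HasDerivAt (pressureForm f g) (2 * polarForm f g x -
      (deriv (deriv (deriv (riccatiForm f))) x + 2 * g x * deriv g x / (1 - x ^ 2))) x := by
  have hw := (one_sub_sq_pos hx).ne'
  have d₀ := hasDerivAt_of_contDiffOn hf isOpen_Ioo hx
  have d₁ := hasDerivAt_of_contDiffOn (contDiffOn_deriv hf isOpen_Ioo) isOpen_Ioo hx
  have dg := hasDerivAt_of_contDiffOn hg isOpen_Ioo hx
  have dR := hasDerivAt_of_contDiffOn (contDiffOn_deriv (contDiffOn_deriv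
    (contDiffOn_riccatiForm hf isOpen_Ioo) isOpen_Ioo) isOpen_Ioo) isOpen_Ioo hx
  have hd := ((d₁.const_mul 2).fun_sub (((d₀.fun_pow 2).fun_add (dg.fun_pow 2)).fun_div
    (hasDerivAt_one_sub_sq x) hw)).fun_sub dR
  refine (hd.congr_of_eventuallyEq ?_).congr_deriv ?_
  · filter_upwards [isOpen_Ioo.mem_nhds hx] with z hz using pressureForm_eq isOpen_Ioo hf hz
  · simp only [polarForm]
    push_cast
    field_simp
    ring

end RiccatiForm

/-! ### Reduction of a solution to its profiles -/

lemma isOpen_slitSpace : IsOpen slitSpace := by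
  have hcont : ∀ j, Continuous fun y : R3 => y j := fun j => (contDiff_coord j).continuous
  have hclosed : IsClosed {y : R3 | y 0 = 0 ∧ y 1 = 0 ∧ y 2 ≤ 0} :=
    (isClosed_eq (hcont 0) continuous_const).inter
      ((isClosed_eq (hcont 1) continuous_const).inter (isClosed_le (hcont 2) continuous_const))
  exact hclosed.isOpen_compl

lemma SolvesNavierStokes.congr {u v : R3 → R3} {p : R3 → ℝ} {s : Set R3}
    (h : SolvesNavierStokes u p s) (hs : IsOpen s) (huv : EqOn u v s) :
    SolvesNavierStokes v p s := fun y hy => by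
  have hnhds := huv.symm.eventuallyEq_of_mem (hs.mem_nhds hy)
  rw [divergence, (InnerProductSpace.laplacian_congr_nhds hnhds).eq_of_nhds, hnhds.fderiv_eq,
    ← huv hy]
  exact h y hy

lemma fderiv_apply_self_of_homogeneous {E : Type*} [NormedAddCommGroup E] [NormedSpace ℝ E]
    {p : E → ℝ} {y : E} {k : ℕ} (hp : DifferentiableAt ℝ p y)
    (hhom : ∀ c : ℝ, 0 < c → p (c • y) = (c ^ k)⁻¹ * p y) : fderiv ℝ p y y = -k * p y := by
  have hray : HasDerivAt (fun c : ℝ => p (c • y)) (fderiv ℝ p y y) 1 := by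
    have hp' : HasFDerivAt p (fderiv ℝ p y) ((1 : ℝ) • y) := by
      rw [one_smul]
      exact hp.hasFDerivAt
    exact (hp'.comp_hasDerivAt 1 ((hasDerivAt_id' (1 : ℝ)).smul_const y)).congr_deriv
      (by rw [one_smul])
  have hpow : HasDerivAt (fun c : ℝ => (c ^ k)⁻¹ * p y) (-k * p y) 1 :=
    (((hasDerivAt_pow k (1 : ℝ)).fun_inv (by simp)).mul_const _).congr_deriv (by simp)
  refine hray.unique (hpow.congr_of_eventuallyEq ?_)
  filter_upwards [Ioi_mem_nhds one_pos] with c hc using hhom c hc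

lemma hasDerivAt_vec3 {a b c : ℝ → ℝ} {a' b' c' t : ℝ} (ha : HasDerivAt a a' t)
    (hb : HasDerivAt b b' t) (hc : HasDerivAt c c' t) :
    HasDerivAt (fun t => (!₂[a t, b t, c t] : R3)) !₂[a', b', c'] t := by
  refine hasDerivWithinAt_univ.1 (hasFDerivWithinAt_euclidean.2 fun i => ?_)
  fin_cases i
  exacts [ha.hasDerivWithinAt, hb.hasDerivWithinAt, hc.hasDerivWithinAt]

lemma norm_eR (θ φ : ℝ) : ‖eR θ φ‖ = 1 := by
  refine (pow_eq_one_iff_of_nonneg (norm_nonneg _) two_ne_zero).1 ?_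
  rw [norm_sq_eq]
  change (Real.sin θ * Real.cos φ) ^ 2 + (Real.sin θ * Real.sin φ) ^ 2 + Real.cos θ ^ 2 = 1
  linear_combination Real.sin θ ^ 2 * Real.sin_sq_add_cos_sq φ + Real.sin_sq_add_cos_sq θ

lemma eR_mem_offAxis {θ : ℝ} (hθ : θ ∈ Ioo 0 Real.pi) (φ : ℝ) : eR θ φ ∈ offAxis := by
  have hsin := Real.sin_pos_of_mem_Ioo hθ
  have hsq : eR θ φ 0 ^ 2 + eR θ φ 1 ^ 2 = Real.sin θ ^ 2 := by
    change (Real.sin θ * Real.cos φ) ^ 2 + (Real.sin θ * Real.sin φ) ^ 2 = _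
    linear_combination Real.sin θ ^ 2 * Real.sin_sq_add_cos_sq φ
  change 0 < eR θ φ 0 ^ 2 + eR θ φ 1 ^ 2
  rw [hsq]
  positivity

lemma hasDerivAt_eR_azimuth (θ φ : ℝ) :
    HasDerivAt (fun φ => eR θ φ) (Real.sin θ • ePhi φ) φ := by
  refine (hasDerivAt_vec3 ((Real.hasDerivAt_cos φ).const_mul _)
    ((Real.hasDerivAt_sin φ).const_mul _) (hasDerivAt_const φ _)).congr_deriv ?_
  ext i
  fin_cases i <;> simp [ePhi]

lemma eq_sum_inner_smul_frame (v : R3) (θ φ : ℝ) :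
    v = inner ℝ v (eR θ φ) • eR θ φ + inner ℝ v (eTheta θ φ) • eTheta θ φ +
      inner ℝ v (ePhi φ) • ePhi φ := by
  have hθ := Real.sin_sq_add_cos_sq θ
  have hφ := Real.sin_sq_add_cos_sq φ
  ext i
  fin_cases i <;> simp [eR, eTheta, ePhi, PiLp.inner_apply, Fin.sum_univ_three] <;> grind

lemma IsAxisymmetric.apply_smul_eR {u : R3 → R3} (h : IsAxisymmetric u) {r θ : ℝ} (hr : 0 < r)
    (hθ : θ ∈ Ioo 0 Real.pi) (φ : ℝ) : u (r • eR θ φ) =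
      !₂[Real.cos φ * u (r • eR θ 0) 0 - Real.sin φ * u (r • eR θ 0) 1,
        Real.sin φ * u (r • eR θ 0) 0 + Real.cos φ * u (r • eR θ 0) 1, u (r • eR θ 0) 2] := by
  obtain ⟨hR, hΘ, hΦ⟩ := h r hr θ hθ φ 0
  have hsum := eq_sum_inner_smul_frame (u (r • eR θ φ)) θ φ
  rw [← compR, ← compTheta, ← compPhi, hR, hΘ, hΦ] at hsum
  have hsum₀ := eq_sum_inner_smul_frame (u (r • eR θ 0)) θ 0
  rw [← compR, ← compTheta, ← compPhi] at hsum₀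
  generalize compR u r θ 0 = a at *
  generalize compTheta u r θ 0 = b at *
  generalize compPhi u r θ 0 = c at *
  rw [hsum, hsum₀]
  ext i
  fin_cases i <;> simp [eR, eTheta, ePhi] <;> ring

lemma arccos_mem_Ioo {x : ℝ} (hx : x ∈ Ioo (-1 : ℝ) 1) : Real.arccos x ∈ Ioo 0 Real.pi :=
  ⟨Real.arccos_pos.2 hx.2,
    (Real.arccos_le_pi x).lt_of_ne fun h => hx.1.not_ge (Real.arccos_eq_pi.1 h)⟩

lemma exists_eq_norm_smul_eR {y : R3} (hy : y ∈ offAxis) :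
    ∃ φ, y = ‖y‖ • eR (Real.arccos (cosPolar y)) φ := by
  have hx := cosPolar_mem_Ioo hy
  have hy0 := ne_zero_of_mem_offAxis hy
  have hρ : ‖(⟨y 0, y 1⟩ : ℂ)‖ = ‖y‖ * √(1 - cosPolar y ^ 2) := by
    rw [← sq_eq_sq₀ (norm_nonneg _) (by positivity), mul_pow,
      Real.sq_sqrt (one_sub_sq_pos hx).le, Complex.sq_norm, Complex.normSq_mk]
    linear_combination -norm_sq_eq y + (‖y‖ * cosPolar y + y 2) * norm_mul_cosPolar hy0
  have hcos := Complex.norm_mul_cos_arg ⟨y 0, y 1⟩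
  have hsin := Complex.norm_mul_sin_arg ⟨y 0, y 1⟩
  rw [hρ] at hcos hsin
  refine ⟨Complex.arg ⟨y 0, y 1⟩, ?_⟩
  ext k
  fin_cases k
  · simp [eR, Real.sin_arccos, ← mul_assoc, hcos]
  · simp [eR, Real.sin_arccos, ← mul_assoc, hsin]
  · simp [eR, Real.cos_arccos hx.1.le hx.2.le, norm_mul_cosPolar hy0]

/-- The point of the unit sphere on the meridian `φ = 0` with `cos θ = x`. -/
def meridian (x : ℝ) : R3 := !₂[√(1 - x ^ 2), 0, x]

section Meridian

variable {x : ℝ}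

lemma eR_arccos (hx : x ∈ Icc (-1 : ℝ) 1) : eR (Real.arccos x) 0 = meridian x := by
  simp [eR, meridian, Real.sin_arccos, Real.cos_arccos hx.1 hx.2]

lemma meridian_zero (x : ℝ) : meridian x 0 = √(1 - x ^ 2) := rfl

lemma meridian_one (x : ℝ) : meridian x 1 = 0 := rfl

lemma meridian_two (x : ℝ) : meridian x 2 = x := rfl

lemma sqrt_one_sub_sq_pos (hx : x ∈ Ioo (-1 : ℝ) 1) : 0 < √(1 - x ^ 2) :=
  Real.sqrt_pos.2 (one_sub_sq_pos hx)

lemma meridian_mem_offAxis (hx : x ∈ Ioo (-1 : ℝ) 1) : meridian x ∈ offAxis :=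
  eR_arccos (Ioo_subset_Icc_self hx) ▸ eR_mem_offAxis (arccos_mem_Ioo hx) 0

lemma norm_meridian (hx : x ∈ Ioo (-1 : ℝ) 1) : ‖meridian x‖ = 1 :=
  eR_arccos (Ioo_subset_Icc_self hx) ▸ norm_eR _ 0

lemma cosPolar_meridian (hx : x ∈ Ioo (-1 : ℝ) 1) : cosPolar (meridian x) = x := by
  rw [cosPolar, norm_meridian hx, div_one, meridian_two]

lemma contDiffOn_sqrt_one_sub_sq :
    ContDiffOn ℝ ∞ (fun x : ℝ => √(1 - x ^ 2)) (Ioo (-1) 1) :=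
  ContDiffOn.sqrt (by fun_prop) fun _ hx => (one_sub_sq_pos hx).ne'

lemma contDiffOn_meridian : ContDiffOn ℝ ∞ meridian (Ioo (-1) 1) := by
  refine contDiffOn_euclidean.2 fun i => ?_
  fin_cases i
  exacts [contDiffOn_sqrt_one_sub_sq, contDiffOn_const, contDiffOn_id]

lemma hasDerivAt_meridian (hx : x ∈ Ioo (-1 : ℝ) 1) :
    HasDerivAt meridian !₂[-x / √(1 - x ^ 2), 0, 1] x := by
  refine hasDerivAt_vec3 ?_ (hasDerivAt_const x 0) (hasDerivAt_id' x)
  refine ((hasDerivAt_one_sub_sq x).sqrt (one_sub_sq_pos hx).ne').congr_deriv ?_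
  rw [← mul_neg, mul_div_mul_left _ _ two_ne_zero]

lemma continuous_meridian : Continuous meridian := by
  unfold meridian
  fun_prop

lemma UTheta_eq (u : R3 → R3) (hx : x ∈ Icc (-1 : ℝ) 1) : UTheta u x = √(1 - x ^ 2) *
    (x * u (meridian x) 0 - √(1 - x ^ 2) * u (meridian x) 2) := by
  rw [UTheta, compTheta, one_smul, eR_arccos hx]
  simp only [eTheta, Real.cos_arccos hx.1 hx.2, Real.sin_arccos, Real.cos_zero, Real.sin_zero,
    PiLp.inner_apply, RCLike.inner_apply, Real.ringHom_apply, Fin.sum_univ_three,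
    Matrix.cons_val_zero, Matrix.cons_val_one, Matrix.cons_val]
  ring

lemma UPhi_eq (u : R3 → R3) (hx : x ∈ Icc (-1 : ℝ) 1) :
    UPhi u x = √(1 - x ^ 2) * u (meridian x) 1 := by
  rw [UPhi, compPhi, one_smul, eR_arccos hx]
  simp [ePhi, PiLp.inner_apply, Fin.sum_univ_three, Real.sin_arccos, mul_comm]

end Meridian

lemma contDiffOn_axiField {α β ζ : ℝ → ℝ} {s : Set R3} {J : Set ℝ} (hs : ∀ y ∈ s, y ≠ 0)
    (hJ : MapsTo cosPolar s J) (hα : ContDiffOn ℝ ∞ α J) (hβ : ContDiffOn ℝ ∞ β J)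
    (hζ : ContDiffOn ℝ ∞ ζ J) : ContDiffOn ℝ ∞ (axiField α β ζ) s := by
  have hcoord : ∀ {η : ℝ → ℝ} (j : Fin 3), ContDiffOn ℝ ∞ η J →
      ContDiffOn ℝ ∞ (fun y : R3 => y j * hom 2 η y) s := fun j hη =>
    (contDiff_coord j).contDiffOn.mul (contDiffOn_hom hs hJ hη)
  refine contDiffOn_euclidean.2 fun i => ?_
  fin_cases i
  · exact (hcoord 0 hα).sub (hcoord 1 hβ)
  · exact (hcoord 1 hα).add (hcoord 0 hβ)
  · exact contDiffOn_hom hs hJ hζ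

lemma contDiffOn_axiField_offAxis {α β ζ : ℝ → ℝ} (hα : ContDiffOn ℝ ∞ α (Ioo (-1) 1))
    (hβ : ContDiffOn ℝ ∞ β (Ioo (-1) 1)) (hζ : ContDiffOn ℝ ∞ ζ (Ioo (-1) 1)) :
    ContDiffOn ℝ ∞ (axiField α β ζ) offAxis :=
  contDiffOn_axiField (fun _ => ne_zero_of_mem_offAxis) (fun _ => cosPolar_mem_Ioo) hα hβ hζ

section ProfileReduction

variable {α β ζ : ℝ → ℝ} {p : R3 → ℝ} {x : ℝ}

lemma fderiv_pressure_eq (hα : ContDiffOn ℝ ∞ α (Ioo (-1) 1))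
    (hβ : ContDiffOn ℝ ∞ β (Ioo (-1) 1)) (hζ : ContDiffOn ℝ ∞ ζ (Ioo (-1) 1))
    (h : SolvesNavierStokes (axiField α β ζ) p offAxis) {y : R3} (hy : y ∈ offAxis)
    (hn : ‖y‖ = 1) (v : R3) : fderiv ℝ p y v =
      -((y 0 * v 0 + y 1 * v 1) * radialRes α β ζ (y 2) +
        (y 0 * v 1 - y 1 * v 0) * swirlRes α β ζ (y 2) + v 2 * axialRes α ζ (y 2)) := by
  have hmom := (momentum_equation_iff isOpen_offAxis (contDiffOn_axiField_offAxis hα hβ hζ) hy).1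
    (h y hy).1
  have hcos : cosPolar y = y 2 := by rw [cosPolar, hn, div_one]
  have h0 := hmom 0
  have h1 := hmom 1
  have h2 := hmom 2
  rw [advectionDiffusion_axiField_zero hα hβ hy, hn, hcos] at h0
  rw [advectionDiffusion_axiField_one hα hβ hy, hn, hcos] at h1
  rw [advectionDiffusion_axiField_two hζ hy, hn, hcos] at h2
  rw [fderiv_eq_sum_partialDeriv, Fin.sum_univ_three]
  norm_num at h0 h1 h2
  linear_combination v 0 * h0 + v 1 * h1 + v 2 * h2

lemma divRes_eq_zero_of_solves (hα : ContDiffOn ℝ ∞ α (Ioo (-1) 1))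
    (hβ : ContDiffOn ℝ ∞ β (Ioo (-1) 1)) (hζ : ContDiffOn ℝ ∞ ζ (Ioo (-1) 1))
    (h : SolvesNavierStokes (axiField α β ζ) p offAxis) (hx : x ∈ Ioo (-1 : ℝ) 1) :
    divRes α ζ x = 0 := by
  have hoff := meridian_mem_offAxis hx
  have hdiv := (h _ hoff).2
  rw [divergence_eq_sum_partialDeriv (differentiableAt_of_contDiffOn
      (contDiffOn_axiField_offAxis hα hβ hζ) isOpen_offAxis hoff),
    sum_partialDeriv_axiField hα hβ hζ hoff, norm_meridian hx, cosPolar_meridian hx] at hdiv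
  simpa using hdiv

/-- The pressure is periodic along a circle of latitude, where its derivative is constant. -/
lemma swirlRes_eq_zero_of_solves (hα : ContDiffOn ℝ ∞ α (Ioo (-1) 1))
    (hβ : ContDiffOn ℝ ∞ β (Ioo (-1) 1)) (hζ : ContDiffOn ℝ ∞ ζ (Ioo (-1) 1))
    (hp : ∀ y ∈ offAxis, DifferentiableAt ℝ p y)
    (h : SolvesNavierStokes (axiField α β ζ) p offAxis) (hx : x ∈ Ioo (-1 : ℝ) 1) :
    swirlRes α β ζ x = 0 := by
  set θ := Real.arccos x
  have hθ : θ ∈ Ioo 0 Real.pi := arccos_mem_Ioo hx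
  have hcos : Real.cos θ = x := Real.cos_arccos hx.1.le hx.2.le
  have hcircle : ∀ φ, HasDerivAt (fun φ => p (eR θ φ))
      (-(Real.sin θ ^ 2 * swirlRes α β ζ x)) φ := fun φ => by
    have hoff := eR_mem_offAxis hθ φ
    refine ((hp _ hoff).hasFDerivAt.comp_hasDerivAt φ (hasDerivAt_eR_azimuth θ φ)).congr_deriv ?_
    rw [fderiv_pressure_eq hα hβ hζ h hoff (norm_eR θ φ)]
    simp only [eR, ePhi, hcos, PiLp.smul_apply, smul_eq_mul, Matrix.cons_val_zero,
      Matrix.cons_val_one, Matrix.cons_val, mul_neg, sub_neg_eq_add, mul_zero, zero_mul, add_zero]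
    linear_combination -(Real.sin θ ^ 2 * swirlRes α β ζ x) * Real.sin_sq_add_cos_sq φ
  obtain ⟨φ, -, hφ⟩ := exists_hasDerivAt_eq_zero Real.two_pi_pos
    (fun φ _ => (hcircle φ).continuousAt.continuousWithinAt) (by simp [eR]) fun φ _ => hcircle φ
  exact (mul_eq_zero.1 (neg_eq_zero.1 hφ)).resolve_left
    (pow_pos (Real.sin_pos_of_mem_Ioo hθ) 2).ne'

lemma pressure_meridian_eq (hα : ContDiffOn ℝ ∞ α (Ioo (-1) 1))
    (hβ : ContDiffOn ℝ ∞ β (Ioo (-1) 1)) (hζ : ContDiffOn ℝ ∞ ζ (Ioo (-1) 1))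
    (hp : ∀ y ∈ offAxis, DifferentiableAt ℝ p y)
    (hhom : ∀ y ∈ offAxis, ∀ c : ℝ, 0 < c → p (c • y) = (c ^ 2)⁻¹ * p y)
    (h : SolvesNavierStokes (axiField α β ζ) p offAxis) (hx : x ∈ Ioo (-1 : ℝ) 1) :
    2 * p (meridian x) = (1 - x ^ 2) * radialRes α β ζ x + x * axialRes α ζ x := by
  have hoff := meridian_mem_offAxis hx
  have heuler := fderiv_apply_self_of_homogeneous (hp _ hoff) (hhom _ hoff)
  rw [fderiv_pressure_eq hα hβ hζ h hoff (norm_meridian hx), meridian_zero, meridian_one,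
    meridian_two] at heuler
  push_cast at heuler
  linear_combination heuler + radialRes α β ζ x * Real.sq_sqrt (one_sub_sq_pos hx).le

lemma hasDerivAt_pressure_meridian (hα : ContDiffOn ℝ ∞ α (Ioo (-1) 1))
    (hβ : ContDiffOn ℝ ∞ β (Ioo (-1) 1)) (hζ : ContDiffOn ℝ ∞ ζ (Ioo (-1) 1))
    (hp : ∀ y ∈ offAxis, DifferentiableAt ℝ p y)
    (h : SolvesNavierStokes (axiField α β ζ) p offAxis) (hx : x ∈ Ioo (-1 : ℝ) 1) :
    HasDerivAt (fun x => p (meridian x)) (x * radialRes α β ζ x - axialRes α ζ x) x := by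
  have hoff := meridian_mem_offAxis hx
  have hs := (sqrt_one_sub_sq_pos hx).ne'
  refine ((hp _ hoff).hasFDerivAt.comp_hasDerivAt x (hasDerivAt_meridian hx)).congr_deriv ?_
  rw [fderiv_pressure_eq hα hβ hζ h hoff (norm_meridian hx), meridian_zero, meridian_one,
    meridian_two]
  simp only [Matrix.cons_val_zero, Matrix.cons_val_one, Matrix.cons_val, mul_zero, add_zero,
    zero_mul, sub_self, one_mul]
  field_simp
  ring

lemma isProfile_of_divRes_eq_zero (hα : ContDiffOn ℝ ∞ α (Ioo (-1) 1))
    (hβ : ContDiffOn ℝ ∞ β (Ioo (-1) 1)) (hζ : ContDiffOn ℝ ∞ ζ (Ioo (-1) 1))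
    (hdiv : ∀ x ∈ Ioo (-1 : ℝ) 1, divRes α ζ x = 0) :
    IsProfile (fun x => (1 - x ^ 2) * (x * α x - ζ x)) (fun x => (1 - x ^ 2) * β x) α β ζ := by
  have hderiv : ∀ x ∈ Ioo (-1 : ℝ) 1, deriv (fun x => (1 - x ^ 2) * (x * α x - ζ x)) x =
      (1 - x ^ 2) * α x + x * ζ x := by
    intro x hx
    have dα := hasDerivAt_of_contDiffOn hα isOpen_Ioo hx
    have dζ := hasDerivAt_of_contDiffOn hζ isOpen_Ioo hx
    have h := hdiv x hx
    simp only [divRes, rhoOp, zOp] at h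
    push_cast at h
    refine (((hasDerivAt_one_sub_sq x).fun_mul
      (((hasDerivAt_id' x).fun_mul dα).fun_sub dζ)).congr_deriv ?_).deriv
    linear_combination -h
  refine ⟨by fun_prop, by fun_prop, fun x hx => ?_, fun x hx => ?_, fun x hx => ?_⟩
  · have hw := (one_sub_sq_pos hx).ne'
    simp only [hderiv x hx]
    field_simp
    ring
  · exact (mul_div_cancel_left₀ _ (one_sub_sq_pos hx).ne').symm
  · simp only [hderiv x hx]
    ring

lemma IsProfile.profileEquations {f g : ℝ → ℝ} (hP : IsProfile f g α β ζ)
    (hp : ∀ y ∈ offAxis, DifferentiableAt ℝ p y)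
    (hhom : ∀ y ∈ offAxis, ∀ c : ℝ, 0 < c → p (c • y) = (c ^ 2)⁻¹ * p y)
    (h : SolvesNavierStokes (axiField α β ζ) p offAxis) : ProfileEquations f g := by
  have hα := hP.contDiffOn_radial
  have hβ := hP.contDiffOn_swirl
  have hζ := hP.contDiffOn_axial
  refine ⟨hP.smooth_f, hP.smooth_g, fun x hx => ?_, fun x hx => ?_⟩
  · have hswirl := swirlRes_eq_zero_of_solves hα hβ hζ hp h hx
    rw [hP.swirlRes_eq hx] at hswirl
    linear_combination -(div_eq_zero_iff.1 hswirl).resolve_right (one_sub_sq_pos hx).ne'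
  · have hpressure : EqOn (pressureForm f g) (fun z => 2 * p (meridian z)) (Ioo (-1) 1) :=
      fun z hz => by
        simp only [pressure_meridian_eq hα hβ hζ hp hhom h hz, hP.radialRes_eq hz,
          hP.axialRes_eq hz]
        ring
    have hpolar := ((hasDerivAt_pressure_meridian hα hβ hζ hp h hx).const_mul
      2).congr_of_eventuallyEq (hpressure.eventuallyEq_of_mem (isOpen_Ioo.mem_nhds hx))
    have hderiv := hpolar.unique (hasDerivAt_pressureForm hP.smooth_f hP.smooth_g hx)
    rw [hP.radialRes_eq hx, hP.axialRes_eq hx] at hderiv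
    linear_combination hderiv

end ProfileReduction

namespace IsAxisymmetricSolution

variable {u : R3 → R3} {p : R3 → ℝ}

lemma eqOn_axiField (h : IsAxisymmetricSolution u p) :
    EqOn u (axiField (fun x => u (meridian x) 0 / √(1 - x ^ 2))
      (fun x => u (meridian x) 1 / √(1 - x ^ 2)) (fun x => u (meridian x) 2)) offAxis := by
  intro y hy
  have hr : 0 < ‖y‖ := norm_pos_iff.2 (ne_zero_of_mem_offAxis hy)
  have hx := cosPolar_mem_Ioo hy
  have hσ := sqrt_one_sub_sq_pos hx
  have hmer := eR_arccos (Ioo_subset_Icc_self hx)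
  obtain ⟨φ, hφ⟩ := exists_eq_norm_smul_eR hy
  have hrot := h.axisymmetric.apply_smul_eR hr (arccos_mem_Ioo hx) φ
  rw [← hφ, hmer, h.homogeneous_velocity _
    (offAxis_subset_slitSpace (meridian_mem_offAxis hx)) _ hr] at hrot
  have hy0 : y 0 = ‖y‖ * (√(1 - cosPolar y ^ 2) * Real.cos φ) := by
    conv_lhs => rw [hφ]
    simp [eR, Real.sin_arccos]
  have hy1 : y 1 = ‖y‖ * (√(1 - cosPolar y ^ 2) * Real.sin φ) := by
    conv_lhs => rw [hφ]
    simp [eR, Real.sin_arccos]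
  rw [hrot, axiField, hy0, hy1]
  ext k
  fin_cases k <;> simp [hom] <;> field_simp

lemma exists_profileEquations (h : IsAxisymmetricSolution u p) :
    ∃ f g : ℝ → ℝ, ProfileEquations f g ∧
      EqOn f (UTheta u) (Ioo (-1) 1) ∧ EqOn g (UPhi u) (Ioo (-1) 1) := by
  have hcomp : ∀ j, ContDiffOn ℝ ∞ (fun x => u (meridian x) j) (Ioo (-1) 1) := fun j =>
    (contDiff_coord j).comp_contDiffOn (h.smooth_velocity.comp contDiffOn_meridian
      fun x hx => offAxis_subset_slitSpace (meridian_mem_offAxis hx))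
  have hdiv : ∀ j, ContDiffOn ℝ ∞ (fun x => u (meridian x) j / √(1 - x ^ 2)) (Ioo (-1) 1) :=
    fun j => (hcomp j).div contDiffOn_sqrt_one_sub_sq fun x hx => (sqrt_one_sub_sq_pos hx).ne'
  have hNS : SolvesNavierStokes _ p offAxis := SolvesNavierStokes.congr
    (fun y hy => h.equations y (offAxis_subset_slitSpace hy)) isOpen_offAxis h.eqOn_axiField
  have hP := isProfile_of_divRes_eq_zero (hdiv 0) (hdiv 1) (hcomp 2)
    fun x hx => divRes_eq_zero_of_solves (hdiv 0) (hdiv 1) (hcomp 2) hNS hx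
  refine ⟨_, _, hP.profileEquations (fun y hy => differentiableAt_of_contDiffOn h.smooth_pressure
    isOpen_slitSpace (offAxis_subset_slitSpace hy)) (fun y hy =>
    h.homogeneous_pressure y (offAxis_subset_slitSpace hy)) hNS, fun x hx => ?_, fun x hx => ?_⟩
  · have hsq := Real.sq_sqrt (one_sub_sq_pos hx).le
    have hquot : (1 - x ^ 2) / √(1 - x ^ 2) = √(1 - x ^ 2) := Real.div_sqrt
    simp only [UTheta_eq u (Ioo_subset_Icc_self hx)]
    linear_combination x * u (meridian x) 0 * hquot + u (meridian x) 2 * hsq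
  · have hquot : (1 - x ^ 2) / √(1 - x ^ 2) = √(1 - x ^ 2) := Real.div_sqrt
    simp only [UPhi_eq u (Ioo_subset_Icc_self hx)]
    linear_combination u (meridian x) 1 * hquot

lemma tendsto_UPhi_north (h : IsAxisymmetricSolution u p) :
    Tendsto (UPhi u) (𝓝[<] 1) (𝓝 0) := by
  have hmem : meridian 1 ∈ slitSpace := fun ⟨_, _, hle⟩ =>
    (show ¬ (1 : ℝ) ≤ 0 by norm_num) hle
  have hu : ContinuousAt u (meridian 1) :=
    (differentiableAt_of_contDiffOn h.smooth_velocity isOpen_slitSpace hmem).continuousAt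
  have hcomp : ContinuousAt (fun x => u (meridian x) 1) 1 :=
    (contDiff_coord 1).continuous.continuousAt.comp
      (ContinuousAt.comp (f := meridian) hu continuous_meridian.continuousAt)
  have hcont : ContinuousAt (fun x => √(1 - x ^ 2) * u (meridian x) 1) 1 :=
    ContinuousAt.mul (by fun_prop) hcomp
  have hlim : Tendsto (fun x => √(1 - x ^ 2) * u (meridian x) 1) (𝓝[<] 1) (𝓝 0) := by
    simpa using hcont.tendsto.mono_left nhdsWithin_le_nhds
  refine hlim.congr' ?_
  filter_upwards [Ioo_mem_nhdsLT (show (-1 : ℝ) < 1 by norm_num)] with x hx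
  exact (UPhi_eq u (Ioo_subset_Icc_self hx)).symm

theorem exists_UThetaAtSouth (h : IsAxisymmetricSolution u p) :
    ∃ a : ℝ, UThetaAtSouth u a ∧ (3 ≤ a → ∀ x ∈ Ioc (-1 : ℝ) 1, UPhi u x = 0) := by
  obtain ⟨f, g, hfg, hf, hg⟩ := h.exists_profileEquations
  have hg_north : Tendsto g (𝓝[<] 1) (𝓝 0) := h.tendsto_UPhi_north.congr'
    (hg.symm.eventuallyEq_of_mem (Ioo_mem_nhdsLT (by norm_num)))
  obtain ⟨a, ha, hzero⟩ := hfg.exists_tendsto_south hg_north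
  refine ⟨a, ha.congr' (hf.eventuallyEq_of_mem (Ioo_mem_nhdsGT (by norm_num))),
    fun h3 x hx => ?_⟩
  rcases hx.2.lt_or_eq with hlt | rfl
  · rw [← hg ⟨hx.1, hlt⟩]
    exact hzero h3 x ⟨hx.1, hlt⟩
  · simp [UPhi]

end IsAxisymmetricSolution

/-! ### Functions of power growth at the south pole -/

/-- Continuity on `(0, 3)` together with the bound `C * y ^ p`. The variable is `y = 1 + x`, so that
the south pole is `y = 0` and the north pole `y = 2` is an interior point: solutions continued past
it are smooth there. -/
structure PowerBounded (p C : ℝ) (φ : ℝ → ℝ) : Prop where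
  cont : ContinuousOn φ (Ioo 0 3)
  bound : ∀ y ∈ Ioo (0 : ℝ) 3, |φ y| ≤ C * y ^ p

namespace PowerBounded

variable {p q C C' : ℝ} {φ ψ : ℝ → ℝ}

lemma congr (h : PowerBounded p C φ) (he : EqOn ψ φ (Ioo 0 3)) : PowerBounded p C ψ :=
  ⟨h.cont.congr he, fun y hy => by rw [he hy]; exact h.bound y hy⟩

lemma mono (h : PowerBounded p C φ) (hC : C ≤ C') : PowerBounded p C' φ :=
  ⟨h.cont, fun y hy => (h.bound y hy).trans (by have := hy.1; gcongr)⟩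

lemma nonneg (h : PowerBounded p C φ) : 0 ≤ C := by
  simpa using (abs_nonneg _).trans (h.bound 1 ⟨by norm_num, by norm_num⟩)

lemma zero : PowerBounded p 0 (fun _ => 0) :=
  ⟨continuousOn_const, fun y _ => by simp⟩

lemma add (h : PowerBounded p C φ) (h' : PowerBounded p C' ψ) :
    PowerBounded p (C + C') (fun y => φ y + ψ y) :=
  ⟨h.cont.add h'.cont, fun y hy => by
    rw [add_mul]
    exact (abs_add_le _ _).trans (add_le_add (h.bound y hy) (h'.bound y hy))⟩

lemma const_mul (h : PowerBounded p C φ) (c : ℝ) : PowerBounded p (|c| * C) (fun y => c * φ y) :=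
  ⟨continuousOn_const.mul h.cont, fun y hy => by
    rw [abs_mul, mul_assoc]
    exact mul_le_mul_of_nonneg_left (h.bound y hy) (abs_nonneg c)⟩

lemma sub (h : PowerBounded p C φ) (h' : PowerBounded p C' ψ) :
    PowerBounded p (C + C') (fun y => φ y - ψ y) :=
  ⟨h.cont.sub h'.cont, fun y hy => by
    rw [add_mul]
    exact (abs_sub _ _).trans (add_le_add (h.bound y hy) (h'.bound y hy))⟩

lemma mul (h : PowerBounded p C φ) (h' : PowerBounded q C' ψ) :
    PowerBounded (p + q) (C * C') (fun y => φ y * ψ y) :=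
  ⟨h.cont.mul h'.cont, fun y hy => by
    have hφ := h.bound y hy
    rw [abs_mul, Real.rpow_add hy.1]
    calc |φ y| * |ψ y| ≤ (C * y ^ p) * (C' * y ^ q) :=
          mul_le_mul hφ (h'.bound y hy) (abs_nonneg _) ((abs_nonneg _).trans hφ)
      _ = _ := by ring⟩

lemma weaken (h : PowerBounded p C φ) (hq : q ≤ p) : PowerBounded q (C * 3 ^ (p - q)) φ :=
  ⟨h.cont, fun y hy => by
    have hpow : y ^ (p - q) ≤ (3 : ℝ) ^ (p - q) :=
      Real.rpow_le_rpow hy.1.le hy.2.le (by linarith)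
    have hC := h.nonneg
    have hy0 := hy.1
    calc |φ y| ≤ C * (y ^ (p - q) * y ^ q) := by
          rw [← Real.rpow_add hy0, sub_add_cancel]
          exact h.bound y hy
      _ ≤ C * (3 ^ (p - q) * y ^ q) := by gcongr
      _ = _ := by ring⟩

lemma rpow (p : ℝ) : PowerBounded p 1 (fun y => y ^ p) :=
  ⟨fun y hy => (Real.continuousAt_rpow_const y p (Or.inl hy.1.ne')).continuousWithinAt,
    fun y hy => by
      have := hy.1
      rw [one_mul, abs_of_nonneg (by positivity)]⟩

lemma div_id (h : PowerBounded p C φ) : PowerBounded (p - 1) C (fun y => φ y / y) := by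
  have hmul := h.mul (rpow (-1))
  rw [mul_one, ← sub_eq_add_neg] at hmul
  refine hmul.congr fun y _ => ?_
  simp only [Real.rpow_neg_one, div_eq_mul_inv]

lemma abs_apply_le (h : PowerBounded 0 C φ) {y : ℝ} (hy : y ∈ Ioo (0 : ℝ) 3) : |φ y| ≤ C := by
  simpa using h.bound y hy

end PowerBounded

lemma two_mem_Ioo_zero_three : (2 : ℝ) ∈ Ioo (0 : ℝ) 3 := by norm_num

/-- The primitive vanishing at `0`. -/
def primitive (φ : ℝ → ℝ) (y : ℝ) : ℝ := ∫ s in (0 : ℝ)..y, φ s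

section Primitive

variable {a C C' : ℝ} {φ ψ : ℝ → ℝ} {y : ℝ}

lemma PowerBounded.intervalIntegrable (h : PowerBounded (a - 1) C φ) (ha : 0 < a)
    (hy : y ∈ Ioo (0 : ℝ) 3) : IntervalIntegrable φ MeasureTheory.volume 0 y := by
  have hsub : uIoc (0 : ℝ) y ⊆ Ioo 0 3 := by
    rw [uIoc_of_le hy.1.le]
    exact fun s hs => ⟨hs.1, hs.2.trans_lt hy.2⟩
  have hpow : IntervalIntegrable (fun s : ℝ => C * s ^ (a - 1)) MeasureTheory.volume 0 y :=
    (intervalIntegral.intervalIntegrable_rpow' (by linarith)).const_mul C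
  refine hpow.mono_fun' ((h.cont.mono hsub).aestronglyMeasurable measurableSet_uIoc) ?_
  filter_upwards [MeasureTheory.self_mem_ae_restrict measurableSet_uIoc] with s hs
  exact h.bound s (hsub hs)

lemma hasDerivAt_integral_of_continuousOn {c : ℝ} (hφ : ContinuousOn φ (Ioo 0 3))
    (hint : IntervalIntegrable φ MeasureTheory.volume c y) (hy : y ∈ Ioo (0 : ℝ) 3) :
    HasDerivAt (fun y => ∫ s in c..y, φ s) (φ y) y :=
  intervalIntegral.integral_hasDerivAt_right hint
    (hφ.stronglyMeasurableAtFilter isOpen_Ioo y hy) (hφ.continuousAt (isOpen_Ioo.mem_nhds hy))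

lemma PowerBounded.hasDerivAt_primitive (h : PowerBounded (a - 1) C φ) (ha : 0 < a)
    (hy : y ∈ Ioo (0 : ℝ) 3) : HasDerivAt (primitive φ) (φ y) y :=
  hasDerivAt_integral_of_continuousOn h.cont (h.intervalIntegrable ha hy) hy

lemma PowerBounded.integral (h : PowerBounded (a - 1) C φ) (ha : 0 < a) :
    PowerBounded a (C / a) (primitive φ) := by
  refine ⟨fun y hy => (h.hasDerivAt_primitive ha hy).continuousAt.continuousWithinAt,
    fun y hy => ?_⟩
  have hpow : IntervalIntegrable (fun s : ℝ => C * s ^ (a - 1)) MeasureTheory.volume 0 y :=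
    (intervalIntegral.intervalIntegrable_rpow' (by linarith)).const_mul C
  refine (intervalIntegral.norm_integral_le_of_norm_le (f := φ) hy.1.le
    (Eventually.of_forall fun s hs => h.bound s ⟨hs.1, hs.2.trans_lt hy.2⟩) hpow).trans_eq ?_
  rw [intervalIntegral.integral_const_mul, integral_rpow (Or.inl (by linarith)), sub_add_cancel,
    Real.zero_rpow ha.ne']
  ring

lemma PowerBounded.primitive_sub (h : PowerBounded (a - 1) C φ) (h' : PowerBounded (a - 1) C' ψ)
    (ha : 0 < a) (hy : y ∈ Ioo (0 : ℝ) 3) :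
    primitive φ y - primitive ψ y = primitive (fun s => φ s - ψ s) y :=
  (intervalIntegral.integral_sub (h.intervalIntegrable ha hy) (h'.intervalIntegrable ha hy)).symm

lemma uIcc_two_subset (hy : y ∈ Ioo (0 : ℝ) 3) : uIcc 2 y ⊆ Ioo 0 3 :=
  ordConnected_Ioo.uIcc_subset two_mem_Ioo_zero_three hy

lemma intervalIntegrable_from_two (hφ : ContinuousOn φ (Ioo 0 3)) (hy : y ∈ Ioo (0 : ℝ) 3) :
    IntervalIntegrable φ MeasureTheory.volume 2 y :=
  (hφ.mono (uIcc_two_subset hy)).intervalIntegrable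

lemma two_rpow_neg_le (ha : 0 < a) (hy : y ∈ Ioo (0 : ℝ) 3) :
    (2 : ℝ) ^ (-a) ≤ (3 / 2) ^ a * y ^ (-a) := by
  have hinv : (3 : ℝ)⁻¹ ≤ y⁻¹ := inv_anti₀ hy.1 hy.2.le
  rw [Real.rpow_neg hy.1.le, Real.rpow_neg two_pos.le, ← Real.inv_rpow hy.1.le,
    ← Real.inv_rpow two_pos.le, ← Real.mul_rpow (by norm_num) (inv_nonneg.2 hy.1.le)]
  exact Real.rpow_le_rpow (by norm_num) (by linarith) ha.le

lemma PowerBounded.integral_from_two (h : PowerBounded (-a - 1) C φ) (ha : 0 < a) :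
    PowerBounded (-a) ((3 / 2) ^ a / a * C) (fun y => ∫ s in (2 : ℝ)..y, φ s) := by
  refine ⟨fun y hy => (hasDerivAt_integral_of_continuousOn h.cont
    (intervalIntegrable_from_two h.cont hy) hy).continuousAt.continuousWithinAt, fun y hy => ?_⟩
  have h0 : (0 : ℝ) ∉ uIcc 2 y := fun h0 => lt_irrefl 0 (uIcc_two_subset hy h0).1
  have hC := h.nonneg
  have hdiff : |y ^ (-a) - 2 ^ (-a)| ≤ (3 / 2) ^ a * y ^ (-a) := by
    have hone : (1 : ℝ) ≤ (3 / 2) ^ a := Real.one_le_rpow (by norm_num) ha.le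
    have hy_pos : 0 < y ^ (-a) := Real.rpow_pos_of_pos hy.1 _
    have htwo_pos : (0 : ℝ) < 2 ^ (-a) := by positivity
    have htwo := two_rpow_neg_le ha hy
    rw [abs_le]
    constructor <;> nlinarith
  calc |∫ s in (2 : ℝ)..y, φ s| ≤ |∫ s in (2 : ℝ)..y, C * s ^ (-a - 1)| := by
        refine intervalIntegral.norm_integral_le_abs_of_norm_le (f := φ) ?_
          ((intervalIntegral.intervalIntegrable_rpow (Or.inr h0)).const_mul C)
        filter_upwards [MeasureTheory.self_mem_ae_restrict measurableSet_uIoc] with s hs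
        exact h.bound s (uIcc_two_subset hy (uIoc_subset_uIcc hs))
    _ = C * (|y ^ (-a) - 2 ^ (-a)| / a) := by
        rw [intervalIntegral.integral_const_mul, integral_rpow (Or.inr ⟨by linarith, h0⟩),
          sub_add_cancel, abs_mul, abs_of_nonneg hC, abs_div, abs_neg, abs_of_pos ha]
    _ ≤ C * ((3 / 2) ^ a * y ^ (-a) / a) := by gcongr
    _ = _ := by ring

end Primitive

/-! ### The linear equation `y w' = μ w + φ` -/

/-- A bounded linear solution operator for `y w' = μ w + φ` in the class of functions bounded by a
multiple of `y ^ α`. -/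
structure IsSolutionOperator (μ α c : ℝ) (S : (ℝ → ℝ) → ℝ → ℝ) : Prop where
  nonneg : 0 ≤ c
  hasDerivAt : ∀ {φ C}, PowerBounded α C φ → ∀ y ∈ Ioo (0 : ℝ) 3,
    HasDerivAt (S φ) ((μ * S φ y + φ y) / y) y
  bound : ∀ {φ C}, PowerBounded α C φ → PowerBounded α (c * C) (S φ)
  sub : ∀ {φ ψ C C'}, PowerBounded α C φ → PowerBounded α C' ψ → ∀ y ∈ Ioo (0 : ℝ) 3,
    S φ y - S ψ y = S (fun s => φ s - ψ s) y

section SolutionOperator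

variable {μ α C : ℝ} {φ : ℝ → ℝ}

lemma PowerBounded.rpow_mul (h : PowerBounded α C φ) (μ : ℝ) :
    PowerBounded (α - μ - 1) C (fun s => s ^ (-μ - 1) * φ s) := by
  have hmul := (PowerBounded.rpow (-μ - 1)).mul h
  rwa [one_mul, show -μ - 1 + α = α - μ - 1 by ring] at hmul

lemma hasDerivAt_rpow_mul_integral {F : ℝ → ℝ} {y : ℝ} (hy : 0 < y)
    (hF : HasDerivAt F (y ^ (-μ - 1) * φ y) y) :
    HasDerivAt (fun y => y ^ μ * F y) ((μ * (y ^ μ * F y) + φ y) / y) y := by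
  refine ((Real.hasDerivAt_rpow_const (p := μ) (Or.inl hy.ne')).fun_mul hF).congr_deriv ?_
  have hcancel : y ^ μ * y ^ (-μ - 1) = y⁻¹ := by
    rw [← Real.rpow_add hy, show μ + (-μ - 1) = -1 by ring, Real.rpow_neg_one]
  rw [Real.rpow_sub_one hy.ne' μ, ← mul_assoc (y ^ μ) (y ^ (-μ - 1)), hcancel]
  field_simp

lemma isSolutionOperator_of_lt (h : μ < α) : IsSolutionOperator μ α (1 / (α - μ))
    (fun φ y => y ^ μ * primitive (fun s => s ^ (-μ - 1) * φ s) y) where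
  nonneg := one_div_nonneg.2 (sub_nonneg.2 h.le)
  hasDerivAt hφ _ hy :=
    hasDerivAt_rpow_mul_integral hy.1 ((hφ.rpow_mul μ).hasDerivAt_primitive (sub_pos.2 h) hy)
  bound hφ := by
    have hmul := (PowerBounded.rpow μ).mul ((hφ.rpow_mul μ).integral (sub_pos.2 h))
    rw [add_sub_cancel, one_mul] at hmul
    exact hmul.mono (one_div_mul_eq_div _ _).ge
  sub hφ hψ y hy := by
    rw [← mul_sub, (hφ.rpow_mul μ).primitive_sub (hψ.rpow_mul μ) (sub_pos.2 h) hy]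
    simp only [mul_sub]

lemma isSolutionOperator_of_gt (h : α < μ) :
    IsSolutionOperator μ α ((3 / 2) ^ (μ - α) / (μ - α))
      (fun φ y => y ^ μ * ∫ s in (2 : ℝ)..y, s ^ (-μ - 1) * φ s) where
  nonneg := div_nonneg (by positivity) (sub_nonneg.2 h.le)
  hasDerivAt hφ y hy :=
    hasDerivAt_rpow_mul_integral hy.1 (hasDerivAt_integral_of_continuousOn (hφ.rpow_mul μ).cont
      (intervalIntegrable_from_two (hφ.rpow_mul μ).cont hy) hy)
  bound hφ := by
    have hweight := hφ.rpow_mul μ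
    rw [← neg_sub μ α] at hweight
    have hmul := (PowerBounded.rpow μ).mul (hweight.integral_from_two (sub_pos.2 h))
    rwa [neg_sub, add_sub_cancel, one_mul] at hmul
  sub hφ hψ y hy := by
    rw [← mul_sub, ← intervalIntegral.integral_sub
      (intervalIntegrable_from_two (hφ.rpow_mul μ).cont hy)
      (intervalIntegrable_from_two (hψ.rpow_mul μ).cont hy)]
    simp only [mul_sub]

end SolutionOperator

/-! ### A contraction principle in weighted spaces -/

/-- The function `y ^ α * v y`, continued by zero outside `(0, 3)`. It identifies the Banach space
of bounded continuous functions on `(0, 3)` with the functions bounded by a multiple of `y ^ α`. -/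
def weightedExtension (α : ℝ) (v : BoundedContinuousFunction (Ioo (0 : ℝ) 3) ℝ) (y : ℝ) : ℝ :=
  y ^ α * Function.extend Subtype.val v 0 y

section WeightedExtension

variable {α C C' : ℝ} {φ ψ : ℝ → ℝ}

lemma weightedExtension_apply (α : ℝ) (v : BoundedContinuousFunction (Ioo (0 : ℝ) 3) ℝ)
    (y : Ioo (0 : ℝ) 3) : weightedExtension α v y = (y : ℝ) ^ α * v y := by
  rw [weightedExtension, Subtype.val_injective.extend_apply]

lemma powerBounded_weightedExtension {v : BoundedContinuousFunction (Ioo (0 : ℝ) 3) ℝ}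
    (hv : ‖v‖ ≤ C) : PowerBounded α C (weightedExtension α v) where
  cont := by
    rw [continuousOn_iff_continuous_domRestrict]
    refine ((continuousOn_iff_continuous_domRestrict.1 (PowerBounded.rpow α).cont).mul
      v.continuous).congr fun y => ?_
    exact (weightedExtension_apply α v y).symm
  bound y hy := by
    have hpos : 0 < y ^ α := Real.rpow_pos_of_pos hy.1 _
    rw [weightedExtension_apply α v ⟨y, hy⟩, abs_mul, abs_of_pos hpos, mul_comm]
    exact mul_le_mul_of_nonneg_right ((v.norm_coe_le_norm _).trans hv) hpos.le

lemma PowerBounded.norm_rpow_neg_mul_le (h : PowerBounded α C φ) (y : Ioo (0 : ℝ) 3) :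
    ‖(y : ℝ) ^ (-α) * φ y‖ ≤ C := by
  have hpos : 0 < (y : ℝ) ^ (-α) := Real.rpow_pos_of_pos y.2.1 _
  rw [norm_mul, Real.norm_of_nonneg hpos.le]
  calc (y : ℝ) ^ (-α) * ‖φ y‖ ≤ (y : ℝ) ^ (-α) * (C * (y : ℝ) ^ α) :=
        mul_le_mul_of_nonneg_left (h.bound y y.2) hpos.le
    _ = C * (y : ℝ) ^ (-α + α) := by rw [Real.rpow_add y.2.1]; ring
    _ = C := by rw [neg_add_cancel, Real.rpow_zero, mul_one]

/-- The bounded continuous function `y ^ (-α) * φ y`, an inverse of `weightedExtension`. -/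
def PowerBounded.rescale (h : PowerBounded α C φ) :
    BoundedContinuousFunction (Ioo (0 : ℝ) 3) ℝ :=
  BoundedContinuousFunction.ofNormedAddCommGroup (fun y => (y : ℝ) ^ (-α) * φ y)
    ((continuousOn_iff_continuous_domRestrict.1 (PowerBounded.rpow (-α)).cont).mul
      (continuousOn_iff_continuous_domRestrict.1 h.cont)) C h.norm_rpow_neg_mul_le

lemma PowerBounded.rescale_apply (h : PowerBounded α C φ) (y : Ioo (0 : ℝ) 3) :
    h.rescale y = (y : ℝ) ^ (-α) * φ y := rfl

lemma PowerBounded.norm_rescale_le (h : PowerBounded α C φ) : ‖h.rescale‖ ≤ C :=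
  BoundedContinuousFunction.norm_ofNormedAddCommGroup_le _ h.nonneg h.norm_rpow_neg_mul_le

lemma PowerBounded.dist_rescale_le (h : PowerBounded α C φ) (h' : PowerBounded α C' ψ) {d : ℝ}
    (hd : PowerBounded α d (fun y => φ y - ψ y)) : dist h.rescale h'.rescale ≤ d := by
  refine (BoundedContinuousFunction.dist_le hd.nonneg).2 fun y => ?_
  rw [dist_eq_norm, h.rescale_apply, h'.rescale_apply, ← mul_sub]
  exact hd.norm_rpow_neg_mul_le y

lemma PowerBounded.weightedExtension_rescale (h : PowerBounded α C φ) :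
    EqOn (weightedExtension α h.rescale) φ (Ioo 0 3) := fun y hy => by
  rw [weightedExtension_apply α h.rescale ⟨y, hy⟩, h.rescale_apply, ← mul_assoc,
    ← Real.rpow_add hy.1, add_neg_cancel, Real.rpow_zero, one_mul]

lemma powerBounded_weightedExtension_sub (v₁ v₂ : BoundedContinuousFunction (Ioo (0 : ℝ) 3) ℝ) :
    PowerBounded α (dist v₁ v₂)
      (fun y => weightedExtension α v₁ y - weightedExtension α v₂ y) := by
  refine (powerBounded_weightedExtension (dist_eq_norm v₁ v₂).ge).congr fun y hy => ?_
  simp only [weightedExtension_apply α _ ⟨y, hy⟩, BoundedContinuousFunction.sub_apply, mul_sub]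

end WeightedExtension

lemma exists_fixedPoint_of_contracting {α δ : ℝ} (hδ : 0 ≤ δ) (N : (ℝ → ℝ) → ℝ → ℝ)
    (hmaps : ∀ w, PowerBounded α δ w → PowerBounded α δ (N w))
    (hcontr : ∀ w₁ w₂ d, PowerBounded α δ w₁ → PowerBounded α δ w₂ →
      PowerBounded α d (fun y => w₁ y - w₂ y) →
      PowerBounded α (d / 2) (fun y => N w₁ y - N w₂ y)) :
    ∃ w, PowerBounded α δ w ∧ EqOn w (N w) (Ioo 0 3) := by
  let B := Metric.closedBall (0 : BoundedContinuousFunction (Ioo (0 : ℝ) 3) ℝ) δ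
  have hball : ∀ v : B, PowerBounded α δ (weightedExtension α v) := fun v =>
    powerBounded_weightedExtension (mem_closedBall_zero_iff.1 v.2)
  have hN : ∀ v : B, PowerBounded α δ (N (weightedExtension α v)) := fun v => hmaps _ (hball v)
  let T : B → B := fun v =>
    ⟨(hN v).rescale, mem_closedBall_zero_iff.2 (hN v).norm_rescale_le⟩
  have hT : ContractingWith (1 / 2) T := by
    refine ⟨by norm_num, LipschitzWith.of_dist_le_mul fun v₁ v₂ => ?_⟩
    have hdist := (hN v₁).dist_rescale_le (hN v₂)
      (hcontr _ _ _ (hball v₁) (hball v₂) (powerBounded_weightedExtension_sub _ _))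
    refine hdist.trans_eq ?_
    rw [← Subtype.dist_eq]
    push_cast
    ring
  have : CompleteSpace B := Metric.isClosed_closedBall.completeSpace_coe
  have : Nonempty B := ⟨⟨0, Metric.mem_closedBall_self hδ⟩⟩
  have hfix : T (hT.fixedPoint T) = hT.fixedPoint T := hT.fixedPoint_isFixedPt
  refine ⟨_, hball (hT.fixedPoint T), fun y hy => ?_⟩
  conv_lhs => rw [← hfix]
  exact (hN _).weightedExtension_rescale hy

/-! ### Averages over the segment to the north pole -/

/-- The average `∫₀¹ ρ(σ) φ(y + σ (2 - y)) dσ` of `φ` over the segment from `y` to `2`, with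
weight `ρ`. -/
def segmentAvg (ρ φ : ℝ → ℝ) (y : ℝ) : ℝ := ∫ σ in (0 : ℝ)..1, ρ σ * φ (y + σ * (2 - y))

section SegmentAvg

variable {ρ φ ψ : ℝ → ℝ} {y : ℝ}

lemma add_mul_two_sub_mem {s : Set ℝ} (hs : s.OrdConnected) (h2 : (2 : ℝ) ∈ s) (hy : y ∈ s) {σ : ℝ}
    (hσ : σ ∈ Icc (0 : ℝ) 1) : y + σ * (2 - y) ∈ s :=
  hs.convex.add_smul_sub_mem hy h2 hσ

lemma exists_Icc_mem_nhds (hy : y ∈ Ioo (0 : ℝ) 3) :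
    ∃ c d : ℝ, Icc c d ⊆ Ioo (0 : ℝ) 3 ∧ Icc c d ∈ 𝓝 y ∧ (2 : ℝ) ∈ Icc c d := by
  refine ⟨min (y / 2) 2, max ((y + 3) / 2) 2, fun s hs => ⟨?_, ?_⟩, Icc_mem_nhds ?_ ?_,
    min_le_right _ _, le_max_right _ _⟩
  · exact lt_of_lt_of_le (lt_min (by linarith [hy.1]) (by norm_num)) hs.1
  · exact lt_of_le_of_lt hs.2 (max_lt (by linarith [hy.2]) (by norm_num))
  · exact lt_of_le_of_lt (min_le_left _ _) (by linarith [hy.1])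
  · exact lt_of_lt_of_le (by linarith [hy.2]) (le_max_left _ _)

lemma intervalIntegrable_segmentAvg_integrand (hρ : Continuous ρ)
    (hφ : ContinuousOn φ (Ioo 0 3)) (hy : y ∈ Ioo (0 : ℝ) 3) :
    IntervalIntegrable (fun σ => ρ σ * φ (y + σ * (2 - y))) MeasureTheory.volume 0 1 := by
  refine ContinuousOn.intervalIntegrable ?_
  rw [uIcc_of_le zero_le_one]
  exact hρ.continuousOn.mul (hφ.comp (by fun_prop)
    fun σ hσ => add_mul_two_sub_mem ordConnected_Ioo two_mem_Ioo_zero_three hy hσ)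

lemma aestronglyMeasurable_segmentAvg_integrand (hρ : Continuous ρ)
    (hφ : ContinuousOn φ (Ioo 0 3)) (hy : y ∈ Ioo (0 : ℝ) 3) :
    MeasureTheory.AEStronglyMeasurable (fun σ => ρ σ * φ (y + σ * (2 - y)))
      (MeasureTheory.volume.restrict (uIoc 0 1)) :=
  (intervalIntegrable_segmentAvg_integrand hρ hφ hy).def'.aestronglyMeasurable

lemma exists_bound_segmentAvg_integrand (hρ : Continuous ρ) (hφ : ContinuousOn φ (Ioo 0 3))
    {c d : ℝ} (hcd : Icc c d ⊆ Ioo (0 : ℝ) 3) (h2 : (2 : ℝ) ∈ Icc c d) :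
    ∃ B, ∀ σ ∈ uIoc (0 : ℝ) 1, ∀ z ∈ Icc c d, ‖ρ σ * φ (z + σ * (2 - z))‖ ≤ B := by
  obtain ⟨B₁, hB₁⟩ := isCompact_Icc.exists_bound_of_continuousOn (s := Icc (0 : ℝ) 1)
    hρ.continuousOn
  obtain ⟨B₂, hB₂⟩ := isCompact_Icc.exists_bound_of_continuousOn (hφ.mono hcd)
  refine ⟨B₁ * B₂, fun σ hσ z hz => ?_⟩
  rw [uIoc_of_le zero_le_one] at hσ
  have hρσ := hB₁ σ ⟨hσ.1.le, hσ.2⟩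
  rw [norm_mul]
  exact mul_le_mul hρσ (hB₂ _ (add_mul_two_sub_mem ordConnected_Icc h2 hz ⟨hσ.1.le, hσ.2⟩))
    (norm_nonneg _) ((norm_nonneg _).trans hρσ)

lemma continuousOn_segmentAvg (hρ : Continuous ρ) (hφ : ContinuousOn φ (Ioo 0 3)) :
    ContinuousOn (segmentAvg ρ φ) (Ioo 0 3) := by
  intro y hy
  obtain ⟨c, d, hcd, hn, h2⟩ := exists_Icc_mem_nhds hy
  obtain ⟨B, hB⟩ := exists_bound_segmentAvg_integrand hρ hφ hcd h2
  refine ContinuousAt.continuousWithinAt (intervalIntegral.continuousAt_of_dominated_interval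
    (bound := fun _ => B) ?_ ?_ intervalIntegrable_const ?_)
  · filter_upwards [isOpen_Ioo.mem_nhds hy] with z hz using
      aestronglyMeasurable_segmentAvg_integrand hρ hφ hz
  · filter_upwards [hn] with z hz
    exact Eventually.of_forall fun σ hσ => hB σ hσ z hz
  · refine Eventually.of_forall fun σ hσ => ?_
    rw [uIoc_of_le zero_le_one] at hσ
    have hm := add_mul_two_sub_mem ordConnected_Ioo two_mem_Ioo_zero_three hy ⟨hσ.1.le, hσ.2⟩
    exact continuousAt_const.mul (ContinuousAt.comp (f := fun z => z + σ * (2 - z))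
      (hφ.continuousAt (isOpen_Ioo.mem_nhds hm)) (by fun_prop))

lemma hasDerivAt_segmentAvg {φ' : ℝ → ℝ} (hρ : Continuous ρ)
    (hφ : ∀ s ∈ Ioo (0 : ℝ) 3, HasDerivAt φ (φ' s) s) (hφ' : ContinuousOn φ' (Ioo 0 3))
    (hy : y ∈ Ioo (0 : ℝ) 3) :
    HasDerivAt (segmentAvg ρ φ) (segmentAvg (fun σ => ρ σ * (1 - σ)) φ' y) y := by
  have hφc : ContinuousOn φ (Ioo 0 3) := fun s hs => (hφ s hs).continuousAt.continuousWithinAt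
  have hρ' : Continuous fun σ => ρ σ * (1 - σ) := by fun_prop
  obtain ⟨c, d, hcd, hn, h2⟩ := exists_Icc_mem_nhds hy
  obtain ⟨B, hB⟩ := exists_bound_segmentAvg_integrand hρ' hφ' hcd h2
  refine (intervalIntegral.hasDerivAt_integral_of_dominated_loc_of_deriv_le
    (F := fun z σ => ρ σ * φ (z + σ * (2 - z)))
    (F' := fun z σ => ρ σ * (1 - σ) * φ' (z + σ * (2 - z)))
    (bound := fun _ => B) hn ?_ (intervalIntegrable_segmentAvg_integrand hρ hφc hy)
    (aestronglyMeasurable_segmentAvg_integrand hρ' hφ' hy) ?_ intervalIntegrable_const ?_).2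
  · filter_upwards [isOpen_Ioo.mem_nhds hy] with z hz using
      aestronglyMeasurable_segmentAvg_integrand hρ hφc hz
  · exact Eventually.of_forall fun σ hσ z hz => hB σ hσ z hz
  · refine Eventually.of_forall fun σ hσ z hz => ?_
    rw [uIoc_of_le zero_le_one] at hσ
    have hm :=
      add_mul_two_sub_mem ordConnected_Ioo two_mem_Ioo_zero_three (hcd hz) ⟨hσ.1.le, hσ.2⟩
    have hline : HasDerivAt (fun z => z + σ * (2 - z)) (1 + σ * -1) z :=
      (hasDerivAt_id' z).fun_add (((hasDerivAt_id' z).const_sub 2).const_mul σ)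
    refine (((hφ _ hm).comp z hline).const_mul (ρ σ)).congr_deriv ?_
    ring

lemma contDiffOn_segmentAvg (n : ℕ) : ∀ {ρ φ : ℝ → ℝ}, Continuous ρ →
    ContDiffOn ℝ n φ (Ioo 0 3) → ContDiffOn ℝ n (segmentAvg ρ φ) (Ioo 0 3) := by
  induction n with
  | zero =>
    intro ρ φ hρ hφ
    exact contDiffOn_zero.2 (continuousOn_segmentAvg hρ hφ.continuousOn)
  | succ n ih =>
    intro ρ φ hρ hφ
    push_cast at hφ ⊢
    rw [contDiffOn_succ_iff_deriv_of_isOpen isOpen_Ioo] at hφ ⊢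
    obtain ⟨hd, -, hc⟩ := hφ
    have hderiv : ∀ z ∈ Ioo (0 : ℝ) 3, HasDerivAt (segmentAvg ρ φ)
        (segmentAvg (fun σ => ρ σ * (1 - σ)) (deriv φ) z) z := fun z hz =>
      hasDerivAt_segmentAvg hρ
        (fun s hs => (hd.differentiableAt (isOpen_Ioo.mem_nhds hs)).hasDerivAt)
        hc.continuousOn hz
    refine ⟨fun z hz => (hderiv z hz).differentiableAt.differentiableWithinAt, by simp, ?_⟩
    exact (ih (by fun_prop) hc).congr fun z hz => (hderiv z hz).deriv

lemma segmentAvg_sub (hρ : Continuous ρ) (hφ : ContinuousOn φ (Ioo 0 3))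
    (hψ : ContinuousOn ψ (Ioo 0 3)) (hy : y ∈ Ioo (0 : ℝ) 3) :
    segmentAvg ρ φ y - segmentAvg ρ ψ y = segmentAvg ρ (fun s => φ s - ψ s) y := by
  unfold segmentAvg
  rw [← intervalIntegral.integral_sub (intervalIntegrable_segmentAvg_integrand hρ hφ hy)
    (intervalIntegrable_segmentAvg_integrand hρ hψ hy)]
  simp only [mul_sub]

lemma rpow_neg_add_mul_two_sub_le {a b c σ : ℝ} (ha : 0 ≤ a) (hb : 0 ≤ b) (hc : 0 ≤ c)
    (hy : y ∈ Ioo (0 : ℝ) 3) (hσ : σ ∈ Ioc (0 : ℝ) 1) :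
    (y + σ * (2 - y)) ^ (-(a + b + c)) ≤
      4 ^ (a + b + c) * (y ^ (-a) * σ ^ (-b) * σ ^ (-c)) := by
  have hy0 := hy.1
  have hσ0 := hσ.1
  have hlow : (y + σ) / 4 ≤ y + σ * (2 - y) := by
    nlinarith [mul_pos hσ.1 (sub_pos.2 hy.2), mul_nonneg (sub_nonneg.2 hσ.2) hy0.le]
  have hanti : ∀ {e z : ℝ}, 0 ≤ e → 0 < z → z ≤ y + σ → (y + σ) ^ (-e) ≤ z ^ (-e) :=
    fun he hz hle => Real.rpow_le_rpow_of_nonpos hz hle (neg_nonpos.2 he)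
  have hya : (y + σ) ^ (-a) ≤ y ^ (-a) := hanti ha hy0 (by linarith)
  have hσb : (y + σ) ^ (-b) ≤ σ ^ (-b) := hanti hb hσ0 (by linarith)
  have hσc : (y + σ) ^ (-c) ≤ σ ^ (-c) := hanti hc hσ0 (by linarith)
  calc (y + σ * (2 - y)) ^ (-(a + b + c)) ≤ ((y + σ) / 4) ^ (-(a + b + c)) :=
        Real.rpow_le_rpow_of_nonpos (by positivity) hlow (by linarith)
    _ = 4 ^ (a + b + c) * ((y + σ) ^ (-a) * (y + σ) ^ (-b) * (y + σ) ^ (-c)) := by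
        rw [Real.div_rpow (by positivity) (by norm_num),
          Real.rpow_neg (by norm_num : (0 : ℝ) ≤ 4), div_inv_eq_mul, mul_comm,
          ← Real.rpow_add (by positivity), ← Real.rpow_add (by positivity)]
        ring_nf
    _ ≤ 4 ^ (a + b + c) * (y ^ (-a) * σ ^ (-b) * σ ^ (-c)) := by gcongr

/-- Averaging over the segment to `2` gains up to one power of `y`, and a weight vanishing at the
end point `y` gains correspondingly more. -/
lemma PowerBounded.average {a b c C : ℝ} (hρ : Continuous ρ) (ha : 0 ≤ a) (hb : 0 ≤ b)
    (hb1 : b < 1) (hc : 0 ≤ c) (hρc : ∀ σ ∈ Ioc (0 : ℝ) 1, |ρ σ| ≤ σ ^ c)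
    (hφ : PowerBounded (-(a + b + c)) C φ) :
    PowerBounded (-a) (C * 4 ^ (a + b + c) / (1 - b)) (segmentAvg ρ φ) := by
  refine ⟨continuousOn_segmentAvg hρ hφ.cont, fun y hy => ?_⟩
  have hC := hφ.nonneg
  set K := C * 4 ^ (a + b + c) * y ^ (-a) with hK
  have hpow : IntervalIntegrable (fun σ : ℝ => K * σ ^ (-b)) MeasureTheory.volume 0 1 :=
    (intervalIntegral.intervalIntegrable_rpow' (by linarith)).const_mul K
  have hbound : ∀ σ ∈ Ioc (0 : ℝ) 1, ‖ρ σ * φ (y + σ * (2 - y))‖ ≤ K * σ ^ (-b) := by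
    intro σ hσ
    have hσ0 := hσ.1
    have hm := add_mul_two_sub_mem ordConnected_Ioo two_mem_Ioo_zero_three hy ⟨hσ.1.le, hσ.2⟩
    rw [norm_mul]
    calc ‖ρ σ‖ * ‖φ (y + σ * (2 - y))‖ ≤
          σ ^ c * (C * (4 ^ (a + b + c) * (y ^ (-a) * σ ^ (-b) * σ ^ (-c)))) :=
          mul_le_mul (hρc σ hσ) ((hφ.bound _ hm).trans (mul_le_mul_of_nonneg_left
            (rpow_neg_add_mul_two_sub_le ha hb hc hy hσ) hC)) (norm_nonneg _) (by positivity)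
      _ = K * σ ^ (-b) * σ ^ (c + -c) := by rw [Real.rpow_add hσ0]; ring
      _ = K * σ ^ (-b) := by rw [add_neg_cancel, Real.rpow_zero, mul_one]
  refine (intervalIntegral.norm_integral_le_of_norm_le zero_le_one
    (Eventually.of_forall hbound) hpow).trans_eq ?_
  rw [intervalIntegral.integral_const_mul, integral_rpow (Or.inl (by linarith)), Real.one_rpow,
    Real.zero_rpow (by linarith), hK, show -b + 1 = 1 - b by ring]
  ring

end SegmentAvg

/-! ### Lipschitz maps between weighted spaces -/

/-- On the unit ball of the functions bounded by a multiple of `y ^ α`, the map `Φ` takes values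
bounded by `C * y ^ p` and is Lipschitz with constant `C` for the norms weighted by `y ^ α` and
`y ^ p`. -/
def LipschitzPowerBounded (α p C : ℝ) (Φ : (ℝ → ℝ) → ℝ → ℝ) : Prop :=
  ∀ w₁ w₂ d, PowerBounded α 1 w₁ → PowerBounded α 1 w₂ →
    PowerBounded α d (fun y => w₁ y - w₂ y) →
    PowerBounded p C (Φ w₁) ∧ PowerBounded p (C * d) (fun y => Φ w₁ y - Φ w₂ y)

lemma abs_exp_neg_sub_exp_neg_le {C x y : ℝ} (hx : |x| ≤ C) (hy : |y| ≤ C) :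
    |Real.exp (-x) - Real.exp (-y)| ≤ Real.exp C * |x - y| := by
  have hlip : ∀ t ∈ Iic C, ‖deriv Real.exp t‖ ≤ Real.exp C := fun t ht => by
    rw [Real.deriv_exp, Real.norm_of_nonneg (Real.exp_pos t).le]
    exact Real.exp_le_exp.2 ht
  have h := (convex_Iic C).norm_image_sub_le_of_norm_deriv_le
    (fun t _ => Real.differentiableAt_exp) hlip (neg_le.2 (abs_le.1 hy).1 : -y ≤ C)
    (neg_le.2 (abs_le.1 hx).1 : -x ≤ C)
  rwa [show -x - -y = -(x - y) by ring, norm_neg] at h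

namespace LipschitzPowerBounded

variable {α p q C C' : ℝ} {Φ Ψ : (ℝ → ℝ) → ℝ → ℝ}

lemma apply {w : ℝ → ℝ} (h : LipschitzPowerBounded α p C Φ) (hw : PowerBounded α 1 w) :
    PowerBounded p C (Φ w) :=
  (h w w 0 hw hw (PowerBounded.zero.congr fun _ _ => sub_self _)).1

lemma nonneg (h : LipschitzPowerBounded α p C Φ) : 0 ≤ C :=
  (h.apply (PowerBounded.zero.mono zero_le_one)).nonneg

lemma id : LipschitzPowerBounded α α 1 fun w => w :=
  fun _ _ _ h₁ _ hd => ⟨h₁, by rwa [one_mul]⟩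

lemma weaken (h : LipschitzPowerBounded α p C Φ) (hq : q ≤ p) :
    LipschitzPowerBounded α q (C * 3 ^ (p - q)) Φ :=
  fun w₁ w₂ d h₁ h₂ hd => ⟨(h w₁ w₂ d h₁ h₂ hd).1.weaken hq, by
    have := (h w₁ w₂ d h₁ h₂ hd).2.weaken hq
    rwa [mul_right_comm] at this⟩

lemma mul (h : LipschitzPowerBounded α p C Φ) (h' : LipschitzPowerBounded α q C' Ψ) :
    LipschitzPowerBounded α (p + q) (2 * C * C') fun w y => Φ w y * Ψ w y := by
  intro w₁ w₂ d h₁ h₂ hd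
  obtain ⟨hΦ, hΦd⟩ := h w₁ w₂ d h₁ h₂ hd
  obtain ⟨hΨ, hΨd⟩ := h' w₁ w₂ d h₁ h₂ hd
  refine ⟨(hΦ.mul hΨ).mono (by nlinarith [mul_nonneg hΦ.nonneg hΨ.nonneg]), ?_⟩
  refine (((hΦd.mul hΨ).add ((h.apply h₂).mul hΨd)).mono
    (show _ ≤ 2 * C * C' * d from le_of_eq (by ring))).congr fun y _ => ?_
  simp only
  ring

lemma of_fixed {φ : ℝ → ℝ} (h : PowerBounded p C φ) : LipschitzPowerBounded α p C fun _ => φ :=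
  fun _ _ _ _ _ hd => ⟨h, (PowerBounded.zero.mono (mul_nonneg h.nonneg hd.nonneg)).congr
    fun _ _ => sub_self _⟩

lemma div_id (h : LipschitzPowerBounded α p C Φ) :
    LipschitzPowerBounded α (p - 1) C fun w y => Φ w y / y :=
  fun w₁ w₂ d h₁ h₂ hd => ⟨(h w₁ w₂ d h₁ h₂ hd).1.div_id,
    (h w₁ w₂ d h₁ h₂ hd).2.div_id.congr fun _ _ => (sub_div _ _ _).symm⟩

lemma integral {a : ℝ} (h : LipschitzPowerBounded α (a - 1) C Φ) (ha : 0 < a) :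
    LipschitzPowerBounded α a (C / a) fun w => primitive (Φ w) := fun w₁ w₂ d h₁ h₂ hd => by
  obtain ⟨hΦ, hΦd⟩ := h w₁ w₂ d h₁ h₂ hd
  refine ⟨hΦ.integral ha, ?_⟩
  rw [div_mul_eq_mul_div]
  exact (hΦd.integral ha).congr fun y hy => hΦ.primitive_sub (h.apply h₂) ha hy

lemma average {ρ : ℝ → ℝ} {a b c : ℝ} (hρ : Continuous ρ) (ha : 0 ≤ a) (hb : 0 ≤ b) (hb1 : b < 1)
    (hc : 0 ≤ c) (hρc : ∀ σ ∈ Ioc (0 : ℝ) 1, |ρ σ| ≤ σ ^ c)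
    (h : LipschitzPowerBounded α (-(a + b + c)) C Φ) :
    LipschitzPowerBounded α (-a) (C * 4 ^ (a + b + c) / (1 - b)) fun w => segmentAvg ρ (Φ w) :=
  fun w₁ w₂ d h₁ h₂ hd => by
    obtain ⟨hΦ, hΦd⟩ := h w₁ w₂ d h₁ h₂ hd
    refine ⟨hΦ.average hρ ha hb hb1 hc hρc, ?_⟩
    refine ((hΦd.average hρ ha hb hb1 hc hρc).congr fun y hy =>
      segmentAvg_sub hρ hΦ.cont (h.apply h₂).cont hy).mono (le_of_eq ?_)
    ring

lemma exp_neg (h : LipschitzPowerBounded α 0 C Φ) :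
    LipschitzPowerBounded α 0 (Real.exp C * (1 + C)) fun w y => Real.exp (-Φ w y) := by
  intro w₁ w₂ d h₁ h₂ hd
  obtain ⟨hΦ₁, hΦd⟩ := h w₁ w₂ d h₁ h₂ hd
  have hΦ₂ := h.apply h₂
  have hC := hΦ₁.nonneg
  have hd0 := hd.nonneg
  have hcont : ∀ {φ : ℝ → ℝ}, PowerBounded 0 C φ →
      ContinuousOn (fun y => Real.exp (-φ y)) (Ioo 0 3) := fun hφ =>
    Real.continuous_exp.comp_continuousOn hφ.cont.neg
  refine ⟨⟨hcont hΦ₁, fun y hy => ?_⟩, ⟨(hcont hΦ₁).sub (hcont hΦ₂), fun y hy => ?_⟩⟩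
  · rw [Real.rpow_zero, mul_one, abs_of_pos (Real.exp_pos _)]
    refine le_trans (Real.exp_le_exp.2 ?_)
      (le_mul_of_one_le_right (Real.exp_pos C).le (by linarith))
    exact neg_le.2 (abs_le.1 (hΦ₁.abs_apply_le hy)).1
  · rw [Real.rpow_zero, mul_one, mul_assoc]
    refine (abs_exp_neg_sub_exp_neg_le (hΦ₁.abs_apply_le hy) (hΦ₂.abs_apply_le hy)).trans
      (mul_le_mul_of_nonneg_left ((hΦd.abs_apply_le hy).trans ?_) (Real.exp_pos C).le)
    nlinarith

end LipschitzPowerBounded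

/-! ### The reduced equation for a swirling profile -/

/-- With `U_θ = (1 - x) (m + w y)` and `y = 1 + x`, the swirl equation says that `U_φ'` is a
constant multiple of this function. -/
def swirlSlope (m : ℝ) (w : ℝ → ℝ) (y : ℝ) : ℝ :=
  y ^ (-m) * Real.exp (-primitive (fun s => w s / s) y)

/-- The mean of `swirlSlope m w` over the segment from `y` to `2`, that is, `U_φ / (1 - x)` up to a
constant factor when `U_φ` vanishes at the north pole. -/
def swirlMean (m : ℝ) (w : ℝ → ℝ) : ℝ → ℝ := segmentAvg (fun _ => 1) (swirlSlope m w)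

/-- The source `U_φ U_φ' / (1 - x ^ 2)` of the meridian equation, up to a constant factor. -/
def swirlSource (m : ℝ) (w : ℝ → ℝ) (y : ℝ) : ℝ :=
  swirlMean m w y * swirlSlope m w y / y

/-- Taylor's formula at the north pole for the meridian equation: if `κ' = swirlKernel m w`, then
the third derivative of `(2 - y) ^ 2 * κ y` is `swirlSource m w`. -/
def swirlKernel (m : ℝ) (w : ℝ → ℝ) : ℝ → ℝ :=
  segmentAvg (fun σ => σ * (1 - σ)) (swirlSource m w)

/-- The inhomogeneity `φ` in the equation `y w' = (1 - m) w + φ`, which is the Riccati equation of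
`U_θ = (1 - x) (m + w y)` integrated three times. The parameter `e` measures the swirl. -/
def reducedSource (m e : ℝ) (w : ℝ → ℝ) (y : ℝ) : ℝ :=
  e * primitive (swirlKernel m w) y - w y ^ 2 / 2

/-- Solutions of the reduced equation that vanish at the south pole like `y ^ α`. -/
structure IsReducedSolution (m e α : ℝ) (w : ℝ → ℝ) : Prop where
  exponent_pos : 0 < α
  powerBounded : PowerBounded α 1 w
  powerBounded_swirlKernel : ∃ C, PowerBounded (α - 1) C (swirlKernel m w)
  hasDerivAt : ∀ y ∈ Ioo (0 : ℝ) 3, HasDerivAt w (((1 - m) * w y + reducedSource m e w y) / y) y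

/-- Exponents for which the chain `swirlSlope = O(y ^ -(a + b))`, `swirlMean = O(y ^ -a)`,
`swirlKernel = O(y ^ (α - 1))` follows from the bounds for averages. -/
structure AdmissibleExponents (m a b α : ℝ) : Prop where
  le_add : m ≤ a + b
  a_nonneg : 0 ≤ a
  b_nonneg : 0 ≤ b
  b_lt : b < 1
  α_pos : 0 < α
  α_le : α ≤ 1
  le_source : 0 ≤ a + (a + b) - (1 - α)
  source_lt : a + (a + b) - (1 - α) < 1

lemma exists_lipschitzPowerBounded_swirlSlope {m M α : ℝ} (hα : 0 < α) (hM : m ≤ M) :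
    ∃ C, LipschitzPowerBounded α (-M) C (swirlSlope m) := by
  have hexp := (((LipschitzPowerBounded.id (α := α)).div_id.integral hα).weaken hα.le).exp_neg
  have hmul := (LipschitzPowerBounded.of_fixed (α := α) (PowerBounded.rpow (-m))).mul hexp
  rw [add_zero] at hmul
  exact ⟨_, hmul.weaken (neg_le_neg hM)⟩

lemma AdmissibleExponents.exists_lipschitzPowerBounded_swirlKernel {m a b α : ℝ}
    (h : AdmissibleExponents m a b α) :
    ∃ C, LipschitzPowerBounded α (α - 1) C (swirlKernel m) := by
  obtain ⟨C, hslope⟩ := exists_lipschitzPowerBounded_swirlSlope h.α_pos h.le_add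
  have hmean : LipschitzPowerBounded α (-a) _ (swirlMean m) :=
    LipschitzPowerBounded.average (c := 0) continuous_const h.a_nonneg h.b_nonneg h.b_lt le_rfl
      (by simp) (by rwa [add_zero])
  have hsource : LipschitzPowerBounded α _ _ (swirlSource m) := (hmean.mul hslope).div_id
  rw [show -a + -(a + b) - 1 = -((1 - α) + (a + (a + b) - (1 - α)) + 1) by ring] at hsource
  have hkernel : LipschitzPowerBounded α (-(1 - α)) _ (swirlKernel m) :=
    hsource.average (by fun_prop) (by linarith [h.α_le]) h.le_source h.source_lt zero_le_one
      fun σ hσ => by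
        rw [Real.rpow_one, abs_of_nonneg (mul_nonneg hσ.1.le (by linarith [hσ.2]))]
        exact mul_le_of_le_one_right hσ.1.le (by linarith [hσ.1])
  rw [neg_sub] at hkernel
  exact ⟨_, hkernel⟩

lemma exists_admissibleExponents {m : ℝ} (hm : m < 3 / 2) :
    ∃ a b α, AdmissibleExponents m a b α ∧ ∃ c S, IsSolutionOperator (1 - m) α c S := by
  rcases le_or_gt 1 m with h | h
  · refine ⟨m - 1 + (3 / 2 - m) / 2, 1 - (3 / 2 - m) / 2, 3 / 2 - m, ?_, _, _,
      isSolutionOperator_of_lt (by linarith)⟩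
    constructor <;> linarith
  · refine ⟨1 / 4, 3 / 4, min (1 / 2) ((1 - m) / 2), ?_, _, _, isSolutionOperator_of_gt ?_⟩
    · have hle := min_le_left (1 / 2) ((1 - m) / 2)
      have hpos : 0 < min (1 / 2) ((1 - m) / 2) := lt_min (by norm_num) (by linarith)
      constructor <;> linarith
    · exact lt_of_le_of_lt (min_le_right _ _) (by linarith)

section ReducedSource

variable {m e α δ C : ℝ}

lemma PowerBounded.reducedSource {w : ℝ → ℝ}
    (hκ : LipschitzPowerBounded α α C fun w => primitive (swirlKernel m w)) (hα : 0 ≤ α)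
    (he : 0 ≤ e) (hδ : δ ≤ 1) (hw : PowerBounded α δ w) :
    PowerBounded α (e * C + δ ^ 2 * 3 ^ α / 2) (AxisymNS.reducedSource m e w) := by
  have hsq := ((hw.mul hw).weaken (show α ≤ α + α by linarith)).const_mul (1 / 2)
  refine ((((hκ.apply (hw.mono hδ)).const_mul e).sub hsq).congr fun y _ => ?_).mono (le_of_eq ?_)
  · simp only [AxisymNS.reducedSource]
    ring
  · rw [abs_of_nonneg he, abs_of_pos one_half_pos, add_sub_cancel_right]
    ring

lemma PowerBounded.reducedSource_sub {w₁ w₂ : ℝ → ℝ} {d : ℝ}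
    (hκ : LipschitzPowerBounded α α C fun w => primitive (swirlKernel m w)) (hα : 0 ≤ α)
    (he : 0 ≤ e) (hδ : δ ≤ 1) (h₁ : PowerBounded α δ w₁) (h₂ : PowerBounded α δ w₂)
    (hd : PowerBounded α d (fun y => w₁ y - w₂ y)) :
    PowerBounded α (e * (C * d) + d * δ * 3 ^ α)
      (fun y => AxisymNS.reducedSource m e w₁ y - AxisymNS.reducedSource m e w₂ y) := by
  have hprim := (hκ w₁ w₂ d (h₁.mono hδ) (h₂.mono hδ) hd).2
  have hsq := ((hd.mul (h₁.add h₂)).weaken (show α ≤ α + α by linarith)).const_mul (1 / 2)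
  refine (((hprim.const_mul e).sub hsq).congr fun y _ => ?_).mono (le_of_eq ?_)
  · simp only [AxisymNS.reducedSource]
    ring
  · rw [abs_of_nonneg he, abs_of_pos one_half_pos, add_sub_cancel_right]
    ring

end ReducedSource

lemma exists_contraction_parameters {c C K : ℝ} (hc : 0 ≤ c) (hC : 0 ≤ C) (hK : 0 < K) :
    ∃ δ e : ℝ, 0 < δ ∧ δ ≤ 1 ∧ 0 < e ∧ c * δ * K ≤ 1 / 4 ∧ c * (e * C) ≤ δ / 4 := by
  obtain ⟨δ, hδ0, hδ1, hδ⟩ : ∃ δ : ℝ, 0 < δ ∧ δ ≤ 1 ∧ c * δ * K ≤ 1 / 4 := by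
    refine ⟨min 1 (1 / (4 * (c + 1) * K)), lt_min one_pos (by positivity), min_le_left _ _, ?_⟩
    calc c * min 1 (1 / (4 * (c + 1) * K)) * K ≤ (c + 1) * (1 / (4 * (c + 1) * K)) * K := by
          gcongr
          · linarith
          · exact min_le_right _ _
      _ = 1 / 4 := by field_simp
  refine ⟨δ, δ / (4 * (c + 1) * (C + 1)), hδ0, hδ1, by positivity, hδ, ?_⟩
  calc c * (δ / (4 * (c + 1) * (C + 1)) * C) ≤
        (c + 1) * (δ / (4 * (c + 1) * (C + 1)) * (C + 1)) := by
        gcongr <;> linarith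
    _ = δ / 4 := by field_simp

lemma exists_isReducedSolution {m : ℝ} (hm : m < 3 / 2) :
    ∃ α e : ℝ, ∃ w : ℝ → ℝ, 0 < e ∧ IsReducedSolution m e α w := by
  obtain ⟨a, b, α, hE, c, S, hS⟩ := exists_admissibleExponents hm
  obtain ⟨C₀, hkernel⟩ := hE.exists_lipschitzPowerBounded_swirlKernel
  have hα := hE.α_pos
  have hκ := hkernel.integral hα
  set C := C₀ / α
  have hc := hS.nonneg
  have h3 : (0 : ℝ) < 3 ^ α := by positivity
  obtain ⟨δ, e, hδ0, hδ1, he0, hδ, he⟩ := exists_contraction_parameters hc hκ.nonneg h3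
  have hsource : ∀ w, PowerBounded α δ w →
      PowerBounded α (e * C + δ ^ 2 * 3 ^ α / 2) (reducedSource m e w) := fun w hw =>
    hw.reducedSource hκ hα.le he0.le hδ1
  obtain ⟨w, hw, hfix⟩ := exists_fixedPoint_of_contracting (α := α) hδ0.le
    (fun w => S (reducedSource m e w))
    (fun w hw => (hS.bound (hsource w hw)).mono (by nlinarith [mul_nonneg hc h3.le]))
    (fun w₁ w₂ d h₁ h₂ hd => by
      refine ((hS.bound (h₁.reducedSource_sub hκ hα.le he0.le hδ1 h₂ hd)).mono ?_).congr
        fun y hy => hS.sub (hsource _ h₁) (hsource _ h₂) y hy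
      have hlin : c * (e * C) * d ≤ 1 / 4 * d :=
        mul_le_mul_of_nonneg_right (by linarith) hd.nonneg
      have hquad : c * δ * 3 ^ α * d ≤ 1 / 4 * d := mul_le_mul_of_nonneg_right hδ hd.nonneg
      linarith)
  have hw1 := hw.mono hδ1
  refine ⟨α, e, w, he0, hα, hw1, ⟨C₀, hkernel.apply hw1⟩, fun y hy => ?_⟩
  refine ((hS.hasDerivAt (hsource w hw) y hy).congr_of_eventuallyEq
    (hfix.eventuallyEq_of_mem (isOpen_Ioo.mem_nhds hy))).congr_deriv ?_
  rw [← hfix hy]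

/-! ### Regularity of reduced solutions -/

lemma PowerBounded.contDiffOn_primitive {a C : ℝ} {φ : ℝ → ℝ} (h : PowerBounded (a - 1) C φ)
    (ha : 0 < a) {n : ℕ} (hφ : ContDiffOn ℝ n φ (Ioo 0 3)) :
    ContDiffOn ℝ n (primitive φ) (Ioo 0 3) := by
  have hsucc : ContDiffOn ℝ (n + 1) (primitive φ) (Ioo 0 3) := by
    rw [contDiffOn_succ_iff_deriv_of_isOpen isOpen_Ioo]
    exact ⟨fun y hy => (h.hasDerivAt_primitive ha hy).differentiableAt.differentiableWithinAt,
      by simp, hφ.congr fun y hy => (h.hasDerivAt_primitive ha hy).deriv⟩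
  exact hsucc.of_le (by norm_cast; omega)

section Smoothness

variable {m α : ℝ} {w : ℝ → ℝ} {n : ℕ}

lemma contDiffOn_swirlSlope (hα : 0 < α) (hw : PowerBounded α 1 w)
    (h : ContDiffOn ℝ n w (Ioo 0 3)) : ContDiffOn ℝ n (swirlSlope m w) (Ioo 0 3) := by
  have hprim := hw.div_id.contDiffOn_primitive hα
    (h.div contDiffOn_id fun y hy => hy.1.ne' : ContDiffOn ℝ n (fun s => w s / s) (Ioo 0 3))
  exact ContDiffOn.mul (fun y hy => (Real.contDiffAt_rpow_const_of_ne hy.1.ne').contDiffWithinAt)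
    (Real.contDiff_exp.comp_contDiffOn hprim.neg)

lemma contDiffOn_swirlMean (hα : 0 < α) (hw : PowerBounded α 1 w)
    (h : ContDiffOn ℝ n w (Ioo 0 3)) : ContDiffOn ℝ n (swirlMean m w) (Ioo 0 3) :=
  contDiffOn_segmentAvg n continuous_const (contDiffOn_swirlSlope hα hw h)

lemma contDiffOn_swirlSource (hα : 0 < α) (hw : PowerBounded α 1 w)
    (h : ContDiffOn ℝ n w (Ioo 0 3)) : ContDiffOn ℝ n (swirlSource m w) (Ioo 0 3) :=
  ((contDiffOn_swirlMean hα hw h).mul (contDiffOn_swirlSlope hα hw h)).div contDiffOn_id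
    fun _ hy => hy.1.ne'

lemma contDiffOn_swirlKernel (hα : 0 < α) (hw : PowerBounded α 1 w)
    (h : ContDiffOn ℝ n w (Ioo 0 3)) : ContDiffOn ℝ n (swirlKernel m w) (Ioo 0 3) :=
  contDiffOn_segmentAvg n (by fun_prop) (contDiffOn_swirlSource hα hw h)

end Smoothness

/-! ### Swirling profiles -/

section NorthPole

variable {φ : ℝ → ℝ} {y : ℝ}

lemma hasDerivAt_integral_to_two (hφ : ContinuousOn φ (Ioo 0 3)) (hy : y ∈ Ioo (0 : ℝ) 3) :
    HasDerivAt (fun y => ∫ s in y..2, φ s) (-φ y) y :=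
  intervalIntegral.integral_hasDerivAt_left (intervalIntegrable_from_two hφ hy).symm
    (hφ.stronglyMeasurableAtFilter isOpen_Ioo y hy) (hφ.continuousAt (isOpen_Ioo.mem_nhds hy))

lemma two_sub_mul_segmentAvg_one (φ : ℝ → ℝ) (y : ℝ) :
    (2 - y) * segmentAvg (fun _ => 1) φ y = ∫ s in y..2, φ s := by
  have hsubst := intervalIntegral.mul_integral_comp_mul_add (f := φ) (a := 0) (b := 1) (2 - y) y
  simp only [mul_zero, zero_add, mul_one, sub_add_cancel] at hsubst
  rw [← hsubst, segmentAvg]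
  congr 2
  ext σ
  rw [one_mul, add_comm, mul_comm σ]

lemma two_sub_pow_three_mul_segmentAvg (hφ : ContinuousOn φ (Ioo 0 3)) (hy : y ∈ Ioo (0 : ℝ) 3) :
    (2 - y) ^ 3 * segmentAvg (fun σ => σ * (1 - σ)) φ y =
      (∫ s in y..2, s * ((2 - s) * φ s)) - y * ∫ s in y..2, (2 - s) * φ s := by
  have hsubst := intervalIntegral.mul_integral_comp_mul_add
    (f := fun s => (s - y) * ((2 - s) * φ s)) (a := 0) (b := 1) (2 - y) y
  simp only [mul_zero, zero_add, mul_one, sub_add_cancel] at hsubst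
  have hfst : ContinuousOn (fun s => (2 - s) * φ s) (Ioo 0 3) := by fun_prop
  have hsnd : ContinuousOn (fun s => s * ((2 - s) * φ s)) (Ioo 0 3) := by fun_prop
  rw [← intervalIntegral.integral_const_mul, ← intervalIntegral.integral_sub
    (intervalIntegrable_from_two hsnd hy).symm
    ((intervalIntegrable_from_two hfst hy).symm.const_mul y)]
  simp only [← sub_mul]
  rw [← hsubst, segmentAvg, ← intervalIntegral.integral_const_mul,
    ← intervalIntegral.integral_const_mul]
  congr 1
  ext σ
  rw [show y + σ * (2 - y) = (2 - y) * σ + y by ring]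
  ring

lemma hasDerivAt_two_sub_pow_three_mul_segmentAvg (hφ : ContinuousOn φ (Ioo 0 3))
    (hy : y ∈ Ioo (0 : ℝ) 3) :
    HasDerivAt (fun y => (2 - y) ^ 3 * segmentAvg (fun σ => σ * (1 - σ)) φ y)
      (-∫ s in y..2, (2 - s) * φ s) y := by
  have hfst := hasDerivAt_integral_to_two (φ := fun s => (2 - s) * φ s) (by fun_prop) hy
  have hsnd := hasDerivAt_integral_to_two (φ := fun s => s * ((2 - s) * φ s)) (by fun_prop) hy
  have hEq : EqOn (fun y => (2 - y) ^ 3 * segmentAvg (fun σ => σ * (1 - σ)) φ y)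
      (fun y => (∫ s in y..2, s * ((2 - s) * φ s)) - y * ∫ s in y..2, (2 - s) * φ s) (Ioo 0 3) :=
    fun _ hz => two_sub_pow_three_mul_segmentAvg hφ hz
  refine ((hsnd.fun_sub ((hasDerivAt_id' y).fun_mul hfst)).congr_of_eventuallyEq
    (hEq.eventuallyEq_of_mem (isOpen_Ioo.mem_nhds hy))).congr_deriv ?_
  ring

lemma eqOn_third_deriv_of_hasDerivAt {F κ W I r : ℝ → ℝ} {e c : ℝ}
    (hF : EqOn F (fun x => (1 - x) ^ 2 * (e * κ x + c)) (Ioo (-1) 1))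
    (hκ : ∀ x ∈ Ioo (-1 : ℝ) 1, HasDerivAt κ (W x / (1 - x) ^ 3) x)
    (hW : ∀ x ∈ Ioo (-1 : ℝ) 1, HasDerivAt W (-I x) x)
    (hI : ∀ x ∈ Ioo (-1 : ℝ) 1, HasDerivAt I (-((1 - x) * r x)) x) :
    EqOn (deriv (deriv (deriv F))) (fun x => e * r x) (Ioo (-1) 1) := by
  have hsub : ∀ x : ℝ, HasDerivAt (fun x : ℝ => 1 - x) (-1) x := fun x =>
    (hasDerivAt_id' x).const_sub 1
  have hne : ∀ x ∈ Ioo (-1 : ℝ) 1, 1 - x ≠ 0 := fun x hx => by linarith [hx.2]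
  have hfst : EqOn (deriv F) (fun x => -2 * (1 - x) * (e * κ x + c) + e * W x / (1 - x))
      (Ioo (-1) 1) := by
    refine eqOn_deriv_of_hasDerivAt isOpen_Ioo hF fun x hx => ?_
    have := hne x hx
    refine (((hsub x).fun_pow 2).fun_mul (((hκ x hx).const_mul e).add_const _)).congr_deriv ?_
    field_simp
    ring
  have hsnd : EqOn (deriv (deriv F))
      (fun x => 2 * (e * κ x + c) - e * W x / (1 - x) ^ 2 - e * I x / (1 - x)) (Ioo (-1) 1) := by
    refine eqOn_deriv_of_hasDerivAt isOpen_Ioo hfst fun x hx => ?_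
    have hx1 := hne x hx
    refine ((((hsub x).const_mul (-2)).fun_mul (((hκ x hx).const_mul e).add_const _)).fun_add
      (((hW x hx).const_mul e).fun_div (hsub x) hx1)).congr_deriv ?_
    field_simp
    ring
  refine eqOn_deriv_of_hasDerivAt isOpen_Ioo hsnd fun x hx => ?_
  have hx1 := hne x hx
  refine (((((hκ x hx).const_mul e).add_const _).const_mul 2 |>.fun_sub
    (((hW x hx).const_mul e).fun_div ((hsub x).fun_pow 2) (pow_ne_zero 2 hx1))).fun_sub
    (((hI x hx).const_mul e).fun_div (hsub x) hx1)).congr_deriv ?_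
  field_simp
  ring

end NorthPole

lemma one_add_mem_Ioo {x : ℝ} (hx : x ∈ Ioo (-1 : ℝ) 1) : 1 + x ∈ Ioo (0 : ℝ) 3 :=
  ⟨by linarith [hx.1], by linarith [hx.2]⟩

lemma contDiffOn_comp_one_add {φ : ℝ → ℝ} {n : WithTop ℕ∞} (hφ : ContDiffOn ℝ n φ (Ioo 0 3)) :
    ContDiffOn ℝ n (fun x => φ (1 + x)) (Ioo (-1) 2) :=
  hφ.comp (by fun_prop) fun _ hx => ⟨by linarith [hx.1], by linarith [hx.2]⟩

lemma eqOn_third_deriv_sq_mul {F κ φ : ℝ → ℝ} {e c : ℝ} (hφ : ContinuousOn φ (Ioo 0 3))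
    (hκ : ∀ y ∈ Ioo (0 : ℝ) 3, HasDerivAt κ (segmentAvg (fun σ => σ * (1 - σ)) φ y) y)
    (hF : EqOn F (fun x => (1 - x) ^ 2 * (e * κ (1 + x) + c)) (Ioo (-1) 1)) :
    EqOn (deriv (deriv (deriv F))) (fun x => e * φ (1 + x)) (Ioo (-1) 1) := by
  refine eqOn_third_deriv_of_hasDerivAt hF
    (W := fun x => (2 - (1 + x)) ^ 3 * segmentAvg (fun σ => σ * (1 - σ)) φ (1 + x))
    (I := fun x => ∫ s in (1 + x)..2, (2 - s) * φ s) (fun x hx => ?_)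
    (fun x hx => (hasDerivAt_two_sub_pow_three_mul_segmentAvg hφ
      (one_add_mem_Ioo hx)).comp_const_add 1 x) fun x hx => ?_
  · have hx1 : 1 - x ≠ 0 := by linarith [hx.2]
    refine ((hκ _ (one_add_mem_Ioo hx)).comp_const_add 1 x).congr_deriv ?_
    rw [show 2 - (1 + x) = 1 - x by ring, mul_div_cancel_left₀ _ (pow_ne_zero 3 hx1)]
  · refine ((hasDerivAt_integral_to_two (φ := fun s => (2 - s) * φ s) (by fun_prop)
      (one_add_mem_Ioo hx)).comp_const_add 1 x).congr_deriv ?_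
    ring

namespace IsReducedSolution

variable {m e α : ℝ} {w : ℝ → ℝ}

lemma contDiffOn_nat (h : IsReducedSolution m e α w) (n : ℕ) : ContDiffOn ℝ n w (Ioo 0 3) := by
  obtain ⟨C, hkernel⟩ := h.powerBounded_swirlKernel
  induction n with
  | zero => exact contDiffOn_zero.2 h.powerBounded.cont
  | succ n ih =>
    push_cast
    rw [contDiffOn_succ_iff_deriv_of_isOpen isOpen_Ioo]
    refine ⟨fun y hy => (h.hasDerivAt y hy).differentiableAt.differentiableWithinAt, by simp, ?_⟩
    have hprim := hkernel.contDiffOn_primitive h.exponent_pos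
      (contDiffOn_swirlKernel h.exponent_pos h.powerBounded ih)
    exact ContDiffOn.congr (((contDiffOn_const.mul ih).add ((contDiffOn_const.mul hprim).sub
      ((ih.pow 2).div_const 2))).div contDiffOn_id fun y hy => hy.1.ne')
      fun y hy => (h.hasDerivAt y hy).deriv

lemma contDiffOn (h : IsReducedSolution m e α w) : ContDiffOn ℝ ∞ w (Ioo 0 3) :=
  contDiffOn_infty.2 h.contDiffOn_nat

lemma continuousOn_swirlSlope (h : IsReducedSolution m e α w) :
    ContinuousOn (swirlSlope m w) (Ioo 0 3) :=
  (contDiffOn_swirlSlope h.exponent_pos h.powerBounded (h.contDiffOn_nat 0)).continuousOn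

lemma contDiffOn_swirlMean (h : IsReducedSolution m e α w) :
    ContDiffOn ℝ ∞ (swirlMean m w) (Ioo 0 3) :=
  contDiffOn_infty.2 fun n =>
    AxisymNS.contDiffOn_swirlMean h.exponent_pos h.powerBounded (h.contDiffOn_nat n)

lemma hasDerivAt_swirlSlope (h : IsReducedSolution m e α w) {y : ℝ} (hy : y ∈ Ioo (0 : ℝ) 3) :
    HasDerivAt (swirlSlope m w) (-((m + w y) * swirlSlope m w y / y)) y := by
  refine ((Real.hasDerivAt_rpow_const (p := -m) (Or.inl hy.1.ne')).fun_mul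
    (h.powerBounded.div_id.hasDerivAt_primitive h.exponent_pos hy).fun_neg.exp).congr_deriv ?_
  have := hy.1
  rw [Real.rpow_sub_one hy.1.ne', swirlSlope]
  field_simp
  ring

lemma swirlMean_pos (h : IsReducedSolution m e α w) {y : ℝ} (hy : y ∈ Ioo (0 : ℝ) 3) :
    0 < swirlMean m w y := by
  refine intervalIntegral.intervalIntegral_pos_of_pos_on (intervalIntegrable_segmentAvg_integrand
    continuous_const h.continuousOn_swirlSlope hy) (fun σ hσ => ?_) zero_lt_one
  have hpos := (add_mul_two_sub_mem ordConnected_Ioo two_mem_Ioo_zero_three hy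
    (Ioo_subset_Icc_self hσ)).1
  rw [one_mul, swirlSlope]
  exact mul_pos (Real.rpow_pos_of_pos hpos _) (Real.exp_pos _)

lemma tendsto_south (h : IsReducedSolution m e α w) :
    Tendsto (fun x => m + w (1 + x)) (𝓝[>] (-1)) (𝓝 m) := by
  have hpow : Tendsto (fun y : ℝ => 1 * y ^ α) (𝓝[>] 0) (𝓝 0) := by
    have := (Real.continuousAt_rpow_const 0 α (Or.inr h.exponent_pos.le)).tendsto
    rw [Real.zero_rpow h.exponent_pos.ne'] at this
    simpa using this.mono_left nhdsWithin_le_nhds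
  have hw : Tendsto w (𝓝[>] 0) (𝓝 0) := by
    refine squeeze_zero_norm' ?_ hpow
    filter_upwards [Ioo_mem_nhdsGT three_pos] with y hy using h.powerBounded.bound y hy
  have hshift : Tendsto (fun x : ℝ => 1 + x) (𝓝[>] (-1)) (𝓝[>] 0) := by
    refine tendsto_nhdsWithin_iff.2 ⟨?_, ?_⟩
    · have : Continuous fun x : ℝ => 1 + x := by fun_prop
      simpa using (this.tendsto (-1)).mono_left nhdsWithin_le_nhds
    · filter_upwards [self_mem_nhdsWithin] with x hx
      exact neg_lt_iff_pos_add'.1 (mem_Ioi.1 hx)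
  simpa using (hw.comp hshift).const_add m

lemma eqOn_deriv_swirl (h : IsReducedSolution m e α w) (ε : ℝ) :
    EqOn (deriv fun x => (1 - x) * (-ε * swirlMean m w (1 + x)))
      (fun x => ε * swirlSlope m w (1 + x)) (Ioo (-1) 1) := by
  refine eqOn_deriv_of_hasDerivAt isOpen_Ioo
    (ψ := fun x => -ε * ∫ s in (1 + x)..2, swirlSlope m w s) (fun x _ => ?_) fun x hx => ?_
  · simp only [← two_sub_mul_segmentAvg_one, swirlMean]
    ring
  · refine ((hasDerivAt_integral_to_two h.continuousOn_swirlSlope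
      (one_add_mem_Ioo hx)).comp_const_add 1 x |>.const_mul (-ε)).congr_deriv ?_
    ring

lemma eqOn_second_deriv_swirl (h : IsReducedSolution m e α w) (ε : ℝ) :
    EqOn (deriv (deriv fun x => (1 - x) * (-ε * swirlMean m w (1 + x))))
      (fun x => ε * -((m + w (1 + x)) * swirlSlope m w (1 + x) / (1 + x))) (Ioo (-1) 1) :=
  eqOn_deriv_of_hasDerivAt isOpen_Ioo (h.eqOn_deriv_swirl ε) fun x hx =>
    ((h.hasDerivAt_swirlSlope (one_add_mem_Ioo hx)).comp_const_add 1 x).const_mul ε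

lemma eqOn_riccatiForm (h : IsReducedSolution m e α w) :
    EqOn (riccatiForm fun x => (1 - x) * (m + w (1 + x)))
      (fun x => (1 - x) ^ 2 * (e * primitive (swirlKernel m w) (1 + x) + (m ^ 2 / 2 - m)))
      (Ioo (-1) 1) := by
  intro x hx
  have hx1 : 1 + x ≠ 0 := (one_add_mem_Ioo hx).1.ne'
  have hderiv := (((hasDerivAt_id' x).const_sub 1).fun_mul
    (((h.hasDerivAt _ (one_add_mem_Ioo hx)).comp_const_add 1 x).const_add m)).deriv
  simp only [riccatiForm, hderiv, reducedSource]
  field_simp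
  ring

lemma eqOn_third_deriv_riccatiForm (h : IsReducedSolution m e α w) :
    EqOn (deriv (deriv (deriv (riccatiForm fun x => (1 - x) * (m + w (1 + x))))))
      (fun x => e * swirlSource m w (1 + x)) (Ioo (-1) 1) := by
  obtain ⟨C, hkernel⟩ := h.powerBounded_swirlKernel
  exact eqOn_third_deriv_sq_mul
    (contDiffOn_swirlSource h.exponent_pos h.powerBounded (h.contDiffOn_nat 0)).continuousOn
    (fun _ hy => hkernel.hasDerivAt_primitive h.exponent_pos hy) h.eqOn_riccatiForm

lemma contDiffOn_theta (h : IsReducedSolution m e α w) :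
    ContDiffOn ℝ ∞ (fun x => m + w (1 + x)) (Ioo (-1) 2) :=
  contDiffOn_const.add (contDiffOn_comp_one_add h.contDiffOn)

lemma contDiffOn_phi (h : IsReducedSolution m e α w) (ε : ℝ) :
    ContDiffOn ℝ ∞ (fun x => -ε * swirlMean m w (1 + x)) (Ioo (-1) 2) :=
  contDiffOn_const.mul (contDiffOn_comp_one_add h.contDiffOn_swirlMean)

lemma profileEquations (h : IsReducedSolution m e α w) {ε : ℝ} (he : e = 2 * ε ^ 2) :
    ProfileEquations (fun x => (1 - x) * (m + w (1 + x)))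
      (fun x => (1 - x) * (-ε * swirlMean m w (1 + x))) where
  smooth_f := ContDiffOn.mul (by fun_prop)
    (h.contDiffOn_theta.mono (Ioo_subset_Ioo_right one_le_two))
  smooth_g := ContDiffOn.mul (by fun_prop)
    ((h.contDiffOn_phi ε).mono (Ioo_subset_Ioo_right one_le_two))
  swirl x hx := by
    have hx1 : 1 + x ≠ 0 := (one_add_mem_Ioo hx).1.ne'
    rw [h.eqOn_second_deriv_swirl ε hx, h.eqOn_deriv_swirl ε hx]
    field_simp
    ring
  meridian x hx := by
    have hx1 : 1 + x ≠ 0 := (one_add_mem_Ioo hx).1.ne'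
    have hx2 : 1 - x ≠ 0 := by linarith [hx.2]
    rw [h.eqOn_third_deriv_riccatiForm hx, h.eqOn_deriv_swirl ε hx,
      show (1 : ℝ) - x ^ 2 = (1 - x) * (1 + x) by ring]
    simp only [swirlSource, he]
    field_simp
    ring

end IsReducedSolution

lemma exists_swirling_profile {m : ℝ} (hm : m < 3 / 2) : ∃ ψ γ : ℝ → ℝ,
    ContDiffOn ℝ ∞ ψ (Ioo (-1) 2) ∧ ContDiffOn ℝ ∞ γ (Ioo (-1) 2) ∧
    ProfileEquations (fun x => (1 - x) * ψ x) (fun x => (1 - x) * γ x) ∧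
    Tendsto ψ (𝓝[>] (-1)) (𝓝 m) ∧ γ 0 ≠ 0 := by
  obtain ⟨α, e, w, he, h⟩ := exists_isReducedSolution hm
  have hsq : √(e / 2) ^ 2 = e / 2 := Real.sq_sqrt (by positivity)
  have hne : √(e / 2) ≠ 0 := (Real.sqrt_pos.2 (by positivity)).ne'
  exact ⟨_, _, h.contDiffOn_theta, h.contDiffOn_phi (√(e / 2)),
    h.profileEquations (by linarith), h.tendsto_south,
    mul_ne_zero (neg_ne_zero.2 hne) (h.swirlMean_pos (by norm_num)).ne'⟩

/-! ### Solutions from profiles -/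

lemma cosPolar_mem_Ioc {y : R3} (hy : y ∈ slitSpace) : cosPolar y ∈ Ioc (-1 : ℝ) 1 := by
  by_cases hoff : y ∈ offAxis
  · exact Ioo_subset_Ioc_self (cosPolar_mem_Ioo hoff)
  have haxis : y 0 ^ 2 + y 1 ^ 2 ≤ 0 := not_lt.1 hoff
  have h0 : y 0 = 0 := pow_eq_zero_iff two_ne_zero |>.1 (by nlinarith)
  have h1 : y 1 = 0 := pow_eq_zero_iff two_ne_zero |>.1 (by nlinarith)
  have h2 : 0 < y 2 := not_le.1 fun h => hy ⟨h0, h1, h⟩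
  have hnorm : ‖y‖ = y 2 := (sq_eq_sq₀ (norm_nonneg y) h2.le).1 (by
    rw [norm_sq_eq, h0, h1]
    ring)
  rw [cosPolar, hnorm, div_self h2.ne']
  norm_num

lemma hom_smul (k : ℕ) (η : ℝ → ℝ) (y : R3) {c : ℝ} (hc : 0 < c) :
    hom k η (c • y) = (c ^ k)⁻¹ * hom k η y := by
  have hcos : cosPolar (c • y) = cosPolar y := by
    simp only [cosPolar, norm_smul, Real.norm_of_nonneg hc.le, PiLp.smul_apply, smul_eq_mul]
    exact mul_div_mul_left _ _ hc.ne'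
  rw [hom, hom, hcos, norm_smul, Real.norm_of_nonneg hc.le, mul_pow, mul_inv, mul_assoc]

lemma hom_eR (k : ℕ) (η : ℝ → ℝ) (θ φ : ℝ) : hom k η (eR θ φ) = η (Real.cos θ) := by
  have hcos : cosPolar (eR θ φ) = Real.cos θ := by
    rw [cosPolar, norm_eR, div_one]
    rfl
  rw [hom, norm_eR, hcos, one_pow, inv_one, one_mul]

lemma hom_meridian (k : ℕ) (η : ℝ → ℝ) {x : ℝ} (hx : x ∈ Ioo (-1 : ℝ) 1) :
    hom k η (meridian x) = η x := by
  rw [hom, norm_meridian hx, cosPolar_meridian hx, one_pow, inv_one, one_mul]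

section Frame

variable (a b c θ φ : ℝ)

lemma inner_frame_eR :
    inner ℝ (a • eR θ φ + b • eTheta θ φ + c • ePhi φ) (eR θ φ) = a := by
  have hθ := Real.sin_sq_add_cos_sq θ
  have hφ := Real.sin_sq_add_cos_sq φ
  simp only [eR, eTheta, ePhi, PiLp.inner_apply, PiLp.add_apply, PiLp.smul_apply, smul_eq_mul,
    RCLike.inner_apply, Real.ringHom_apply, Fin.sum_univ_three, Matrix.cons_val_zero,
    Matrix.cons_val_one, Matrix.cons_val]
  grind

lemma inner_frame_eTheta :
    inner ℝ (a • eR θ φ + b • eTheta θ φ + c • ePhi φ) (eTheta θ φ) = b := by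
  have hθ := Real.sin_sq_add_cos_sq θ
  have hφ := Real.sin_sq_add_cos_sq φ
  simp only [eR, eTheta, ePhi, PiLp.inner_apply, PiLp.add_apply, PiLp.smul_apply, smul_eq_mul,
    RCLike.inner_apply, Real.ringHom_apply, Fin.sum_univ_three, Matrix.cons_val_zero,
    Matrix.cons_val_one, Matrix.cons_val]
  grind

lemma inner_frame_ePhi :
    inner ℝ (a • eR θ φ + b • eTheta θ φ + c • ePhi φ) (ePhi φ) = c := by
  have hφ := Real.sin_sq_add_cos_sq φ
  simp only [eR, eTheta, ePhi, PiLp.inner_apply, PiLp.add_apply, PiLp.smul_apply, smul_eq_mul,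
    RCLike.inner_apply, Real.ringHom_apply, Fin.sum_univ_three, Matrix.cons_val_zero,
    Matrix.cons_val_one, Matrix.cons_val]
  grind

end Frame

section AxiField

variable (α β ζ : ℝ → ℝ)

lemma axiField_smul (y : R3) {c : ℝ} (hc : 0 < c) :
    axiField α β ζ (c • y) = c⁻¹ • axiField α β ζ y := by
  have hc0 := hc.ne'
  ext i
  fin_cases i
  · change axiField α β ζ (c • y) 0 = c⁻¹ * axiField α β ζ y 0
    simp only [axiField_zero, hom_smul _ _ _ hc, PiLp.smul_apply, smul_eq_mul]
    field_simp
  · change axiField α β ζ (c • y) 1 = c⁻¹ * axiField α β ζ y 1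
    simp only [axiField_one, hom_smul _ _ _ hc, PiLp.smul_apply, smul_eq_mul]
    field_simp
  · change axiField α β ζ (c • y) 2 = c⁻¹ * axiField α β ζ y 2
    rw [axiField_two, axiField_two, hom_smul _ _ _ hc, pow_one]

lemma axiField_eR (θ φ : ℝ) : axiField α β ζ (eR θ φ) =
    (Real.sin θ ^ 2 * α (Real.cos θ) + Real.cos θ * ζ (Real.cos θ)) • eR θ φ +
      (Real.sin θ * (Real.cos θ * α (Real.cos θ) - ζ (Real.cos θ))) • eTheta θ φ +
      (Real.sin θ * β (Real.cos θ)) • ePhi φ := by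
  have hθ := Real.sin_sq_add_cos_sq θ
  simp only [axiField, hom_eR]
  ext i
  fin_cases i <;> simp [eR, eTheta, ePhi] <;> grind

lemma isAxisymmetric_axiField : IsAxisymmetric (axiField α β ζ) := by
  intro r hr θ _ φ φ'
  simp only [compR, compTheta, compPhi, axiField_smul _ _ _ _ hr, axiField_eR, inner_smul_left,
    inner_frame_eR, inner_frame_eTheta, inner_frame_ePhi, and_self]

lemma UTheta_axiField {x : ℝ} (hx : x ∈ Ioo (-1 : ℝ) 1) :
    UTheta (axiField α β ζ) x = (1 - x ^ 2) * (x * α x - ζ x) := by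
  have hsq := Real.mul_self_sqrt (one_sub_sq_pos hx).le
  rw [UTheta_eq _ (Ioo_subset_Icc_self hx), axiField_zero, axiField_two, hom_meridian _ _ hx,
    hom_meridian _ _ hx, hom_meridian _ _ hx, meridian_zero, meridian_one]
  linear_combination (x * α x - ζ x) * hsq

lemma UPhi_axiField {x : ℝ} (hx : x ∈ Ioo (-1 : ℝ) 1) :
    UPhi (axiField α β ζ) x = (1 - x ^ 2) * β x := by
  have hsq := Real.mul_self_sqrt (one_sub_sq_pos hx).le
  rw [UPhi_eq _ (Ioo_subset_Icc_self hx), axiField_one, hom_meridian _ _ hx, hom_meridian _ _ hx,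
    meridian_zero, meridian_one]
  linear_combination β x * hsq

end AxiField

lemma slitSpace_subset_closure_offAxis : slitSpace ⊆ closure offAxis := by
  intro y _
  let shift : ℝ → R3 := fun t => y + t • EuclideanSpace.single 0 1
  have hshift : Tendsto shift (𝓝[≠] 0) (𝓝 y) := by
    have hcont : Continuous shift := by fun_prop
    simpa [shift] using (hcont.tendsto 0).mono_left nhdsWithin_le_nhds
  refine mem_closure_of_tendsto hshift ?_
  have hne : ∀ᶠ t : ℝ in 𝓝[≠] 0, t ≠ -y 0 := by
    by_cases h : y 0 = 0
    · rw [h, neg_zero]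
      exact self_mem_nhdsWithin
    · exact nhdsWithin_le_nhds (isOpen_ne.mem_nhds (neg_ne_zero.2 h).symm)
  filter_upwards [hne] with t ht
  have h0 : shift t 0 = y 0 + t := by simp [shift]
  have hpos : shift t 0 ≠ 0 := fun h => ht (by linarith)
  change 0 < shift t 0 ^ 2 + shift t 1 ^ 2
  positivity

lemma contDiffOn_advectionDiffusion {u : R3 → R3} {v : R3 → ℝ} {s : Set R3} (hs : IsOpen s)
    (hu : ContDiffOn ℝ ∞ u s) (hv : ContDiffOn ℝ ∞ v s) :
    ContDiffOn ℝ ∞ (advectionDiffusion u v) s := by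
  have hlap : ContDiffOn ℝ ∞ (Laplacian.laplacian v) s :=
    (ContDiffOn.sum fun i _ => contDiffOn_partialDeriv hs (contDiffOn_partialDeriv hs hv)).congr
      fun y hy => laplacian_eq_sum_partialDeriv hs hv hy
  have hadv : ContDiffOn ℝ ∞ (fun y => fderiv ℝ v y (u y)) s :=
    (hv.fderiv_of_isOpen hs (by simp)).clm_apply hu
  exact hlap.neg.add hadv

lemma SolvesNavierStokes.of_subset_closure {u : R3 → R3} {p : R3 → ℝ} {s t : Set R3}
    (h : SolvesNavierStokes u p s) (hs : IsOpen s) (ht : IsOpen t) (hst : s ⊆ t)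
    (hts : t ⊆ closure s) (hu : ContDiffOn ℝ ∞ u t) (hp : ContDiffOn ℝ ∞ p t) :
    SolvesNavierStokes u p t := by
  have hcoord : ∀ j, ContDiffOn ℝ ∞ (fun z => u z j) t := fun j =>
    (contDiff_coord j).comp_contDiffOn hu
  have hmom : ∀ j, EqOn (fun y => advectionDiffusion u (fun z => u z j) y + partialDeriv j p y)
      0 t := fun j => EqOn.of_subset_closure
    (fun y hy => (momentum_equation_iff hs (hu.mono hst) hy).1 (h y hy).1 j)
    ((contDiffOn_advectionDiffusion ht hu (hcoord j)).add
      (contDiffOn_partialDeriv ht hp)).continuousOn continuousOn_const hst hts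
  have hdiv : EqOn (fun y => ∑ i, partialDeriv i (fun z => u z i) y) 0 t :=
    EqOn.of_subset_closure
      (fun y hy => (divergence_eq_sum_partialDeriv
        (differentiableAt_of_contDiffOn hu ht (hst hy))).symm.trans (h y hy).2)
      (ContDiffOn.sum fun i _ => contDiffOn_partialDeriv ht (hcoord i)).continuousOn
      continuousOn_const hst hts
  exact fun y hy => ⟨(momentum_equation_iff ht hu hy).2 fun j => hmom j hy,
    (divergence_eq_sum_partialDeriv (differentiableAt_of_contDiffOn hu ht hy)).trans (hdiv hy)⟩

lemma solvesNavierStokes_axiField {α β ζ π : ℝ → ℝ} (hα : ContDiffOn ℝ ∞ α (Ioo (-1) 1))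
    (hβ : ContDiffOn ℝ ∞ β (Ioo (-1) 1)) (hζ : ContDiffOn ℝ ∞ ζ (Ioo (-1) 1))
    (hπ : ContDiffOn ℝ ∞ π (Ioo (-1) 1))
    (hradial : ∀ x ∈ Ioo (-1 : ℝ) 1, radialRes α β ζ x + 2 * rhoOp 2 π x = 0)
    (hswirl : ∀ x ∈ Ioo (-1 : ℝ) 1, swirlRes α β ζ x = 0)
    (haxial : ∀ x ∈ Ioo (-1 : ℝ) 1, axialRes α ζ x + zOp 2 π x = 0)
    (hdiv : ∀ x ∈ Ioo (-1 : ℝ) 1, divRes α ζ x = 0) :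
    SolvesNavierStokes (axiField α β ζ) (hom 2 π) offAxis := by
  intro y hy
  have hx := cosPolar_mem_Ioo hy
  have hu := contDiffOn_axiField_offAxis hα hβ hζ
  refine ⟨(momentum_equation_iff isOpen_offAxis hu hy).2 fun j => ?_, ?_⟩
  · fin_cases j
    · change advectionDiffusion _ (fun z => axiField α β ζ z 0) y + partialDeriv 0 (hom 2 π) y = 0
      rw [advectionDiffusion_axiField_zero hα hβ hy, hswirl _ hx,
        partialDeriv_hom_horizontal hπ hy (by decide), hom]
      linear_combination (‖y‖ ^ 4)⁻¹ * y 0 * hradial _ hx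
    · change advectionDiffusion _ (fun z => axiField α β ζ z 1) y + partialDeriv 1 (hom 2 π) y = 0
      rw [advectionDiffusion_axiField_one hα hβ hy, hswirl _ hx,
        partialDeriv_hom_horizontal hπ hy (by decide), hom]
      linear_combination (‖y‖ ^ 4)⁻¹ * y 1 * hradial _ hx
    · change advectionDiffusion _ (fun z => axiField α β ζ z 2) y + partialDeriv 2 (hom 2 π) y = 0
      rw [advectionDiffusion_axiField_two hζ hy, partialDeriv_hom_two hπ hy, hom]
      linear_combination (‖y‖ ^ 3)⁻¹ * haxial _ hx
  · rw [divergence_eq_sum_partialDeriv (differentiableAt_of_contDiffOn hu isOpen_offAxis hy),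
      sum_partialDeriv_axiField hα hβ hζ hy, hdiv _ hx, mul_zero]

namespace IsProfile

variable {f g α β ζ π : ℝ → ℝ}

lemma solvesNavierStokes (h : IsProfile f g α β ζ) (hfg : ProfileEquations f g)
    (hπ : ContDiffOn ℝ ∞ π (Ioo (-1) 1))
    (hpressure : EqOn π (fun x => pressureForm f g x / 2) (Ioo (-1) 1)) :
    SolvesNavierStokes (axiField α β ζ) (hom 2 π) offAxis := by
  have hderiv : EqOn (deriv π) (polarForm f g) (Ioo (-1) 1) :=
    eqOn_deriv_of_hasDerivAt isOpen_Ioo hpressure fun x hx =>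
      ((hasDerivAt_pressureForm h.smooth_f h.smooth_g hx).div_const 2).congr_deriv (by
        rw [hfg.meridian x hx, sub_zero, mul_div_cancel_left₀ _ two_ne_zero])
  refine solvesNavierStokes_axiField h.contDiffOn_radial h.contDiffOn_swirl h.contDiffOn_axial hπ
    (fun x hx => ?_) (fun x hx => ?_) (fun x hx => ?_) fun x hx => h.divRes_eq_zero hx
  · rw [h.radialRes_eq hx, rhoOp, hderiv hx, hpressure hx]
    push_cast
    ring
  · rw [h.swirlRes_eq hx, hfg.swirl x hx, neg_zero, zero_div]
  · rw [h.axialRes_eq hx, zOp, hderiv hx, hpressure hx]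
    push_cast
    ring

lemma isAxisymmetricSolution (h : IsProfile f g α β ζ) (hfg : ProfileEquations f g)
    (hpressure : EqOn π (fun x => pressureForm f g x / 2) (Ioo (-1) 1)) {J : Set ℝ}
    (hJ : Ioc (-1) 1 ⊆ J) (hα : ContDiffOn ℝ ∞ α J) (hβ : ContDiffOn ℝ ∞ β J)
    (hζ : ContDiffOn ℝ ∞ ζ J) (hπ : ContDiffOn ℝ ∞ π J) :
    IsAxisymmetricSolution (axiField α β ζ) (hom 2 π) := by
  have hne : ∀ y ∈ slitSpace, y ≠ 0 := fun _ => ne_zero_of_mem_slitSpace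
  have hmaps : MapsTo cosPolar slitSpace J := fun _ hy => hJ (cosPolar_mem_Ioc hy)
  have hu := contDiffOn_axiField hne hmaps hα hβ hζ
  have hp : ContDiffOn ℝ ∞ (hom 2 π) slitSpace := contDiffOn_hom hne hmaps hπ
  exact
    { smooth_velocity := hu
      smooth_pressure := hp
      homogeneous_velocity := fun y _ _ hc => axiField_smul α β ζ y hc
      homogeneous_pressure := fun y _ _ hc => hom_smul 2 π y hc
      axisymmetric := isAxisymmetric_axiField α β ζ
      equations := (h.solvesNavierStokes hfg (hπ.mono (Ioo_subset_Ioc_self.trans hJ))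
        hpressure).of_subset_closure isOpen_offAxis isOpen_slitSpace offAxis_subset_slitSpace
        slitSpace_subset_closure_offAxis hu hp }

lemma UTheta_eq (h : IsProfile f g α β ζ) {x : ℝ} (hx : x ∈ Ioo (-1 : ℝ) 1) :
    UTheta (axiField α β ζ) x = f x := by
  have hw := (one_sub_sq_pos hx).ne'
  rw [UTheta_axiField _ _ _ hx, h.eqOn_radial hx, h.eqOn_axial hx]
  field_simp
  ring

lemma UPhi_eq (h : IsProfile f g α β ζ) {x : ℝ} (hx : x ∈ Ioo (-1 : ℝ) 1) :
    UPhi (axiField α β ζ) x = g x := by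
  rw [UPhi_axiField _ _ _ hx, h.eqOn_swirl hx, mul_div_cancel₀ _ (one_sub_sq_pos hx).ne']

end IsProfile

section NorthPole

variable {ψ γ f g : ℝ → ℝ}

lemma exists_isProfile_of_eq_one_sub_mul (hψ : ContDiffOn ℝ ∞ ψ (Ioo (-1) 2))
    (hγ : ContDiffOn ℝ ∞ γ (Ioo (-1) 2)) (hf : f = fun x => (1 - x) * ψ x)
    (hg : g = fun x => (1 - x) * γ x) : ∃ α β ζ, IsProfile f g α β ζ ∧
      ContDiffOn ℝ ∞ α (Ioo (-1) 2) ∧ ContDiffOn ℝ ∞ β (Ioo (-1) 2) ∧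
      ContDiffOn ℝ ∞ ζ (Ioo (-1) 2) := by
  have sf : ContDiffOn ℝ ∞ f (Ioo (-1) 2) := hf ▸ ContDiffOn.mul (by fun_prop) hψ
  have sg : ContDiffOn ℝ ∞ g (Ioo (-1) 2) := hg ▸ ContDiffOn.mul (by fun_prop) hγ
  have sf' := contDiffOn_deriv sf isOpen_Ioo
  have hsub : Ioo (-1 : ℝ) 1 ⊆ Ioo (-1) 2 := Ioo_subset_Ioo_right one_le_two
  have hadd : ∀ x ∈ Ioo (-1 : ℝ) 2, 1 + x ≠ 0 := fun x hx => by linarith [hx.1]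
  refine ⟨fun x => deriv f x + x * ψ x / (1 + x), fun x => γ x / (1 + x),
    fun x => x * deriv f x - f x,
    ⟨sf.mono hsub, sg.mono hsub, fun x hx => ?_, fun x hx => ?_, fun x _ => rfl⟩,
    sf'.add ((contDiffOn_id.mul hψ).div (by fun_prop) hadd), hγ.div (by fun_prop) hadd,
    (contDiffOn_id.mul sf').sub sf⟩
  all_goals
    have h₁ : 1 - x ≠ 0 := by linarith [hx.2]
    have h₂ := hadd x (hsub hx)
    simp only [hf, hg, show 1 - x ^ 2 = (1 - x) * (1 + x) by ring]
    field_simp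

lemma exists_pressure_of_eq_one_sub_mul (hψ : ContDiffOn ℝ ∞ ψ (Ioo (-1) 2))
    (hγ : ContDiffOn ℝ ∞ γ (Ioo (-1) 2)) (hf : f = fun x => (1 - x) * ψ x)
    (hg : g = fun x => (1 - x) * γ x) : ∃ π, ContDiffOn ℝ ∞ π (Ioo (-1) 2) ∧
      EqOn π (fun x => pressureForm f g x / 2) (Ioo (-1) 1) := by
  have sf : ContDiffOn ℝ ∞ f (Ioo (-1) 2) := hf ▸ ContDiffOn.mul (by fun_prop) hψ
  have sf' := contDiffOn_deriv sf isOpen_Ioo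
  have sf'' := contDiffOn_deriv sf' isOpen_Ioo
  have sf''' := contDiffOn_deriv sf'' isOpen_Ioo
  refine ⟨fun x => (-(1 - x ^ 2) * deriv (deriv (deriv f)) x + 2 * x * deriv (deriv f) x -
    f x * deriv (deriv f) x - deriv f x ^ 2 - (1 - x) * (ψ x ^ 2 + γ x ^ 2) / (1 + x)) / 2,
    ?_, fun x hx => ?_⟩
  · refine (ContDiffOn.sub (by fun_prop) (ContDiffOn.div (by fun_prop) (by fun_prop)
      fun x hx => ?_)).div_const 2
    linarith [hx.1]
  · have h₁ : 1 - x ≠ 0 := by linarith [hx.2]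
    have h₂ : 1 + x ≠ 0 := by linarith [hx.1]
    have hquot : (f x ^ 2 + g x ^ 2) / (1 - x ^ 2) = (1 - x) * (ψ x ^ 2 + γ x ^ 2) / (1 + x) := by
      simp only [hf, hg, show 1 - x ^ 2 = (1 - x) * (1 + x) by ring]
      field_simp
    simp only [pressureForm, hquot]

end NorthPole

theorem exists_swirling_solution {τ : ℝ} (hτ : τ < 3) :
    ∃ (u : R3 → R3) (p : R3 → ℝ), IsAxisymmetricSolution u p ∧ UThetaAtSouth u τ ∧
      ∃ x ∈ Ioo (-1 : ℝ) 1, UPhi u x ≠ 0 := by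
  obtain ⟨ψ, γ, hψ, hγ, hfg, hlim, hγ0⟩ := exists_swirling_profile (m := τ / 2) (by linarith)
  obtain ⟨α, β, ζ, hprofile, hα, hβ, hζ⟩ := exists_isProfile_of_eq_one_sub_mul hψ hγ rfl rfl
  obtain ⟨π, hπ, hpressure⟩ := exists_pressure_of_eq_one_sub_mul hψ hγ rfl rfl
  have hf : Tendsto (fun x => (1 - x) * ψ x) (𝓝[>] (-1)) (𝓝 τ) := by
    have hsub : Tendsto (fun x : ℝ => 1 - x) (𝓝[>] (-1)) (𝓝 (1 - -1)) :=
      (Continuous.tendsto (by fun_prop) (-1)).mono_left nhdsWithin_le_nhds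
    convert hsub.mul hlim using 2
    ring
  have h0 : (0 : ℝ) ∈ Ioo (-1 : ℝ) 1 := by norm_num
  refine ⟨axiField α β ζ, hom 2 π, hprofile.isAxisymmetricSolution hfg hpressure
    (Ioc_subset_Ioo_right one_lt_two) hα hβ hζ hπ, hf.congr' ?_, 0, h0, ?_⟩
  · filter_upwards [Ioo_mem_nhdsGT (show (-1 : ℝ) < 1 by norm_num)] with x hx
      using (hprofile.UTheta_eq hx).symm
  · rw [hprofile.UPhi_eq h0]
    simpa using hγ0

end AxisymNS

end

theorem mainTheorem5 :
    (∀ τ : ℝ, τ < 3 →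
      ∃ (u : AxisymNS.R3 → AxisymNS.R3) (p : AxisymNS.R3 → ℝ),
        AxisymNS.IsAxisymmetricSolution u p ∧
        AxisymNS.UThetaAtSouth u τ ∧
        ∃ x ∈ Set.Ioo (-1 : ℝ) 1, AxisymNS.UPhi u x ≠ 0) ∧
    (∀ (u : AxisymNS.R3 → AxisymNS.R3) (p : AxisymNS.R3 → ℝ),
      AxisymNS.IsAxisymmetricSolution u p →
      ∃ a : ℝ, AxisymNS.UThetaAtSouth u a ∧
        (3 ≤ a → ∀ x ∈ Set.Ioc (-1 : ℝ) 1, AxisymNS.UPhi u x = 0)) :=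
  ⟨fun _ hτ => AxisymNS.exists_swirling_solution hτ, fun _ _ h => h.exists_UThetaAtSouth⟩
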